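/- Let $G$ be a finite simple graph. A graph $H$ is an induced minor of $G$ if it can be obtained from $G$ by vertex deletions and edge contractions; equivalently, if there are pairwise disjoint sets $X_u\subseteq V(G)$ $(u\in V(H))$, each inducing a (nonempty) connected subgraph of $G$, such that for all distinct $u,v\in V(H)$ there is an edge of $G$ between $X_u$ and $X_v$ if and only if $uv\in E(H)$; $G$ is $H$-induced-minor-free if $H$ is not an induced minor of $G$. Let $K_5^-$ be the graph obtained from the complete graph $K_5$ by deleting an edge, and let $W_4$ be the graph obtained from the cycle $C_4$ by adding a universal vertex. Let $\eta(G)$ be the Hadwiger number of $G$, that is, the maximum integer $p$ such that $K_p$ is a minor of $G$, and let $\mathrm{tw}(G)$ be the treewidth of $G$, that is, the minimum over all tree decompositions $(T,\{X_t\}_{t\in V(T)})$ of $G$ (with $T$ a finite tree) of $\max_{t\in V(T)}|X_t|-1$. (For the graph without vertices, $\eta=0$ and $\mathrm{tw}=-1$.) 1. If $G$ is $K_5^-$-induced-minor-free, then $\mathrm{tw}(G)=\eta(G)-1$. 2. If $G$ is $W_4$-induced-minor-free, then $\mathrm{tw}(G)=\eta(G)-1$. -/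

import Mathlib

namespace SimpleGraph

/-- `X` is a minor model of `H` in `G`: pairwise disjoint vertex sets, each inducing a connected
(in particular nonempty) subgraph, with an edge of `G` between `X u` and `X v` whenever `u` and `v`
are adjacent in `H`. -/
structure IsMinorModel {V W : Type*} (H : SimpleGraph W) (G : SimpleGraph V) (X : W → Set V) :
    Prop where
  disjoint : ∀ u v, u ≠ v → Disjoint (X u) (X v)
  connected : ∀ u, (G.induce (X u)).Connected
  adj : ∀ u v, H.Adj u v → ∃ x ∈ X u, ∃ y ∈ X v, G.Adj x y

/-- `X` is an induced minor model of `H` in `G`: as a minor model, but for distinct `u`, `v` there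
is an edge of `G` between `X u` and `X v` if and only if `u` and `v` are adjacent in `H`. -/
structure IsInducedMinorModel {V W : Type*} (H : SimpleGraph W) (G : SimpleGraph V)
    (X : W → Set V) : Prop where
  disjoint : ∀ u v, u ≠ v → Disjoint (X u) (X v)
  connected : ∀ u, (G.induce (X u)).Connected
  adj_iff : ∀ u v, u ≠ v → ((∃ x ∈ X u, ∃ y ∈ X v, G.Adj x y) ↔ H.Adj u v)

/-- `H` is a minor of `G`. -/
def IsMinor {V W : Type*} (H : SimpleGraph W) (G : SimpleGraph V) : Prop :=
  ∃ X : W → Set V, IsMinorModel H G X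

/-- `H` is an induced minor of `G`. -/
def IsInducedMinor {V W : Type*} (H : SimpleGraph W) (G : SimpleGraph V) : Prop :=
  ∃ X : W → Set V, IsInducedMinorModel H G X

/-- `G` is `H`-induced-minor-free. -/
def InducedMinorFree {V W : Type*} (G : SimpleGraph V) (H : SimpleGraph W) : Prop :=
  ¬ IsInducedMinor H G

/-- `K₅⁻`, the complete graph on five vertices minus one edge. -/
def K5Minus : SimpleGraph (Fin 5) :=
  (completeGraph (Fin 5)).deleteEdges {s(0, 1)}

/-- The `n`-wheel (for `n ≥ 3`): the cycle `Cₙ` on the vertices `some i`, together with a universal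
vertex `none`. -/
def wheelGraph (n : ℕ) : SimpleGraph (Option (Fin n)) where
  Adj
    | none, none => False
    | none, some _ => True
    | some _, none => True
    | some i, some j => (cycleGraph n).Adj i j
  symm := ⟨by
    rintro (_ | i) (_ | j) h
    · exact h
    · trivial
    · trivial
    · exact (cycleGraph n).adj_symm h⟩
  loopless := ⟨by
    rintro (_ | i) h
    · exact h
    · exact (cycleGraph n).irrefl h⟩

/-- The Hadwiger number of a (finite) graph: the maximum `p` such that `K_p` is a minor. -/
noncomputable def hadwigerNumber {V : Type*} (G : SimpleGraph V) : ℕ :=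
  sSup {p : ℕ | IsMinor (completeGraph (Fin p)) G}

/-- A tree decomposition of `G` whose tree has node set `ι`. -/
structure TreeDecomposition {V : Type*} (G : SimpleGraph V) (ι : Type*) where
  tree : SimpleGraph ι
  isTree : tree.IsTree
  bag : ι → Set V
  exists_mem_bag : ∀ v : V, ∃ t, v ∈ bag t
  exists_edge_bag : ∀ u v : V, G.Adj u v → ∃ t, u ∈ bag t ∧ v ∈ bag t
  connected : ∀ v : V, (tree.induce {t | v ∈ bag t}).Connected

/-- The width `max_t |X_t| - 1` of a tree decomposition (of a finite graph, with a finite tree).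
It is an integer, so that an empty bag contributes `-1`. -/
noncomputable def TreeDecomposition.width {V ι : Type*} {G : SimpleGraph V}
    (D : TreeDecomposition G ι) : ℤ :=
  ⨆ t : ι, ((D.bag t).ncard : ℤ) - 1

/-- The treewidth of a (finite) graph: the minimum width of a tree decomposition. Every finite tree
is isomorphic to one with node set `Fin n`. -/
noncomputable def treewidth {V : Type*} (G : SimpleGraph V) : ℤ :=
  sInf {w : ℤ | ∃ (n : ℕ) (D : TreeDecomposition G (Fin n)), D.width = w}

/-- On a finite graph the maximum in the definition of the Hadwiger number exists. -/
theorem isGreatest_hadwigerNumber {V : Type*} [Finite V] (G : SimpleGraph V) :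
    IsGreatest {p : ℕ | IsMinor (completeGraph (Fin p)) G} G.hadwigerNumber := by
  have hne : {p : ℕ | IsMinor (completeGraph (Fin p)) G}.Nonempty :=
    ⟨0, fun i => i.elim0, ⟨fun i => i.elim0, fun i => i.elim0, fun i => i.elim0⟩⟩
  have hb : BddAbove {p : ℕ | IsMinor (completeGraph (Fin p)) G} := by
    refine ⟨Nat.card V, ?_⟩
    rintro p ⟨X, hX⟩
    have hn : ∀ i, ∃ x, x ∈ X i := fun i => by
      obtain ⟨x⟩ := (hX.connected i).nonempty
      exact ⟨x.1, x.2⟩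
    choose f hf using hn
    have hinj : Function.Injective f := by
      intro i j hij
      by_contra hne
      exact Set.disjoint_left.mp (hX.disjoint i j hne) (hf i) (hij ▸ hf j)
    simpa using Nat.card_le_card_of_injective f hinj
  exact ⟨Nat.sSup_mem hne hb, fun p hp => le_csSup hb hp⟩

/-- On a finite graph the maximum in the definition of the width exists. -/
theorem TreeDecomposition.isGreatest_width {V ι : Type*} [Finite ι] {G : SimpleGraph V}
    (D : TreeDecomposition G ι) :
    IsGreatest (Set.range fun t : ι => ((D.bag t).ncard : ℤ) - 1) D.width := by
  have : Nonempty ι := D.isTree.connected.nonempty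
  have hf := Set.finite_range fun t : ι => ((D.bag t).ncard : ℤ) - 1
  exact ⟨(Set.range_nonempty _).csSup_mem hf, fun w hw => le_csSup hf.bddAbove hw⟩

/-- The minimum in the definition of treewidth exists. -/
theorem isLeast_treewidth {V : Type*} (G : SimpleGraph V) :
    IsLeast {w : ℤ | ∃ (n : ℕ) (D : TreeDecomposition G (Fin n)), D.width = w} G.treewidth := by
  have hne : {w : ℤ | ∃ (n : ℕ) (D : TreeDecomposition G (Fin n)), D.width = w}.Nonempty := by
    refine ⟨_, 1, ⟨⊥, IsTree.of_subsingleton, fun _ => Set.univ, fun v => ⟨0, trivial⟩,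
      fun u v _ => ⟨0, trivial, trivial⟩, fun v => ?_⟩, rfl⟩
    have : Nonempty {t : Fin 1 | v ∈ (Set.univ : Set V)} := ⟨⟨0, trivial⟩⟩
    exact Connected.of_subsingleton
  have hb : BddBelow {w : ℤ | ∃ (n : ℕ) (D : TreeDecomposition G (Fin n)), D.width = w} := by
    refine ⟨-1, ?_⟩
    rintro w ⟨n, D, rfl⟩
    obtain ⟨t, ht⟩ := D.isGreatest_width.1
    rw [← ht]
    have := Int.natCast_nonneg (D.bag t).ncard
    show (-1 : ℤ) ≤ ((D.bag t).ncard : ℤ) - 1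
    omega
  exact ⟨Int.csInf_mem hne hb, fun w hw => csInf_le hb hw⟩

end SimpleGraph

/-! The bound η − 1 ≤ tw holds for every graph. Connected subsets of a tree have the Helly property,
so some bag meets all the disjoint branch sets of a K_η model
(`hadwigerNumber_sub_one_le_treewidth`).

For the converse, a decomposition with bags of size at most η is built by induction on |V(G)|. Both
graph classes are closed under induced minors, and η does not grow when passing to a minor. Across a
clique cutset, decompositions of the two sides can be glued. A nonadjacent 2-cutset {a, b} becomes a
clique when the far side is contracted into a. What remains is a complete graph, where one bag
suffices, or a non-complete `WellLinked` graph (`tdOn_or_wellLinked`).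

For W₄ this ends the proof: a well-linked non-complete graph has W₄ as an induced minor
(`WellLinked.isInducedMinor_wheelGraph`).

For K₅⁻ the tool is surgery on minor models that cover all vertices. In a well-linked graph, a
branch set with more than one vertex and at least three touched neighbours can lose a part to a
neighbouring branch set, or be cut into two parts touching at least two branch sets each, or be cut
into three mutually touching parts with one private neighbour each (`SpanModel.exists_cut`). The
last two outcomes are turned into larger or forbidden minors, so the branch set shrinks to a vertex
(`WellLinked.shrink`). If η ≥ 5, all branch sets of a K_η model shrink, so G is complete
(`WellLinked.complete_of_five_le`). If η ≤ 4, a K₅⁻ minor would already be an induced one, as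
otherwise K₅ would be a minor; hence there is no K₅⁻ minor. The W₄ found above then leads, possibly
through a prism or K₃,₃ minor, to a degree-3 vertex with two adjacent neighbours or to two degree-3
vertices with the same neighbours (`WellLinked.cubic_of_isMinor_wheelGraph`). Contracting these
vertices into their neighbourhood makes it a clique, so induction applies and they are put back in
bags of size 4 ≤ η. -/

namespace SimpleGraph

/-! ### Connected sets, touching sets and components. -/

/-- A vertex set that induces a connected subgraph, described through its cuts. -/
def ConnSet {V : Type*} (G : SimpleGraph V) (S : Set V) : Prop :=
  S.Nonempty ∧ ∀ U ⊆ S, U.Nonempty → U ≠ S → ∃ u ∈ U, ∃ w ∈ S \ U, G.Adj u w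

/-- There is an edge between the two vertex sets. -/
def Touch {V : Type*} (G : SimpleGraph V) (A B : Set V) : Prop :=
  ∃ x ∈ A, ∃ y ∈ B, G.Adj x y

/-- The outer vertex boundary of a vertex set. -/
def bdry {V : Type*} (G : SimpleGraph V) (C : Set V) : Set V :=
  {v | v ∉ C ∧ ∃ c ∈ C, G.Adj c v}

section Toolkit

variable {V : Type*} {G : SimpleGraph V} {A B C S : Set V} {x y : V}

theorem connSet_iff : G.ConnSet S ↔ (G.induce S).Connected := by
  constructor
  · rintro ⟨⟨u, hu⟩, h⟩
    have : Nonempty S := ⟨⟨u, hu⟩⟩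
    have key : ∀ x : S, (G.induce S).Reachable ⟨u, hu⟩ x := by
      by_contra! hc
      obtain ⟨x, hx⟩ := hc
      obtain ⟨a, ⟨ha, hra⟩, b, ⟨hb, hnb⟩, hab⟩ :=
        h {y | ∃ hy : y ∈ S, (G.induce S).Reachable ⟨u, hu⟩ ⟨y, hy⟩} (fun y hy => hy.1)
          ⟨u, hu, Reachable.refl _⟩ (fun he => by
            have : x.1 ∈ {y | ∃ hy : y ∈ S, (G.induce S).Reachable ⟨u, hu⟩ ⟨y, hy⟩} := by
              rw [he]; exact x.2
            exact hx this.2)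
      exact hnb ⟨hb, hra.trans (Adj.reachable (by simpa using hab))⟩
    exact ⟨fun a b => (key a).symm.trans (key b)⟩
  · intro h
    obtain ⟨⟨s, hs⟩⟩ := h.nonempty
    refine ⟨⟨s, hs⟩, fun U hU ⟨u, hu⟩ hne => ?_⟩
    obtain ⟨w, hw, hwU⟩ : ∃ w ∈ S, w ∉ U := by
      by_contra! hc
      exact hne (hU.antisymm hc)
    obtain ⟨p⟩ := h.preconnected ⟨u, hU hu⟩ ⟨w, hw⟩
    obtain ⟨d, -, h1, h2⟩ := p.exists_boundary_dart {z | z.1 ∈ U} hu hwU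
    exact ⟨d.fst.1, h1, d.snd.1, ⟨d.snd.2, h2⟩, by simpa using d.adj⟩

theorem Touch.symm (h : G.Touch A B) : G.Touch B A := by
  obtain ⟨x, hx, y, hy, h⟩ := h
  exact ⟨y, hy, x, hx, h.symm⟩

theorem touch_comm : G.Touch A B ↔ G.Touch B A := ⟨Touch.symm, Touch.symm⟩

theorem Touch.mono {A' B' : Set V} (h : G.Touch A B) (hA : A ⊆ A') (hB : B ⊆ B') :
    G.Touch A' B' := by
  obtain ⟨x, hx, y, hy, h⟩ := h
  exact ⟨x, hA hx, y, hB hy, h⟩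

theorem Touch.left (h : G.Touch A B) (hA : A ⊆ C) : G.Touch C B := h.mono hA subset_rfl

theorem Touch.right (h : G.Touch A B) (hB : B ⊆ C) : G.Touch A C := h.mono subset_rfl hB

theorem touch_union_left : G.Touch (A ∪ B) C ↔ G.Touch A C ∨ G.Touch B C := by
  constructor
  · rintro ⟨x, hx | hx, y, hy, h⟩
    exacts [.inl ⟨x, hx, y, hy, h⟩, .inr ⟨x, hx, y, hy, h⟩]
  · rintro (h | h)
    exacts [h.left Set.subset_union_left, h.left Set.subset_union_right]

theorem touch_singleton : G.Touch {x} {y} ↔ G.Adj x y := by simp [Touch]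

theorem touch_singleton_left : G.Touch {x} A ↔ ∃ y ∈ A, G.Adj x y := by simp [Touch]

theorem connSet_singleton (x : V) : G.ConnSet {x} := by
  refine ⟨⟨x, rfl⟩, fun U hU hne hn => ?_⟩
  exact absurd (hU.antisymm (by obtain ⟨u, hu⟩ := hne; rintro _ rfl; exact hU hu ▸ hu)) hn

theorem ConnSet.touch_diff (h : G.ConnSet S) (hA : A ⊆ S) (hne : A.Nonempty) (hn : A ≠ S) :
    G.Touch A (S \ A) := h.2 A hA hne hn

theorem ConnSet.union (hA : G.ConnSet A) (hB : G.ConnSet B)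
    (h : (A ∩ B).Nonempty ∨ G.Touch A B) : G.ConnSet (A ∪ B) := by
  refine ⟨hA.1.mono Set.subset_union_left, fun U hU hne hn => ?_⟩
  by_contra! hc
  -- No edge leaves `U` inside `A ∪ B`, so `U` swallows every connected set that it meets.
  have key : ∀ D, G.ConnSet D → D ⊆ A ∪ B → (D ∩ U).Nonempty → D ⊆ U := by
    intro D hD hDs hDU
    by_contra hDn
    obtain ⟨u, hu, w, hw, huw⟩ := hD.2 (D ∩ U) Set.inter_subset_left hDU
      (fun he => hDn (Set.inter_eq_left.mp he))
    exact hc u hu.2 w ⟨hDs hw.1, fun hwU => hw.2 ⟨hw.1, hwU⟩⟩ huw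
  have kA := key A hA Set.subset_union_left
  have kB := key B hB Set.subset_union_right
  have hAB : (A ∩ U).Nonempty ↔ (B ∩ U).Nonempty := by
    rcases h with ⟨z, hzA, hzB⟩ | ⟨a, ha, b, hb, hab⟩
    · exact ⟨fun h => ⟨z, hzB, kA h hzA⟩, fun h => ⟨z, hzA, kB h hzB⟩⟩
    · constructor
      · intro h
        refine ⟨b, hb, ?_⟩
        by_contra hbU
        exact hc a (kA h ha) b ⟨.inr hb, hbU⟩ hab
      · intro h
        refine ⟨a, ha, ?_⟩
        by_contra haU
        exact hc b (kB h hb) a ⟨.inl ha, haU⟩ hab.symm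
  obtain ⟨u, hu⟩ := hne
  have hA' : (A ∩ U).Nonempty := by
    rcases hU hu with h | h
    exacts [⟨u, h, hu⟩, hAB.mpr ⟨u, h, hu⟩]
  exact hn (hU.antisymm (Set.union_subset (kA hA') (kB (hAB.mp hA'))))

theorem ConnSet.insert (hA : G.ConnSet A) (h : G.Touch A {x}) : G.ConnSet (insert x A) := by
  rw [Set.insert_eq, Set.union_comm]
  exact hA.union (connSet_singleton x) (.inr h)

/-- `K` is a component of `G[S]`. -/
structure IsComp (G : SimpleGraph V) (S K : Set V) : Prop where
  conn : G.ConnSet K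
  sub : K ⊆ S
  notTouch : ¬ G.Touch K (S \ K)

theorem exists_isComp_superset [Finite V] (hA : G.ConnSet A) (hAS : A ⊆ S) :
    ∃ K, G.IsComp S K ∧ A ⊆ K := by
  obtain ⟨K, ⟨hK, hKS, hAK⟩, hmax⟩ := Set.Finite.exists_maximal
    (s := {K | G.ConnSet K ∧ K ⊆ S ∧ A ⊆ K}) (Set.toFinite _) ⟨A, hA, hAS, subset_rfl⟩
  refine ⟨K, ⟨hK, hKS, ?_⟩, hAK⟩
  rintro ⟨k, hk, z, ⟨hzS, hzK⟩, hkz⟩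
  have := hmax (y := Insert.insert z K) ⟨hK.insert ⟨k, hk, z, rfl, hkz⟩, Set.insert_subset hzS hKS,
    hAK.trans (Set.subset_insert _ _)⟩ (Set.subset_insert _ _)
  exact hzK (this (Set.mem_insert _ _))

theorem exists_isComp_mem [Finite V] (hx : x ∈ S) : ∃ K, G.IsComp S K ∧ x ∈ K := by
  obtain ⟨K, hK, h⟩ := exists_isComp_superset (connSet_singleton (G := G) x)
    (Set.singleton_subset_iff.mpr hx)
  exact ⟨K, hK, h rfl⟩

theorem IsComp.mem_of_adj (h : G.IsComp S C) (hx : x ∈ C) (hy : y ∈ S) (hxy : G.Adj x y) :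
    y ∈ C := by
  by_contra hn
  exact h.notTouch ⟨x, hx, y, ⟨hy, hn⟩, hxy⟩

/-- A connected set inside `S` that meets or touches a component lies in it. -/
theorem IsComp.subset_of_conn (h : G.IsComp S C) (hA : G.ConnSet A) (hAS : A ⊆ S)
    (hAC : (A ∩ C).Nonempty) : A ⊆ C := by
  by_contra hn
  obtain ⟨u, hu, w, hw, huw⟩ := hA.2 (A ∩ C) Set.inter_subset_left hAC
    (fun he => hn (Set.inter_eq_left.mp he))
  exact hw.2 ⟨hw.1, h.mem_of_adj hu.2 (hAS hw.1) huw⟩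

theorem IsComp.disjoint_of_ne {D : Set V} (h : G.IsComp S C) (h' : G.IsComp S D) (hne : C ≠ D) :
    Disjoint C D := by
  rw [Set.disjoint_iff_inter_eq_empty, ← Set.not_nonempty_iff_eq_empty]
  intro hn
  exact hne ((h'.subset_of_conn h.conn h.sub hn).antisymm
    (h.subset_of_conn h'.conn h'.sub (by rwa [Set.inter_comm])))

/-- Removing a component of `S \ {p}` from a connected set `S` leaves a connected set. -/
theorem ConnSet.diff_isComp {p : V} (hS : G.ConnSet S) (hp : p ∈ S) (hC : G.IsComp (S \ {p}) C) :
    G.ConnSet (S \ C) := by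
  have hpC : p ∉ C := fun h => (hC.sub h).2 rfl
  refine ⟨⟨p, hp, hpC⟩, fun U hU hne hn => ?_⟩
  by_cases hpU : p ∈ U
  -- Enlarging `U` by `C` forces the crossing edge to start in `U`: inside `S`, the only vertex
  -- outside `C` that can be adjacent to `C` is `p`, which is in `U`.
  · obtain ⟨u, hu, w, hw, huw⟩ := hS.2 (U ∪ C)
      (Set.union_subset (hU.trans Set.sdiff_subset) (hC.sub.trans Set.sdiff_subset))
      (hne.mono Set.subset_union_left) (fun he => hn (hU.antisymm (by
        rintro z ⟨hz, hzC⟩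
        rw [← he] at hz
        exact hz.resolve_right hzC)))
    have hwC : w ∉ C := fun h => hw.2 (.inr h)
    have hwU : w ∉ U := fun h => hw.2 (.inl h)
    rcases hu with hu | hu
    · exact ⟨u, hu, w, ⟨⟨hw.1, hwC⟩, hwU⟩, huw⟩
    · exact absurd (hC.mem_of_adj hu ⟨hw.1, fun h => hwU (by rw [h]; exact hpU)⟩ huw) hwC
  · obtain ⟨u, hu, w, hw, huw⟩ := hS.2 U (hU.trans Set.sdiff_subset) hne
      (fun he => hpU (he ▸ hp))
    refine ⟨u, hu, w, ⟨⟨hw.1, fun hwC => (hU hu).2 (hC.mem_of_adj hwC ⟨(hU hu).1, ?_⟩ huw.symm)⟩,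
      hw.2⟩, huw⟩
    exact fun h => hpU (by rw [← Set.mem_singleton_iff.mp h]; exact hu)

theorem ConnSet.isComp_touch {p : V} (hS : G.ConnSet S) (hp : p ∈ S)
    (hC : G.IsComp (S \ {p}) C) : G.Touch C {p} := by
  obtain ⟨u, hu, w, hw, huw⟩ := hS.2 C (hC.sub.trans Set.sdiff_subset) hC.conn.1
    (fun he => (hC.sub (he.symm ▸ hp : p ∈ C)).2 rfl)
  by_cases hwp : w = p
  · exact ⟨u, hu, w, hwp, huw⟩
  · exact absurd (hC.mem_of_adj hu ⟨hw.1, hwp⟩ huw) hw.2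

/-- In a connected set, two nonadjacent vertices are joined through a connected set avoiding
both. -/
theorem ConnSet.exists_bridge [Finite V] {a b : V} (hS : G.ConnSet S) (ha : a ∈ S) (hb : b ∈ S)
    (hab : a ≠ b) (hadj : ¬ G.Adj a b) :
    ∃ K ⊆ S \ {a, b}, G.ConnSet K ∧ G.Touch K {a} ∧ G.Touch K {b} := by
  -- The cut consists of `a` and all components of `S \ {a, b}` touching `a`. An edge leaving it can
  -- only run from such a component to `b`, and that component is the bridge.
  obtain ⟨u, hu, w, hw, huw⟩ := hS.2
    ({a} ∪ {x | ∃ K, G.IsComp (S \ {a, b}) K ∧ x ∈ K ∧ G.Touch K {a}})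
    (Set.union_subset (Set.singleton_subset_iff.mpr ha)
      (fun x ⟨K, hK, hx, _⟩ => (hK.sub hx).1)) ⟨a, .inl rfl⟩ (fun he => by
      rw [← he] at hb
      rcases hb with hb | ⟨K, hK, hx, _⟩
      · exact hab hb.symm
      · exact (hK.sub hx).2 (.inr rfl))
  have hwa : w ≠ a := fun h => hw.2 (.inl h)
  rcases hu with rfl | ⟨K, hK, hx, hKa⟩
  · have hwb : w ≠ b := fun h => hadj (h ▸ huw)
    obtain ⟨K, hK, hwK⟩ := exists_isComp_mem (G := G)
      (show w ∈ S \ {u, b} from ⟨hw.1, by simp [hwa, hwb]⟩)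
    exact absurd (.inr ⟨K, hK, hwK, w, hwK, u, rfl, huw.symm⟩) hw.2
  · by_cases hwb : w = b
    · exact ⟨K, hK.sub, hK.conn, hKa, u, hx, w, hwb, huw⟩
    · exact absurd (.inr ⟨K, hK, hK.mem_of_adj hx ⟨hw.1, by simp [hwa, hwb]⟩ huw, hKa⟩) hw.2

theorem IsComp.bdry_subset (h : G.IsComp S C) : G.bdry C ⊆ Sᶜ := by
  rintro v ⟨hv, c, hc, hcv⟩ hvS
  exact hv (h.mem_of_adj hc hvS hcv)

theorem mem_bdry_iff : x ∈ G.bdry C ↔ x ∉ C ∧ G.Touch C {x} := by simp [bdry, Touch]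

end Toolkit

end SimpleGraph

namespace SimpleGraph

theorem connSet_univ_iff {V : Type*} {G : SimpleGraph V} : G.ConnSet Set.univ ↔ G.Connected := by
  rw [connSet_iff]
  exact (induceUnivIso G).connected_iff

theorem ConnSet.image {V W : Type*} {G : SimpleGraph V} {H : SimpleGraph W} (f : V → W)
    (hf : ∀ x y, G.Adj x y → H.Adj (f x) (f y)) {S : Set V} (hS : G.ConnSet S) :
    H.ConnSet (f '' S) := by
  refine ⟨hS.1.image f, fun U hU ⟨u, hu⟩ hn => ?_⟩
  obtain ⟨s, hs, rfl⟩ := hU hu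
  obtain ⟨x, hx, y, hy, hxy⟩ := hS.2 {x ∈ S | f x ∈ U} (fun x hx => hx.1) ⟨s, hs, hu⟩ (by
    intro he
    refine hn (hU.antisymm ?_)
    rintro _ ⟨z, hz, rfl⟩
    rw [← he] at hz
    exact hz.2)
  exact ⟨f x, hx.2, f y, ⟨⟨y, hy.1, rfl⟩, fun h => hy.2 ⟨hy.1, h⟩⟩, hf x y hxy⟩

/-! ### The Helly property of subtrees. -/

section Helly

variable {ι : Type*} {T : SimpleGraph ι}

/-- In a rooted tree, the ancestor of `x` at depth `k`. -/
theorem IsTree.exists_ancestor (hT : T.IsTree) (r : ι) :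
    ∃ f : ι → ℕ → ι, (∀ x, f x (T.dist r x) = x) ∧
      ∀ x y k, T.Adj x y → k ≤ T.dist r x → k ≤ T.dist r y → f x k = f y k := by
  have hp : ∀ x, ∃ p : T.Walk r x, p.IsPath ∧ p.length = T.dist r x := fun x =>
    (hT.connected r x).exists_path_of_dist
  choose p hp hl using hp
  -- If `y` is one step deeper than its neighbour `x`, the unique path from the root to `y` is the
  -- path to `x` followed by the edge `xy`.
  have key : ∀ x y k, T.Adj x y → k ≤ T.dist r x → T.dist r y = T.dist r x + 1 →
      (p x).getVert k = (p y).getVert k := by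
    intro x y k hxy hk hd
    have h1 : ((p x).concat hxy).IsPath :=
      Walk.isPath_of_length_eq_dist _ (by rw [Walk.length_concat, hl, hd])
    have h2 : p y = (p x).concat hxy := (hT.existsUnique_path r y).unique (hp y) h1
    rw [h2, Walk.concat, Walk.getVert_append', if_pos (by rw [hl]; exact hk)]
  refine ⟨fun x k => (p x).getVert k, fun x => ?_, fun x y k hxy hx hy => ?_⟩
  · rw [← hl]; exact Walk.getVert_length _
  · rcases hT.dist_eq_dist_add_one_of_adj r hxy with h | h
    · exact (key y x k hxy.symm hy h).symm
    · exact key x y k hxy hx h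

/-- Pairwise intersecting connected vertex sets of a tree have a common vertex. -/
theorem IsTree.helly {κ : Type*} [Finite κ] (hT : T.IsTree) (S : κ → Set ι)
    (hS : ∀ j, T.ConnSet (S j)) (hI : ∀ i j, (S i ∩ S j).Nonempty) : ∃ t, ∀ j, t ∈ S j := by
  obtain ⟨r⟩ := hT.connected.nonempty
  rcases isEmpty_or_nonempty κ with hκ | hκ
  · exact ⟨r, fun j => hκ.elim j⟩
  obtain ⟨f, hf, hadj⟩ := hT.exists_ancestor r
  have htop : ∀ j, ∃ t ∈ S j, ∀ x ∈ S j, T.dist r t ≤ T.dist r x := by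
    intro j
    obtain ⟨t, ht, hmin⟩ := exists_minimal_of_wellFoundedLT (fun n => ∃ t ∈ S j, T.dist r t = n)
      (by obtain ⟨x, hx⟩ := (hS j).1; exact ⟨_, x, hx, rfl⟩)
    obtain ⟨t, ht, rfl⟩ := ht
    exact ⟨t, ht, fun x hx => (le_total _ _).elim id fun h => hmin ⟨x, hx, rfl⟩ h⟩
  choose top htop hmin using htop
  -- The ancestor at the depth of `top j` does not change along edges of `S j`, so it is the same
  -- for all of `S j`.
  have hconst : ∀ j, ∀ x ∈ S j, f x (T.dist r (top j)) = top j := by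
    intro j
    by_contra! hc
    obtain ⟨x, hx, hne⟩ := hc
    obtain ⟨u, hu, w, hw, huw⟩ := (hS j).2 {x ∈ S j | f x (T.dist r (top j)) = top j}
      (fun x hx => hx.1) ⟨top j, htop j, hf _⟩ (fun he => hne (by
        rw [← he] at hx
        exact hx.2))
    exact hw.2 ⟨hw.1, (hadj u w _ huw (hmin j u hu.1) (hmin j w hw.1)).symm.trans hu.2⟩
  have hmem : ∀ j, ∀ x ∈ S j, ∀ k, T.dist r (top j) ≤ k → k ≤ T.dist r x → f x k ∈ S j := by
    intro j x hx k hk hkx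
    rcases hk.eq_or_lt with rfl | hk
    · rw [hconst j x hx]; exact htop j
    obtain ⟨u, hu, w, hw, huw⟩ := (hS j).2 {y ∈ S j | k ≤ T.dist r y ∧ f y k = f x k}
      (fun x hx => hx.1) ⟨x, hx, hkx, rfl⟩ (fun he => by
        have := htop j
        rw [← he] at this
        exact absurd this.2.1 (by omega))
    have hwk : T.dist r w < k := by
      by_contra hn
      exact hw.2 ⟨hw.1, by omega, by rw [← hu.2.2, hadj u w k huw hu.2.1 (by omega)]⟩
    have huk : T.dist r u = k := by
      have := hu.2.1
      rcases hT.dist_eq_dist_add_one_of_adj r huw with h | h <;> omega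
    rw [← hu.2.2, ← huk, hf]
    exact hu.1
  -- The deepest top vertex is the common one: a vertex of `S i ∩ S j` has `top i` as an ancestor at
  -- least as deep as `top j`, and `S j` contains its ancestors down from that depth.
  obtain ⟨i, hi⟩ := Finite.exists_max fun j => T.dist r (top j)
  refine ⟨top i, fun j => ?_⟩
  obtain ⟨z, hzi, hzj⟩ := hI i j
  rw [← hconst i z hzi]
  exact hmem j z hzj _ (hi j) (hmin i z hzi)

end Helly

/-! ### Tree decompositions: gluing along cliques and the lower bound on treewidth. -/

section TreeDec

variable {V : Type*} {G : SimpleGraph V}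

/-- `G[S]` has a tree decomposition with all bags of size at most `k`. -/
def TDOn (G : SimpleGraph V) (S : Set V) (k : ℕ) : Prop :=
  ∃ (ι : Type) (_ : Finite ι) (T : SimpleGraph ι) (bag : ι → Set V), T.IsTree ∧
    (∀ t, bag t ⊆ S) ∧ (∀ t, (bag t).ncard ≤ k) ∧
    (∀ u ∈ S, ∀ v ∈ S, G.Adj u v → ∃ t, u ∈ bag t ∧ v ∈ bag t) ∧
    ∀ v ∈ S, T.ConnSet {t | v ∈ bag t}

theorem tdOn_of_ncard_le {S : Set V} {k : ℕ} (h : S.ncard ≤ k) : G.TDOn S k := by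
  refine ⟨Unit, inferInstance, ⊥, fun _ => S, IsTree.of_subsingleton, fun _ => subset_rfl,
    fun _ => h, fun u hu v hv _ => ⟨(), hu, hv⟩, fun v hv => ⟨⟨(), hv⟩, fun U hU hne hn => ?_⟩⟩
  exact absurd (Set.eq_of_subset_of_subset hU fun x _ => by
    obtain ⟨y, hy⟩ := hne; exact hy) hn

/-- Removes virtual edges that were added to turn a separator or a neighbourhood into a clique. -/
theorem TDOn.mono {G' : SimpleGraph V} {S : Set V} {k k' : ℕ} (h : G'.TDOn S k)
    (hG : ∀ u ∈ S, ∀ v ∈ S, G.Adj u v → G'.Adj u v) (hk : k ≤ k') : G.TDOn S k' := by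
  obtain ⟨ι, hι, T, bag, hT, h1, h2, h3, h4⟩ := h
  exact ⟨ι, hι, T, bag, hT, h1, fun t => (h2 t).trans hk,
    fun u hu v hv huv => h3 u hu v hv (hG u hu v hv huv), h4⟩

/-- Some bag meets every member of a family of pairwise touching connected sets. -/
theorem exists_bag_meets {ι κ : Type*} [Finite κ] {T : SimpleGraph ι} {bag : ι → Set V}
    (hT : T.IsTree) {S : Set V}
    (hE : ∀ u ∈ S, ∀ v ∈ S, G.Adj u v → ∃ t, u ∈ bag t ∧ v ∈ bag t)
    (hC : ∀ v ∈ S, T.ConnSet {t | v ∈ bag t}) (X : κ → Set V) (hXS : ∀ j, X j ⊆ S)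
    (hX : ∀ j, G.ConnSet (X j)) (hXX : ∀ i j, i ≠ j → G.Touch (X i) (X j)) :
    ∃ t, ∀ j, (bag t ∩ X j).Nonempty := by
  refine hT.helly (fun j => {t | (bag t ∩ X j).Nonempty}) (fun j => ?_) fun i j => ?_
  · have hsub : ∀ v ∈ X j, {t | v ∈ bag t} ⊆ {t | (bag t ∩ X j).Nonempty} :=
      fun v hv t ht => ⟨v, ht, hv⟩
    obtain ⟨x, hx⟩ := (hX j).1
    refine ⟨(hC x (hXS j hx)).1.mono (hsub x hx), fun U hU ⟨t, ht⟩ hn => ?_⟩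
    by_contra! hc
    -- A set `U` of nodes with no outgoing edge contains all bags of a vertex of `X j` once it
    -- contains one of them. Edges of `X j` lie in bags, so this property spreads through the
    -- connected set `X j`.
    have key : ∀ v ∈ X j, ∀ s ∈ U, v ∈ bag s → {t | v ∈ bag t} ⊆ U := by
      intro v hv s hs hvs
      by_contra hsU
      obtain ⟨a, ha, b, hb, hab⟩ := (hC v (hXS j hv)).2 ({t | v ∈ bag t} ∩ U)
        Set.inter_subset_left ⟨s, hvs, hs⟩ (fun he => hsU (Set.inter_eq_left.mp he))
      exact hc a ha.2 b ⟨hsub v hv hb.1, fun h => hb.2 ⟨hb.1, h⟩⟩ hab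
    obtain ⟨v, hvt, hv⟩ := hU ht
    obtain ⟨s, hs, hsU⟩ : ∃ s, (bag s ∩ X j).Nonempty ∧ s ∉ U := by
      by_contra! h
      exact hn (hU.antisymm fun s hs => h s hs)
    obtain ⟨w, hws, hw⟩ := hs
    obtain ⟨a, ha, b, hb, hab⟩ := (hX j).2 {v ∈ X j | {t | v ∈ bag t} ⊆ U} (fun v hv => hv.1)
      ⟨v, hv, key v hv t ht hvt⟩ (fun he => by
        rw [← he] at hw
        exact hsU (hw.2 hws))
    obtain ⟨q, hqa, hqb⟩ := hE a (hXS j ha.1) b (hXS j hb.1) hab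
    exact hb.2 ⟨hb.1, key b hb.1 q (ha.2 hqa) hqb⟩
  · by_cases hij : i = j
    · subst hij
      obtain ⟨x, hx⟩ := (hX i).1
      obtain ⟨t, ht⟩ := (hC x (hXS i hx)).1
      exact ⟨t, ⟨x, ht, hx⟩, ⟨x, ht, hx⟩⟩
    · obtain ⟨x, hx, y, hy, hxy⟩ := hXX i j hij
      obtain ⟨t, h1, h2⟩ := hE x (hXS i hx) y (hXS j hy) hxy
      exact ⟨t, ⟨x, h1, hx⟩, ⟨y, h2, hy⟩⟩

/-- Two trees joined by an edge form a tree. -/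
theorem IsTree.sum_sup_edge {ι κ : Type*} [Finite ι] [Finite κ] {T : SimpleGraph ι}
    {U : SimpleGraph κ} (hT : T.IsTree) (hU : U.IsTree) (t : ι) (u : κ) :
    ((T ⊕g U) ⊔ edge (.inl t) (.inr u)).IsTree := by
  have hadj : ((T ⊕g U) ⊔ edge (.inl t) (.inr u)).Adj (.inl t) (.inr u) := by
    simp [edge_adj]
  -- A connected graph is a tree when it has one vertex more than it has edges; the joining edge
  -- makes up for the second tree's surplus vertex.
  refine isTree_iff_connected_and_card.mpr ⟨?_, ?_⟩
  · rw [← connSet_univ_iff, ← Set.range_inl_union_range_inr, ← Set.image_univ, ← Set.image_univ]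
    exact ((connSet_univ_iff.mpr hT.connected).image Sum.inl fun x y h => Or.inl h).union
      ((connSet_univ_iff.mpr hU.connected).image Sum.inr fun x y h => Or.inl h)
      (.inr ⟨_, ⟨t, trivial, rfl⟩, _, ⟨u, trivial, rfl⟩, hadj⟩)
  · have h1 := (isTree_iff_connected_and_card.mp hT).2
    have h2 := (isTree_iff_connected_and_card.mp hU).2
    have h3 : Nat.card (T ⊕g U).edgeSet = Nat.card T.edgeSet + Nat.card U.edgeSet := by
      rw [Nat.card_congr edgeSetSumEquiv, Nat.card_sum]
    have h4 : ((T ⊕g U) ⊔ edge (.inl t) (.inr u)).edgeSet =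
        insert s(.inl t, .inr u) (T ⊕g U).edgeSet := by
      rw [edgeSet_sup, Set.insert_eq, Set.union_comm]
      congr 1
      ext e
      simp [edge]
      rintro rfl
      simp
    rw [Nat.card_sum, h4, Nat.card_coe_set_eq, Set.ncard_insert_of_notMem (by simp),
      ← Nat.card_coe_set_eq, h3]
    omega

/-- Tree decompositions of two parts of a graph that overlap in a clique can be glued. -/
theorem TDOn.glue [Finite V] {A B : Set V} {k : ℕ} (hA : G.TDOn A k) (hB : G.TDOn B k)
    (hK : ∀ u ∈ A ∩ B, ∀ v ∈ A ∩ B, u ≠ v → G.Adj u v) (hAB : ¬ G.Touch (A \ B) (B \ A)) :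
    G.TDOn (A ∪ B) k := by
  obtain ⟨ι, hι, T, bag, hT, a1, a2, a3, a4⟩ := hA
  obtain ⟨κ, hκ, U, bag', hU, b1, b2, b3, b4⟩ := hB
  have hbag : ∀ {ι : Type} {T : SimpleGraph ι} {bag : ι → Set V} {S : Set V}, T.IsTree →
      A ∩ B ⊆ S → (∀ u ∈ S, ∀ v ∈ S, G.Adj u v → ∃ t, u ∈ bag t ∧ v ∈ bag t) →
      (∀ v ∈ S, T.ConnSet {t | v ∈ bag t}) → ∃ t, A ∩ B ⊆ bag t := by
    intro ι T bag S hT hS h3 h4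
    -- The singletons of a clique are pairwise touching connected sets, so one bag contains the
    -- whole clique. The two trees are then joined at such bags.
    obtain ⟨t, ht⟩ := exists_bag_meets hT h3 h4 (fun x : ↥(A ∩ B) => {x.1})
      (fun x => Set.singleton_subset_iff.mpr (hS x.2)) (fun x => connSet_singleton _)
      fun x y hxy => touch_singleton.mpr (hK x x.2 y y.2 fun h => hxy (Subtype.ext h))
    refine ⟨t, fun x hx => ?_⟩
    obtain ⟨y, hy, hyx⟩ := ht ⟨x, hx⟩
    rwa [Set.mem_singleton_iff.mp hyx] at hy
  obtain ⟨t, ht⟩ := hbag hT Set.inter_subset_left a3 a4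
  obtain ⟨u, hu⟩ := hbag hU Set.inter_subset_right b3 b4
  refine ⟨ι ⊕ κ, inferInstance, _, Sum.elim bag bag', hT.sum_sup_edge hU t u, ?_, ?_, ?_, ?_⟩
  · rintro (s | s)
    exacts [(a1 s).trans Set.subset_union_left, (b1 s).trans Set.subset_union_right]
  · rintro (s | s)
    exacts [a2 s, b2 s]
  · intro x hx y hy hxy
    have hcase : (x ∈ A ∧ y ∈ A) ∨ (x ∈ B ∧ y ∈ B) := by
      by_contra! hn
      rcases hx with hx | hx <;> rcases hy with hy | hy
      · exact hn.1 hx hy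
      · exact hAB ⟨x, ⟨hx, fun h => hn.2 h hy⟩, y, ⟨hy, fun h => hn.1 hx h⟩, hxy⟩
      · exact hAB ⟨y, ⟨hy, fun h => hn.2 hx h⟩, x, ⟨hx, fun h => hn.1 h hy⟩, hxy.symm⟩
      · exact hn.2 hx hy
    rcases hcase with ⟨hx, hy⟩ | ⟨hx, hy⟩
    · obtain ⟨s, hs⟩ := a3 x hx y hy hxy
      exact ⟨.inl s, hs⟩
    · obtain ⟨s, hs⟩ := b3 x hx y hy hxy
      exact ⟨.inr s, hs⟩
  · intro v hv
    have hset : {s : ι ⊕ κ | v ∈ Sum.elim bag bag' s} =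
        Sum.inl '' {s | v ∈ bag s} ∪ Sum.inr '' {s | v ∈ bag' s} := by
      ext (s | s) <;> simp
    have hl : v ∈ A → ((T ⊕g U) ⊔ edge (.inl t) (.inr u)).ConnSet (Sum.inl '' {s | v ∈ bag s}) :=
      fun h => (a4 v h).image Sum.inl fun x y h => Or.inl h
    have hr : v ∈ B → ((T ⊕g U) ⊔ edge (.inl t) (.inr u)).ConnSet (Sum.inr '' {s | v ∈ bag' s}) :=
      fun h => (b4 v h).image Sum.inr fun x y h => Or.inl h
    rw [hset]
    by_cases hvA : v ∈ A <;> by_cases hvB : v ∈ B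
    · exact (hl hvA).union (hr hvB) (.inr ⟨_, ⟨t, ht ⟨hvA, hvB⟩, rfl⟩, _, ⟨u, hu ⟨hvA, hvB⟩, rfl⟩,
        by simp [edge_adj]⟩)
    · have : {s | v ∈ bag' s} = ∅ := by
        ext s; simpa using fun h => hvB (b1 s h)
      rw [this, Set.image_empty, Set.union_empty]
      exact hl hvA
    · have : {s | v ∈ bag s} = ∅ := by
        ext s; simpa using fun h => hvA (a1 s h)
      rw [this, Set.image_empty, Set.empty_union]
      exact hr hvB
    · exact absurd hv (by simp [hvA, hvB])

/-- A tree decomposition of a graph on a subtype is one of the corresponding vertex set. -/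
theorem TDOn.of_subtype {B : Set V} {H : SimpleGraph B} {k : ℕ} (h : H.TDOn Set.univ k)
    (hG : ∀ x y : B, G.Adj x y → H.Adj x y) : G.TDOn B k := by
  obtain ⟨ι, hι, T, bag, hT, h1, h2, h3, h4⟩ := h
  refine ⟨ι, hι, T, fun t => Subtype.val '' bag t, hT, fun t => by simp, fun t => ?_, ?_, ?_⟩
  · rw [Set.ncard_image_of_injective _ Subtype.val_injective]
    exact h2 t
  · intro u hu v hv huv
    obtain ⟨t, ha, hb⟩ := h3 ⟨u, hu⟩ trivial ⟨v, hv⟩ trivial (hG ⟨u, hu⟩ ⟨v, hv⟩ huv)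
    exact ⟨t, ⟨_, ha, rfl⟩, ⟨_, hb, rfl⟩⟩
  · intro v hv
    convert h4 ⟨v, hv⟩ trivial using 1
    ext t
    simp [hv]

theorem TDOn.treewidth_le [Finite V] {k : ℕ} (h : G.TDOn Set.univ k) :
    G.treewidth ≤ (k : ℤ) - 1 := by
  obtain ⟨ι, hι, T, bag, hT, h1, h2, h3, h4⟩ := h
  obtain ⟨n, ⟨e⟩⟩ := Finite.exists_equiv_fin ι
  let D : TreeDecomposition G (Fin n) :=
    { tree := T.map e.toEmbedding
      isTree := (Iso.map e T).isTree_iff.mp hT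
      bag := fun t => bag (e.symm t)
      exists_mem_bag := fun v => by
        obtain ⟨t, ht⟩ := (h4 v trivial).1
        exact ⟨e t, by simpa using ht⟩
      exists_edge_bag := fun u v huv => by
        obtain ⟨t, ht⟩ := h3 u trivial v trivial huv
        exact ⟨e t, by simpa using ht⟩
      connected := fun v => by
        rw [← connSet_iff]
        have := (h4 v trivial).image (H := T.map e.toEmbedding) e
          (fun x y h => (map_adj_apply (f := e.toEmbedding)).mpr h)
        convert this using 1
        ext t
        simp }
  obtain ⟨t, ht⟩ := D.isGreatest_width.1
  refine ((isLeast_treewidth G).2 ⟨n, D, rfl⟩).trans ?_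
  rw [← ht]
  have : (D.bag t).ncard ≤ k := h2 _
  show ((D.bag t).ncard : ℤ) - 1 ≤ _
  omega

/-- Some bag meets all branch sets of a largest clique model; as these are disjoint, the bag has at
least η elements. -/
theorem hadwigerNumber_sub_one_le_treewidth [Finite V] (G : SimpleGraph V) :
    (G.hadwigerNumber : ℤ) - 1 ≤ G.treewidth := by
  obtain ⟨n, D, hD⟩ := (isLeast_treewidth G).1
  obtain ⟨X, hX⟩ := (isGreatest_hadwigerNumber G).1
  obtain ⟨t, ht⟩ := exists_bag_meets (G := G) (bag := D.bag) (S := Set.univ) D.isTree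
    (fun u _ v _ h => D.exists_edge_bag u v h) (fun v _ => connSet_iff.mpr (D.connected v)) X
    (fun j => Set.subset_univ _) (fun j => connSet_iff.mpr (hX.connected j))
    fun i j hij => hX.adj i j hij
  choose f hf using ht
  have hinj : Function.Injective f := by
    intro i j hij
    by_contra hne
    exact Set.disjoint_left.mp (hX.disjoint i j hne) (hf i).2 (hij ▸ (hf j).2)
  have hcard : G.hadwigerNumber ≤ (D.bag t).ncard := by
    have := Set.ncard_le_ncard (s := Set.range f) (t := D.bag t)
      (by rintro _ ⟨i, rfl⟩; exact (hf i).1) (Set.toFinite _)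
    rwa [← Nat.card_coe_set_eq, Nat.card_range_of_injective hinj, Nat.card_fin] at this
  have := D.isGreatest_width.2 ⟨t, rfl⟩
  rw [← hD]
  have h2 : ((D.bag t).ncard : ℤ) - 1 ≤ D.width := this
  omega

end TreeDec

end SimpleGraph

namespace SimpleGraph

universe u

/-! ### Composition of minors and contraction of families of sets. -/

section Minors

variable {V U W : Type*} {G : SimpleGraph V}

/-- A vertex set that no edge leaves contains or avoids each `X u` completely, so a bad cut of the
union would be a bad cut of `Y` in `Q`. -/
theorem ConnSet.biUnion {Q : SimpleGraph U} {X : U → Set V} (hX : ∀ u, G.ConnSet (X u))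
    (hadj : ∀ u v, Q.Adj u v → G.Touch (X u) (X v)) {Y : Set U} (hY : Q.ConnSet Y) :
    G.ConnSet (⋃ u ∈ Y, X u) := by
  obtain ⟨y, hy⟩ := hY.1
  have hsub : ∀ u ∈ Y, X u ⊆ ⋃ u ∈ Y, X u := fun u hu => Set.subset_biUnion_of_mem hu
  refine ⟨(hX y).1.mono (hsub y hy), fun S hS ⟨s, hs⟩ hn => ?_⟩
  by_contra! hc
  have key : ∀ u ∈ Y, (X u ∩ S).Nonempty → X u ⊆ S := by
    intro u hu hne
    by_contra hns
    obtain ⟨a, ha, b, hb, hab⟩ := (hX u).2 (X u ∩ S) Set.inter_subset_left hne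
      (fun he => hns (Set.inter_eq_left.mp he))
    exact hc a ha.2 b ⟨hsub u hu hb.1, fun h => hb.2 ⟨hb.1, h⟩⟩ hab
  obtain ⟨v, hv, hsv⟩ := Set.mem_iUnion₂.mp (hS hs)
  obtain ⟨a, ha, b, hb, hab⟩ := hY.2 {u ∈ Y | X u ⊆ S} (fun u hu => hu.1)
    ⟨v, hv, key v hv ⟨s, hsv, hs⟩⟩ (fun he => hn (hS.antisymm (Set.iUnion₂_subset fun u hu => by
      rw [← he] at hu
      exact hu.2)))
  obtain ⟨x, hx, z, hz, hxz⟩ := hadj a b hab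
  refine hc x (ha.2 hx) z ⟨hsub b hb.1 hz, fun hzS => hb.2 ⟨hb.1, key b hb.1 ⟨z, hz, hzS⟩⟩⟩ hxz

theorem touch_biUnion {X : U → Set V} {Y Z : Set U} :
    G.Touch (⋃ u ∈ Y, X u) (⋃ u ∈ Z, X u) ↔ ∃ u ∈ Y, ∃ v ∈ Z, G.Touch (X u) (X v) := by
  constructor
  · rintro ⟨x, hx, y, hy, hxy⟩
    obtain ⟨u, hu, hxu⟩ := Set.mem_iUnion₂.mp hx
    obtain ⟨v, hv, hyv⟩ := Set.mem_iUnion₂.mp hy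
    exact ⟨u, hu, v, hv, x, hxu, y, hyv, hxy⟩
  · rintro ⟨u, hu, v, hv, h⟩
    exact h.mono (Set.subset_biUnion_of_mem hu) (Set.subset_biUnion_of_mem hv)

theorem disjoint_biUnion {X : U → Set V} (hX : ∀ u v, u ≠ v → Disjoint (X u) (X v))
    {Y Z : Set U} (h : Disjoint Y Z) : Disjoint (⋃ u ∈ Y, X u) (⋃ u ∈ Z, X u) := by
  rw [Set.disjoint_iUnion₂_left]
  intro u hu
  rw [Set.disjoint_iUnion₂_right]
  exact fun v hv => hX u v fun he => Set.disjoint_left.mp h hu (he ▸ hv)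

theorem IsInducedMinor.trans {H : SimpleGraph W} {Q : SimpleGraph U} (h1 : IsInducedMinor H Q)
    (h2 : IsInducedMinor Q G) : IsInducedMinor H G := by
  obtain ⟨Y, hY⟩ := h1
  obtain ⟨X, hX⟩ := h2
  refine ⟨fun w => ⋃ u ∈ Y w, X u, fun w w' h => disjoint_biUnion hX.disjoint (hY.disjoint w w' h),
    fun w => connSet_iff.mp (ConnSet.biUnion (fun u => connSet_iff.mpr (hX.connected u))
      (fun u v h => (hX.adj_iff u v h.ne).mpr h) (connSet_iff.mpr (hY.connected w))), ?_⟩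
  intro w w' hne
  rw [← hY.adj_iff w w' hne]
  refine touch_biUnion.trans ?_
  refine exists_congr fun u => and_congr_right fun hu => exists_congr fun v =>
    and_congr_right fun hv => hX.adj_iff u v ?_
  rintro rfl
  exact Set.disjoint_left.mp (hY.disjoint w w' hne) hu hv

theorem IsMinor.trans {H : SimpleGraph W} {Q : SimpleGraph U} (h1 : IsMinor H Q)
    (h2 : IsMinor Q G) : IsMinor H G := by
  obtain ⟨Y, hY⟩ := h1
  obtain ⟨X, hX⟩ := h2
  refine ⟨fun w => ⋃ u ∈ Y w, X u, fun w w' h => disjoint_biUnion hX.disjoint (hY.disjoint w w' h),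
    fun w => connSet_iff.mp (ConnSet.biUnion (fun u => connSet_iff.mpr (hX.connected u))
      hX.adj (connSet_iff.mpr (hY.connected w))), ?_⟩
  intro w w' h
  refine touch_biUnion.mpr ?_
  obtain ⟨u, hu, v, hv, huv⟩ := hY.adj w w' h
  exact ⟨u, hu, v, hv, hX.adj u v huv⟩

theorem IsInducedMinor.isMinor {H : SimpleGraph W} (h : IsInducedMinor H G) : IsMinor H G := by
  obtain ⟨X, hX⟩ := h
  exact ⟨X, hX.disjoint, hX.connected, fun u v huv => (hX.adj_iff u v huv.ne).mpr huv⟩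

theorem IsMinor.hadwigerNumber_le {Q : SimpleGraph U} [Finite U] [Finite V] (h : IsMinor Q G) :
    Q.hadwigerNumber ≤ G.hadwigerNumber :=
  (isGreatest_hadwigerNumber G).2 ((isGreatest_hadwigerNumber Q).1.trans h)

/-- The graph on the index set of a family of vertex sets recording which of them touch. -/
def touchGraph (G : SimpleGraph V) (X : U → Set V) : SimpleGraph U where
  Adj u v := u ≠ v ∧ G.Touch (X u) (X v)
  symm := ⟨fun _ _ h => ⟨h.1.symm, h.2.symm⟩⟩
  loopless := ⟨fun _ h => h.1 rfl⟩

/-- This is the graph left after contracting each `X u` and deleting the other vertices. All smaller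
graphs in the induction have this form. -/
theorem isInducedMinor_touchGraph {X : U → Set V} (hd : ∀ u v, u ≠ v → Disjoint (X u) (X v))
    (hX : ∀ u, G.ConnSet (X u)) : IsInducedMinor (G.touchGraph X) G :=
  ⟨X, hd, fun u => connSet_iff.mp (hX u), fun _ _ h => ⟨fun ht => ⟨h, ht⟩, fun ht => ht.2⟩⟩

end Minors

/-- No clique of `G` and no set of at most two vertices is the boundary of a connected set that
is separated by it from some other vertex. -/
def WellLinked {V : Type*} (G : SimpleGraph V) : Prop :=
  ∀ C, G.ConnSet C → C ∪ G.bdry C ≠ Set.univ →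
    3 ≤ (G.bdry C).ncard ∧ ∃ a ∈ G.bdry C, ∃ b ∈ G.bdry C, a ≠ b ∧ ¬ G.Adj a b

/-! ### Reduction to well-linked graphs: clique cutsets and 2-cutsets. -/

section Reduce

variable {V : Type u} [Finite V] {W : Type*} {H : SimpleGraph W} {G : SimpleGraph V}

/-- The treewidth bound for smaller graphs applies to the graph obtained by contracting disjoint
connected sets. -/
theorem tdOn_of_contract (hG : G.InducedMinorFree H)
    (ih : ∀ (V' : Type u) [Finite V'] (G' : SimpleGraph V'), Nat.card V' < Nat.card V →
      G'.InducedMinorFree H → G'.TDOn Set.univ G'.hadwigerNumber)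
    {A : Set V} (hA : A ≠ Set.univ) (X : V → Set V)
    (hd : ∀ x ∈ A, ∀ y ∈ A, x ≠ y → Disjoint (X x) (X y)) (hX : ∀ x ∈ A, G.ConnSet (X x))
    {G' : SimpleGraph V} (hG' : ∀ x ∈ A, ∀ y ∈ A, G'.Adj x y → G.Touch (X x) (X y)) :
    G'.TDOn A G.hadwigerNumber := by
  have hm : IsInducedMinor (G.touchGraph fun x : A => X x) G :=
    isInducedMinor_touchGraph (fun x y h => hd x x.2 y y.2 fun he => h (Subtype.ext he))
      fun x => hX x x.2
  have hcard : Nat.card A < Nat.card V := by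
    rw [Nat.card_coe_set_eq, ← Set.ncard_univ]
    exact Set.ncard_lt_ncard (Set.ssubset_univ_iff.mpr hA) (Set.toFinite _)
  -- The contracted graph inherits freeness, and its Hadwiger number is at most that of `G`. The
  -- graph `G'` may carry any edge created by the contraction, including edges absent from `G`.
  have h := ih A (G.touchGraph fun x : A => X x) hcard fun h => hG (h.trans hm)
  exact ((h.of_subtype (G := G') fun x y hxy => ⟨fun he => hxy.ne (by rw [he]),
    hG' x x.2 y y.2 hxy⟩)).mono (fun _ _ _ _ h => h) hm.isMinor.hadwigerNumber_le

/-- The case of `tdOn_of_contract` in which a connected set is contracted into one vertex. -/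
theorem tdOn_of_contract_into (hG : G.InducedMinorFree H)
    (ih : ∀ (V' : Type u) [Finite V'] (G' : SimpleGraph V'), Nat.card V' < Nat.card V →
      G'.InducedMinorFree H → G'.TDOn Set.univ G'.hadwigerNumber)
    {A D : Set V} (hD : G.ConnSet D) (hAD : Disjoint A D) {a : V}
    (ha : G.Touch D {a}) {G' : SimpleGraph V}
    (hG' : ∀ x ∈ A, ∀ y ∈ A, G'.Adj x y → G.Adj x y ∨ (x = a ∧ G.Touch D {y}) ∨
      (y = a ∧ G.Touch D {x})) :
    G'.TDOn A G.hadwigerNumber := by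
  classical
  have hA : A ≠ Set.univ := by
    rintro rfl
    obtain ⟨d, hd⟩ := hD.1
    exact Set.disjoint_left.mp hAD trivial hd
  have hmem : ∀ x, x ∈ (if x = a then insert a D else {x} : Set V) := by
    intro x; split_ifs with h <;> simp [h]
  refine tdOn_of_contract hG ih hA (fun x => if x = a then insert a D else {x}) ?_ ?_ ?_
  · intro x hx y hy hxy
    have hxD := Set.disjoint_left.mp hAD hx
    have hyD := Set.disjoint_left.mp hAD hy
    split_ifs with h1 h2 h2
    · exact absurd (h1.trans h2.symm) hxy
    · simp [h2, hyD]
    · simp [h1, hxD]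
    · simpa using hxy
  · intro x hx
    split_ifs
    exacts [hD.insert ha, connSet_singleton x]
  · intro x hx y hy hxy
    rcases hG' x hx y hy hxy with h | ⟨rfl, h⟩ | ⟨rfl, h⟩
    · exact ⟨x, hmem x, y, hmem y, h⟩
    · simp only [if_true]
      exact h.mono (Set.subset_insert _ _) (Set.singleton_subset_iff.mpr (hmem y))
    · simp only [if_true]
      exact h.symm.mono (Set.singleton_subset_iff.mpr (hmem x)) (Set.subset_insert _ _)

theorem natCard_le_hadwigerNumber_of_complete (h : ∀ v w, v ≠ w → G.Adj v w) :
    Nat.card V ≤ G.hadwigerNumber := by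
  obtain ⟨n, ⟨e⟩⟩ := Finite.exists_equiv_fin V
  rw [Nat.card_congr e, Nat.card_fin]
  refine (isGreatest_hadwigerNumber G).2 ⟨fun i => {e.symm i}, fun i j hij => by simpa using hij,
    fun i => connSet_iff.mp (connSet_singleton _), fun i j hij => ?_⟩
  exact ⟨_, rfl, _, rfl, h _ _ fun he => hij.ne (e.symm.injective he)⟩

/-- In a minimal counterexample, there is neither a clique cutset nor a 2-cutset. -/
theorem tdOn_or_wellLinked (hG : G.InducedMinorFree H)
    (ih : ∀ (V' : Type u) [Finite V'] (G' : SimpleGraph V'), Nat.card V' < Nat.card V →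
      G'.InducedMinorFree H → G'.TDOn Set.univ G'.hadwigerNumber) :
    G.TDOn Set.univ G.hadwigerNumber ∨
      G.WellLinked ∧ ∃ v w, v ≠ w ∧ ¬ G.Adj v w := by
  classical
  by_cases hcomp : ∀ v w, v ≠ w → G.Adj v w
  · left
    refine tdOn_of_ncard_le ?_
    rw [Set.ncard_univ]
    exact natCard_le_hadwigerNumber_of_complete hcomp
  have hnt : ∀ C, ¬ G.Touch (Cᶜ \ G.bdry C) C := by
    rintro C ⟨x, hx, y, hy, hxy⟩
    exact hx.2 ⟨hx.1, y, hy, hxy.symm⟩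
  by_cases hcl : ∃ C, G.ConnSet C ∧ C ∪ G.bdry C ≠ Set.univ ∧
      ∀ a ∈ G.bdry C, ∀ b ∈ G.bdry C, a ≠ b → G.Adj a b
  · left
    obtain ⟨C, hC, hne, hK⟩ := hcl
    have hpart : ∀ A : Set V, A ≠ Set.univ → G.TDOn A G.hadwigerNumber := fun A hA =>
      tdOn_of_contract hG ih hA (fun x => {x}) (fun x _ y _ h => by simpa using h)
        (fun x _ => connSet_singleton x) fun x _ y _ h => touch_singleton.mpr h
    have hCc : Cᶜ ≠ Set.univ := by
      intro h
      obtain ⟨c, hc⟩ := hC.1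
      exact (h.symm ▸ trivial : c ∈ Cᶜ) hc
    -- The sides `C ∪ bdry C` and `Cᶜ` are proper and overlap in the clique `bdry C`.
    have := (hpart _ hne).glue (hpart _ hCc) (fun a ha b hb => hK a (ha.1.resolve_left ha.2) b
      (hb.1.resolve_left hb.2)) (by
        rintro ⟨x, hx, y, hy, hxy⟩
        exact hnt C ⟨y, ⟨hy.1, fun h => hy.2 (.inr h)⟩, x, by simpa using hx.2, hxy.symm⟩)
    convert this using 1
    ext x
    by_cases hx : x ∈ C <;> simp [hx]
  push Not at hcl
  by_cases h2 : ∃ C, G.ConnSet C ∧ C ∪ G.bdry C ≠ Set.univ ∧ (G.bdry C).ncard ≤ 2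
  · left
    obtain ⟨C, hC, hne, hle⟩ := h2
    obtain ⟨a, ha, b, hb, hab, hnadj⟩ := hcl C hC hne
    have hbd : G.bdry C = {a, b} := by
      refine (Set.eq_of_subset_of_ncard_le (s := {a, b}) ?_ ?_ (Set.toFinite _)).symm
      · rintro x (rfl | rfl) <;> assumption
      · rw [Set.ncard_pair hab]; exact hle
    obtain ⟨r, hr⟩ : ∃ r, r ∉ C ∪ G.bdry C := by
      by_contra! h
      exact hne (Set.eq_univ_of_forall h)
    obtain ⟨D, hD, hrD⟩ := exists_isComp_mem (G := G) (S := (C ∪ G.bdry C)ᶜ) hr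
    have hDsub : G.bdry D ⊆ {a, b} := by
      intro x hx
      have h1 := hD.bdry_subset hx
      rw [compl_compl, hbd] at h1
      refine h1.resolve_left fun hxC => ?_
      obtain ⟨d, hd, hdx⟩ := hx.2
      have := hD.sub hd
      exact hnt C ⟨d, ⟨fun h => this (.inl h), fun h => this (.inr h)⟩, x, hxC, hdx⟩
    have hDC : Disjoint C D := Set.disjoint_left.mpr fun x hx hxD => hD.sub hxD (.inl hx)
    have hDne : D ∪ G.bdry D ≠ Set.univ := by
      intro h
      obtain ⟨c, hc⟩ := hC.1
      rcases (h.symm ▸ trivial : c ∈ D ∪ G.bdry D) with h | h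
      · exact Set.disjoint_left.mp hDC hc h
      · have := hDsub h
        rw [← hbd] at this
        exact this.1 hc
    have haC := mem_bdry_iff.mp ha
    have hbC := mem_bdry_iff.mp hb
    -- The boundary of `D` is not a clique either, so it cannot be smaller than `{a, b}`.
    have hDab : a ∈ G.bdry D ∧ b ∈ G.bdry D := by
      obtain ⟨a', ha', b', hb', hab', -⟩ := hcl D hD.conn hDne
      rcases hDsub ha' with rfl | rfl <;> rcases hDsub hb' with rfl | rfl
      · exact absurd rfl hab'
      · exact ⟨ha', hb'⟩
      · exact ⟨hb', ha'⟩
      · exact absurd rfl hab'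
    have haD := mem_bdry_iff.mp hDab.1
    have hbD := mem_bdry_iff.mp hDab.2
    have hadj : ∀ D : Set V, G.Touch D {b} → ∀ x y, (G ⊔ edge a b).Adj x y →
        G.Adj x y ∨ (x = a ∧ G.Touch D {y}) ∨ (y = a ∧ G.Touch D {x}) := by
      intro D hDb x y hxy
      rcases hxy with h | h
      · exact .inl h
      · rw [edge_adj] at h
        rcases h.1 with ⟨rfl, rfl⟩ | ⟨rfl, rfl⟩
        · exact .inr (.inl ⟨rfl, hDb⟩)
        · exact .inr (.inr ⟨rfl, hDb⟩)
    -- On each side the virtual edge `ab` comes from contracting the opposite connected set, `D` or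
    -- `C`, into `a`. Then `{a, b}` is a clique along which to glue.
    have hA : (G ⊔ edge a b).TDOn (C ∪ {a, b}) G.hadwigerNumber := by
      refine tdOn_of_contract_into hG ih hD.conn ?_ haD.2 fun x _ y _ => hadj D hbD.2 x y
      rw [Set.disjoint_union_left]
      refine ⟨hDC, ?_⟩
      simp [haD.1, hbD.1]
    have hB : (G ⊔ edge a b).TDOn Cᶜ G.hadwigerNumber :=
      tdOn_of_contract_into hG ih hC disjoint_compl_left haC.2 fun x _ y _ => hadj C hbC.2 x y
    have := hA.glue hB (fun x hx y hy hxy => by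
        have h1 := hx.1.resolve_left hx.2
        have h2 := hy.1.resolve_left hy.2
        refine .inr ((edge_adj ..).mpr ⟨?_, hxy⟩)
        rcases h1 with rfl | rfl <;> rcases h2 with rfl | rfl <;> simp_all) (by
        rintro ⟨x, hx, y, hy, hxy⟩
        have hxC : x ∈ C := by simpa using hx.2
        rcases hxy with hxy | hxy
        · refine hnt C ⟨y, ⟨hy.1, fun h => hy.2 (.inr ?_)⟩, x, hxC, hxy.symm⟩
          rwa [hbd] at h
        · rw [edge_adj] at hxy
          rcases hxy.1 with ⟨rfl, -⟩ | ⟨rfl, -⟩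
          exacts [haC.1 hxC, hbC.1 hxC])
    have h3 := this.mono (G := G) (fun _ _ _ _ h => .inl h) le_rfl
    convert h3 using 1
    ext x
    by_cases hx : x ∈ C <;> simp [hx]
  · right
    push Not at h2 hcomp
    exact ⟨fun C hC hne => ⟨h2 C hC hne, hcl C hC hne⟩, hcomp⟩

end Reduce

end SimpleGraph

namespace SimpleGraph

/-! ### A well-linked non-complete graph has an induced 4-wheel minor. -/

section Wheel

variable {V : Type*} {G : SimpleGraph V}

/-- `Z` is the hub, and the `R i` are the rim in cyclic order; opposite rim sets must not touch,
since the minor is induced. -/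
theorem isInducedMinor_wheelGraph_four {Z : Set V} {R : Fin 4 → Set V} (hZ : G.ConnSet Z)
    (hR : ∀ i, G.ConnSet (R i)) (hZR : ∀ i, Disjoint Z (R i))
    (hd : ∀ i j, i ≠ j → Disjoint (R i) (R j)) (hT : ∀ i, G.Touch Z (R i))
    (hadj : ∀ i, G.Touch (R i) (R (i + 1))) (hn : ∀ i, ¬ G.Touch (R i) (R (i + 2))) :
    IsInducedMinor (wheelGraph 4) G := by
  refine ⟨fun o => o.elim Z R, ?_, ?_, ?_⟩
  · rintro (_ | i) (_ | j) h
    exacts [absurd rfl h, hZR j, (hZR i).symm, hd i j fun he => h (by rw [he])]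
  · rintro (_ | i)
    exacts [connSet_iff.mp hZ, connSet_iff.mp (hR i)]
  · rintro (_ | i) (_ | j) h
    · exact absurd rfl h
    · exact ⟨fun _ => trivial, fun _ => hT j⟩
    · exact ⟨fun _ => trivial, fun _ => (hT i).symm⟩
    · show G.Touch (R i) (R j) ↔ (cycleGraph 4).Adj i j
      have hij : i ≠ j := fun he => h (by rw [he])
      have hcases : ∀ i j : Fin 4, i ≠ j → (j = i + 1 ∧ (cycleGraph 4).Adj i j) ∨
          (i = j + 1 ∧ (cycleGraph 4).Adj i j) ∨ (j = i + 2 ∧ ¬ (cycleGraph 4).Adj i j) := by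
        decide
      rcases hcases i j hij with ⟨rfl, h1⟩ | ⟨rfl, h1⟩ | ⟨rfl, h1⟩
      · exact ⟨fun _ => h1, fun _ => hadj i⟩
      · exact ⟨fun _ => h1, fun _ => (hadj j).symm⟩
      · exact ⟨fun h2 => absurd h2 (hn i), fun h2 => absurd h2 h1⟩

theorem wheel_of_parts {Z R₀ R₁ R₂ R₃ : Set V} (hZ : G.ConnSet Z) (h0 : G.ConnSet R₀)
    (h1 : G.ConnSet R₁) (h2 : G.ConnSet R₂) (h3 : G.ConnSet R₃)
    (dz0 : Disjoint Z R₀) (dz1 : Disjoint Z R₁) (dz2 : Disjoint Z R₂) (dz3 : Disjoint Z R₃)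
    (d01 : Disjoint R₀ R₁) (d02 : Disjoint R₀ R₂) (d03 : Disjoint R₀ R₃) (d12 : Disjoint R₁ R₂)
    (d13 : Disjoint R₁ R₃) (d23 : Disjoint R₂ R₃)
    (z0 : G.Touch Z R₀) (z1 : G.Touch Z R₁) (z2 : G.Touch Z R₂) (z3 : G.Touch Z R₃)
    (t01 : G.Touch R₀ R₁) (t12 : G.Touch R₁ R₂) (t23 : G.Touch R₂ R₃) (t30 : G.Touch R₃ R₀)
    (n02 : ¬ G.Touch R₀ R₂) (n13 : ¬ G.Touch R₁ R₃) : IsInducedMinor (wheelGraph 4) G := by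
  refine isInducedMinor_wheelGraph_four (Z := Z) (R := ![R₀, R₁, R₂, R₃]) hZ ?_ ?_ ?_ ?_ ?_ ?_
  · intro i; fin_cases i <;> assumption
  · intro i; fin_cases i <;> assumption
  · intro i j h
    fin_cases i <;> fin_cases j <;> first | exact absurd rfl h | assumption |
      (apply Disjoint.symm; assumption)
  · intro i; fin_cases i <;> assumption
  · intro i; fin_cases i <;> assumption
  · intro i
    fin_cases i <;> first | assumption | (rw [touch_comm]; assumption)

variable [Finite V]

/-- Two anticomplete connections between nonadjacent vertices `x`, `y` and a third connection that
touches one of them yield a 4-wheel. -/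
theorem WellLinked.wheel_of_connections (hG : G.WellLinked) {x y : V} {P Q D : Set V}
    (hxy : x ≠ y) (hnadj : ¬ G.Adj x y) (hP : G.ConnSet P) (hQ : G.ConnSet Q) (hD : G.ConnSet D)
    (hPx : x ∉ P) (hPy : y ∉ P) (hQx : x ∉ Q) (hQy : y ∉ Q) (hDx : x ∉ D) (hDy : y ∉ D)
    (hPQ : Disjoint P Q) (hPD : Disjoint P D) (hQD : Disjoint Q D) (hnPQ : ¬ G.Touch P Q)
    (tPx : G.Touch P {x}) (tPy : G.Touch P {y}) (tQx : G.Touch Q {x}) (tQy : G.Touch Q {y})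
    (tDx : G.Touch D {x}) (tDy : G.Touch D {y}) (hDP : G.Touch D P)
    (hN : G.bdry D ⊆ {x, y} ∪ P ∪ Q) : IsInducedMinor (wheelGraph 4) G := by
  have dxy : Disjoint ({x} : Set V) {y} := by simpa using hxy
  have dl : ∀ {z : V} {S : Set V}, z ∉ S → Disjoint {z} S := fun h => by simpa using h
  have dr : ∀ {z : V} {S : Set V}, z ∉ S → Disjoint S {z} := fun h => by simpa using h
  have nxy : ¬ G.Touch {x} {y} := by rwa [touch_singleton]
  have cx := connSet_singleton (G := G) x
  have cy := connSet_singleton (G := G) y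
  -- If `D` touches `P` and `Q`, it is the hub of the rim `x, P, y, Q`. Otherwise `Q` is enlarged to
  -- a component `E`, the hub is `P`, and the rim is `x, D, y, E`.
  by_cases hDQ : G.Touch D Q
  · exact wheel_of_parts hD cx hP cy hQ (dr hDx) hPD.symm (dr hDy) hQD.symm (dl hPx) dxy (dl hQx)
      (dr hPy) hPQ (dl hQy) tDx hDP tDy hDQ tPx.symm tPy tQy.symm tQx nxy hnPQ
  · obtain ⟨E, hE, hQE⟩ := exists_isComp_superset hQ (S := ({x, y} ∪ P ∪ D)ᶜ) (by
      intro z hz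
      have h1 := Set.disjoint_right.mp hPQ hz
      have h2 := Set.disjoint_left.mp hQD hz
      have h3 : z ≠ x := by rintro rfl; exact hQx hz
      have h4 : z ≠ y := by rintro rfl; exact hQy hz
      simp [h1, h2, h3, h4])
    have hEx : x ∉ E := fun h => hE.sub h (by simp)
    have hEy : y ∉ E := fun h => hE.sub h (by simp)
    have hEP : Disjoint P E := Set.disjoint_left.mpr fun z hz h => hE.sub h (by simp [hz])
    have hED : Disjoint D E := Set.disjoint_left.mpr fun z hz h => hE.sub h (by simp [hz])
    have hnED : ¬ G.Touch D E := by
      rintro ⟨d, hd, e, he, hde⟩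
      rcases hN ⟨Set.disjoint_right.mp hED he, d, hd, hde⟩ with (h | h) | h
      · rcases h with rfl | rfl
        exacts [hEx he, hEy he]
      · exact Set.disjoint_left.mp hEP h he
      · exact hDQ ⟨d, hd, e, h, hde⟩
    have hEN := hE.bdry_subset
    rw [compl_compl] at hEN
    -- Otherwise the boundary of `E` would lie in `{x, y}`, which well-linkedness forbids.
    have hEPt : G.Touch P E := by
      have hDN : ∀ d ∈ D, d ∉ G.bdry E := by
        rintro d hd ⟨_, e, he, hed⟩
        exact hnED ⟨d, hd, e, he, hed.symm⟩
      have hne : E ∪ G.bdry E ≠ Set.univ := by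
        intro h
        obtain ⟨d, hd⟩ := hD.1
        rcases (h.symm ▸ trivial : d ∈ E ∪ G.bdry E) with h | h
        exacts [Set.disjoint_left.mp hED hd h, hDN d hd h]
      by_contra hcon
      have hsub : G.bdry E ⊆ {x, y} := by
        intro z hz
        rcases hEN hz with (h | h) | h
        · exact h
        · obtain ⟨_, e, he, hez⟩ := hz
          exact absurd ⟨z, h, e, he, hez.symm⟩ hcon
        · exact absurd hz (hDN z h)
      have h1 := Set.ncard_le_ncard hsub (Set.toFinite _)
      rw [Set.ncard_pair hxy] at h1
      have := (hG E hE.conn hne).1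
      omega
    exact wheel_of_parts hP cx hD cy hE.conn (dr hPx) hPD (dr hPy) hEP (dl hDx) dxy (dl hEx)
      (dr hDy) hED (dl hEy) tPx hDP.symm tPy hEPt tDx.symm tDy (tQy.symm.right hQE)
      (tQx.left hQE) nxy hnED

/-- A well-linked graph that is not complete has a 4-wheel as an induced minor. -/
theorem WellLinked.isInducedMinor_wheelGraph (hG : G.WellLinked)
    (hne : ∃ v w, v ≠ w ∧ ¬ G.Adj v w) : IsInducedMinor (wheelGraph 4) G := by
  obtain ⟨v, w, hvw, hnvw⟩ := hne
  obtain ⟨C, hC, hwC⟩ := exists_isComp_mem (G := G) (S := ({z | G.Adj v z} ∪ {v})ᶜ) (x := w)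
    (by simp [hnvw, hvw.symm])
  have hvC : v ∉ C := fun h => hC.sub h (by simp)
  have hnv : ∀ z ∈ C, ¬ G.Adj v z := fun z hz h => hC.sub hz (by simp [h])
  have hCN : ∀ z ∈ G.bdry C, G.Adj v z := by
    intro z hz
    have := hC.bdry_subset hz
    rw [compl_compl] at this
    rcases this with h | h
    · exact h
    · obtain ⟨_, c, hc, hcz⟩ := hz
      rw [Set.mem_singleton_iff.mp h] at hcz
      exact absurd hcz.symm (hnv c hc)
  have hCne : C ∪ G.bdry C ≠ Set.univ := by
    intro h
    rcases (h.symm ▸ trivial : v ∈ C ∪ G.bdry C) with h | h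
    exacts [hvC h, (hCN v h).ne rfl]
  obtain ⟨-, a, ha, b, hb, hab, hnab⟩ := hG C hC.conn hCne
  have hva := hCN a ha
  have hvb := hCN b hb
  -- A minimal connection plays the role of the interior of an induced path. Its minimality is used
  -- later to separate `a` from `b` by deleting one of its vertices.
  obtain ⟨P, ⟨hP, hPC, hPa, hPb⟩, hPmin⟩ := Set.Finite.exists_minimal
    (s := {P | G.ConnSet P ∧ P ⊆ C ∧ G.Touch P {a} ∧ G.Touch P {b}}) (Set.toFinite _)
    ⟨C, hC.conn, subset_rfl, (mem_bdry_iff.mp ha).2, (mem_bdry_iff.mp hb).2⟩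
  have haP : a ∉ P := fun h => ha.1 (hPC h)
  have hbP : b ∉ P := fun h => hb.1 (hPC h)
  have hvP : v ∉ P := fun h => hvC (hPC h)
  have hPv : ¬ G.Touch {v} P := by
    rw [touch_singleton_left]
    rintro ⟨z, hz, h⟩
    exact hnv z (hPC hz) h
  -- a third neighbour of `v`
  obtain ⟨d, hvd, hda, hdb⟩ : ∃ d, G.Adj v d ∧ d ≠ a ∧ d ≠ b := by
    by_contra! hcon
    have hsub : G.bdry {v} ⊆ {a, b} := by
      rintro z ⟨_, c, rfl, hz⟩
      by_cases h : z = a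
      · exact .inl h
      · exact .inr (hcon z hz h)
    have h1 := Set.ncard_le_ncard hsub (Set.toFinite _)
    rw [Set.ncard_pair hab] at h1
    have := (hG {v} (connSet_singleton v) (by
      intro h
      rcases (h.symm ▸ trivial : w ∈ {v} ∪ G.bdry {v}) with h' | ⟨_, c, hc, h'⟩
      exacts [hvw h'.symm, hnvw (Set.mem_singleton_iff.mp hc ▸ h')])).1
    omega
  have hdv : d ≠ v := hvd.ne'
  have hdP : d ∉ P := fun h => hnv d (hPC h) hvd
  obtain ⟨D, hD, hdD⟩ := exists_isComp_mem (G := G) (S := ({v, a, b} ∪ P)ᶜ) (x := d)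
    (by simp [hda, hdb, hdv, hdP])
  have hDN := hD.bdry_subset
  rw [compl_compl] at hDN
  have hDv : v ∉ D := fun h => hD.sub h (by simp)
  have hDa : a ∉ D := fun h => hD.sub h (by simp)
  have hDb : b ∉ D := fun h => hD.sub h (by simp)
  have hDP : Disjoint P D := Set.disjoint_left.mpr fun z hz h => hD.sub h (by simp [hz])
  have tDv : G.Touch D {v} := ⟨d, hdD, v, rfl, hvd.symm⟩
  -- Here `{v}`, `P` and `D` are three connections between `a` and `b`, and `D` touches `{v}`.
  by_cases tab : G.Touch D {a} ∧ G.Touch D {b}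
  · refine hG.wheel_of_connections hab hnab (connSet_singleton v) hP hD.conn
      (by simpa using hva.ne') (by simpa using hvb.ne') haP hbP hDa hDb (by simpa using hvP)
      (by simpa using hDv) hDP hPv (touch_singleton.mpr hva) (touch_singleton.mpr hvb) hPa hPb
      tab.1 tab.2 tDv (hDN.trans ?_)
    rintro z ((rfl | rfl | rfl) | h)
    · simp
    · simp
    · simp
    · exact .inr h
  -- If `D` missed `P`, its boundary would consist of `v` and at most one of `a`, `b`. From here on
  -- the poles are `v` and `p` instead of `a` and `b`.
  obtain ⟨p, hp, hpD⟩ : ∃ p ∈ P, p ∈ G.bdry D := by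
    by_contra! hcon
    have hne : D ∪ G.bdry D ≠ Set.univ := by
      intro h
      obtain ⟨p, hp⟩ := hP.1
      rcases (h.symm ▸ trivial : p ∈ D ∪ G.bdry D) with h | h
      exacts [Set.disjoint_left.mp hDP hp h, hcon p hp h]
    have hsub : ∃ c, G.bdry D ⊆ {v, c} := by
      by_cases h : G.Touch D {a}
      · refine ⟨a, fun z hz => ?_⟩
        rcases hDN hz with (rfl | rfl | rfl) | h'
        · simp
        · simp
        · exact absurd ⟨h, (mem_bdry_iff.mp hz).2⟩ tab
        · exact absurd hz (hcon z h')
      · refine ⟨b, fun z hz => ?_⟩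
        rcases hDN hz with (rfl | rfl | rfl) | h'
        · simp
        · exact absurd (mem_bdry_iff.mp hz).2 h
        · simp
        · exact absurd hz (hcon z h')
    obtain ⟨c, hc⟩ := hsub
    have h1 := Set.ncard_le_ncard hc (Set.toFinite _)
    have h2 := Set.ncard_insert_le v {c}
    rw [Set.ncard_singleton] at h2
    have := (hG D hD.conn hne).1
    omega
  have hpv : p ≠ v := fun h => hvP (h ▸ hp)
  have hpa : p ≠ a := fun h => haP (h ▸ hp)
  have hpb : p ≠ b := fun h => hbP (h ▸ hp)
  have hnvp : ¬ G.Adj v p := hnv p (hPC hp)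
  have tDp := (mem_bdry_iff.mp hpD).2
  have hM : G.ConnSet (insert a (insert b P)) := by
    refine (hP.insert hPb).insert (hPa.left (Set.subset_insert _ _))
  have hpM : p ∈ insert a (insert b P) := by simp [hp]
  obtain ⟨A, hA, haA⟩ := exists_isComp_mem (G := G) (S := insert a (insert b P) \ {p}) (x := a)
    ⟨by simp, fun h => hpa h.symm⟩
  obtain ⟨B, hB, hbB⟩ := exists_isComp_mem (G := G) (S := insert a (insert b P) \ {p}) (x := b)
    ⟨by simp, fun h => hpb h.symm⟩
  -- If `a` and `b` stayed connected without `p`, a bridge between them would be a smaller choice of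
  -- `P`. So `A` and `B` are two anticomplete connections between `v` and `p`.
  have hbA : b ∉ A := by
    intro hbA
    obtain ⟨K, hKA, hK, hKa, hKb⟩ := hA.conn.exists_bridge haA hbA hab hnab
    have hKP : K ⊆ P \ {p} := by
      intro z hz
      have h1 := hKA hz
      have h2 := hA.sub h1.1
      have h3 : z ≠ a := fun h => h1.2 (.inl h)
      have h4 : z ≠ b := fun h => h1.2 (.inr h)
      refine ⟨?_, h2.2⟩
      simpa [h3, h4] using h2.1
    have := hPmin (y := K) ⟨hK, fun z hz => hPC (hKP hz).1, hKa, hKb⟩ (fun z hz => (hKP hz).1)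
    exact (hKP (this hp)).2 rfl
  have hdAB : Disjoint A B := hA.disjoint_of_ne hB (fun h => hbA (h ▸ hbB))
  have hnAB : ¬ G.Touch A B := by
    rintro ⟨x, hx, y, hy, hxy⟩
    exact Set.disjoint_left.mp hdAB (hA.mem_of_adj hx (hB.sub hy) hxy) hy
  have hMsub : ∀ z ∈ insert a (insert b P), z ∉ D := by
    rintro z (rfl | rfl | h)
    exacts [hDa, hDb, Set.disjoint_left.mp hDP h]
  have hMv : ∀ z ∈ insert a (insert b P), z ≠ v := by
    rintro z (rfl | rfl | h)
    exacts [hva.ne', hvb.ne', fun he => hvP (he ▸ h)]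
  have hAM : A ⊆ insert a (insert b P) := hA.sub.trans Set.sdiff_subset
  have hBM : B ⊆ insert a (insert b P) := hB.sub.trans Set.sdiff_subset
  have hAp : p ∉ A := fun h => (hA.sub h).2 rfl
  have hBp : p ∉ B := fun h => (hB.sub h).2 rfl
  have hAv : v ∉ A := fun h => hMv v (hAM h) rfl
  have hBv : v ∉ B := fun h => hMv v (hBM h) rfl
  obtain ⟨E, hE, hDE⟩ := exists_isComp_superset hD.conn (S := ({v, p} ∪ A ∪ B)ᶜ) (by
    intro z hz
    have h1 : z ∉ A := fun h => hMsub z (hAM h) hz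
    have h2 : z ∉ B := fun h => hMsub z (hBM h) hz
    have h3 : z ≠ v := fun h => hDv (h ▸ hz)
    have h4 : z ≠ p := fun h => hMsub p hpM (h ▸ hz)
    simp [h1, h2, h3, h4])
  have hEN := hE.bdry_subset
  rw [compl_compl] at hEN
  have hEv : v ∉ E := fun h => hE.sub h (by simp)
  have hEp : p ∉ E := fun h => hE.sub h (by simp)
  have hEA : Disjoint A E := Set.disjoint_left.mpr fun z hz h => hE.sub h (by simp [hz])
  have hEB : Disjoint B E := Set.disjoint_left.mpr fun z hz h => hE.sub h (by simp [hz])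
  have tAv : G.Touch A {v} := ⟨a, haA, v, rfl, hva.symm⟩
  have tBv : G.Touch B {v} := ⟨b, hbB, v, rfl, hvb.symm⟩
  have tAp := hM.isComp_touch hpM hA
  have tBp := hM.isComp_touch hpM hB
  have tEv := tDv.left hDE
  have tEp := tDp.left hDE
  by_cases hEAt : G.Touch E A
  · exact hG.wheel_of_connections hpv.symm hnvp hA.conn hB.conn hE.conn hAv hAp hBv hBp hEv hEp
      hdAB hEA hEB hnAB tAv tAp tBv tBp tEv tEp hEAt hEN
  by_cases hEBt : G.Touch E B
  · refine hG.wheel_of_connections hpv.symm hnvp hB.conn hA.conn hE.conn hBv hBp hAv hAp hEv hEp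
      hdAB.symm hEB hEA (fun h => hnAB h.symm) tBv tBp tAv tAp tEv tEp hEBt (hEN.trans ?_)
    rintro z ((h | h) | h)
    exacts [.inl (.inl h), .inr h, .inl (.inr h)]
  -- Touching neither `A` nor `B`, the set `E` would be cut off by `{v, p}`.
  · exfalso
    have hEA' : ∀ z ∈ A, z ∉ G.bdry E := by
      rintro z hz ⟨_, e, he, hez⟩
      exact hEAt ⟨e, he, z, hz, hez⟩
    have hne : E ∪ G.bdry E ≠ Set.univ := by
      intro h
      rcases (h.symm ▸ trivial : a ∈ E ∪ G.bdry E) with h | h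
      exacts [Set.disjoint_left.mp hEA haA h, hEA' a haA h]
    have hsub : G.bdry E ⊆ {v, p} := by
      intro z hz
      rcases hEN hz with (h | h) | h
      · exact h
      · exact absurd hz (hEA' z h)
      · obtain ⟨_, e, he, hez⟩ := hz
        exact absurd ⟨e, he, z, h, hez⟩ hEBt
    have h1 := Set.ncard_le_ncard hsub (Set.toFinite _)
    rw [Set.ncard_pair hpv.symm] at h1
    have := (hG E hE.conn hne).1
    omega

end Wheel

end SimpleGraph

namespace SimpleGraph

/-! ### Spanning minor models and the shrinking of branch sets. -/

section Models

variable {V W : Type*} {G : SimpleGraph V} {Q : SimpleGraph W} {X : W → Set V}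

/-- A minor model of `Q` in `G` whose branch sets cover all vertices. -/
structure SpanModel (Q : SimpleGraph W) (G : SimpleGraph V) (X : W → Set V) : Prop where
  disjoint : ∀ u v, u ≠ v → Disjoint (X u) (X v)
  conn : ∀ u, G.ConnSet (X u)
  touch : ∀ u v, Q.Adj u v → G.Touch (X u) (X v)
  cover : ∀ v, ∃ u, v ∈ X u

theorem SpanModel.eq_of_mem (h : SpanModel Q G X) {u v : W} {x : V} (hu : x ∈ X u)
    (hv : x ∈ X v) : u = v := by
  by_contra hne
  exact Set.disjoint_left.mp (h.disjoint u v hne) hu hv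

theorem WellLinked.connSet_univ [Finite V] [Nonempty V] (hG : G.WellLinked) :
    G.ConnSet Set.univ := by
  obtain ⟨v⟩ := ‹Nonempty V›
  obtain ⟨K, hK, -⟩ := exists_isComp_mem (G := G) (Set.mem_univ v)
  have hb : G.bdry K = ∅ := by
    have := hK.bdry_subset
    rwa [Set.compl_univ, Set.subset_empty_iff] at this
  by_cases h : K ∪ G.bdry K = Set.univ
  · rw [hb, Set.union_empty] at h
    exact h ▸ hK.conn
  · have := (hG K hK.conn h).1
    rw [hb, Set.ncard_empty] at this
    omega

/-- Take a maximal model. As the graph is connected, an uncovered vertex would allow a vertex next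
to some branch set to be added to it. -/
theorem WellLinked.exists_spanModel [Finite V] [Finite W] [Nonempty W] (hG : G.WellLinked)
    (h : IsMinor Q G) : ∃ X, SpanModel Q G X := by
  classical
  obtain ⟨X₀, hX₀⟩ := h
  obtain ⟨X, hX, hmax⟩ := Set.Finite.exists_maximal (s := {X | IsMinorModel Q G X})
    (Set.toFinite _) ⟨X₀, hX₀⟩
  have hXc := fun u => connSet_iff.mpr (hX.connected u)
  refine ⟨X, hX.disjoint, hXc, hX.adj, ?_⟩
  by_contra! hcon
  obtain ⟨v, hv⟩ := hcon
  obtain ⟨w⟩ := ‹Nonempty W›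
  have : Nonempty V := ⟨v⟩
  obtain ⟨s, hs, t, ht, hst⟩ := hG.connSet_univ.2 (⋃ u, X u) (Set.subset_univ _)
    ((hXc w).1.mono (Set.subset_iUnion _ _)) (fun he => by
      obtain ⟨u, hu⟩ := Set.mem_iUnion.mp (he.symm ▸ trivial : v ∈ ⋃ u, X u)
      exact hv u hu)
  obtain ⟨u, hu⟩ := Set.mem_iUnion.mp hs
  have htX : ∀ u, t ∉ X u := fun u h => ht.2 (Set.mem_iUnion.mpr ⟨u, h⟩)
  have hle : X ≤ Function.update X u (insert t (X u)) := by
    intro z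
    by_cases hz : z = u
    · subst hz; simp
    · simp [hz]
  refine htX u (hmax ⟨fun a b hab => ?_, fun a => ?_, fun a b hab => ?_⟩ hle u (by simp))
  · by_cases ha : a = u <;> by_cases hb : b = u
    · exact absurd (ha.trans hb.symm) hab
    · subst ha
      simpa [hb, htX] using hX.disjoint a b hab
    · subst hb
      simpa [ha, htX] using hX.disjoint a b hab
    · simpa [ha, hb] using hX.disjoint a b hab
  · rw [← connSet_iff]
    by_cases ha : a = u
    · subst ha
      simpa using (hXc a).insert ⟨s, hu, t, rfl, hst⟩
    · simpa [ha] using hXc a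
  · exact Touch.mono (hX.adj a b hab) (hle a) (hle b)

/-- The branch sets other than that of `i` that are touched by `Y`. -/
def labels (G : SimpleGraph V) (X : W → Set V) (i : W) (Y : Set V) : Set W :=
  {j | j ≠ i ∧ G.Touch Y (X j)}

theorem labels_union {i : W} {Y Z : Set V} :
    G.labels X i (Y ∪ Z) = G.labels X i Y ∪ G.labels X i Z := by
  ext j
  simp only [labels, touch_union_left, Set.mem_ofPred_eq, Set.mem_union]
  tauto

/-- A partition of `S` into two connected sets. -/
structure IsSplit (G : SimpleGraph V) (S Y Z : Set V) : Prop where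
  left : G.ConnSet Y
  right : G.ConnSet Z
  disjoint : Disjoint Y Z
  union : Y ∪ Z = S

theorem IsSplit.symm {S Y Z : Set V} (h : G.IsSplit S Y Z) : G.IsSplit S Z Y :=
  ⟨h.right, h.left, h.disjoint.symm, by rw [Set.union_comm, h.union]⟩

theorem IsSplit.diff_right {S Y Z : Set V} (h : G.IsSplit S Y Z) : S \ Y = Z := by
  rw [← h.union, Set.union_sdiff_left, sdiff_eq_left]
  exact h.disjoint.symm

theorem IsSplit.subset_left {S Y Z : Set V} (h : G.IsSplit S Y Z) : Y ⊆ S :=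
  h.union ▸ Set.subset_union_left

theorem IsSplit.touch {S Y Z : Set V} (h : G.IsSplit S Y Z) (hS : G.ConnSet S) :
    G.Touch Y Z := by
  have := hS.touch_diff h.subset_left h.left.1 (fun he => by
    obtain ⟨z, hz⟩ := h.right.1
    rw [← h.diff_right, he] at hz
    exact hz.2 hz.1)
  rwa [h.diff_right] at this

theorem isSplit_diff {S Z : Set V} (hZ : G.ConnSet Z) (hZS : Z ⊆ S) (h : G.ConnSet (S \ Z)) :
    G.IsSplit S (S \ Z) Z :=
  ⟨h, hZ, Set.disjoint_sdiff_left, Set.sdiff_union_of_subset hZS⟩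

theorem IsComp.isSplit {S K : Set V} {p : V} (hS : G.ConnSet S) (hp : p ∈ S)
    (hK : G.IsComp (S \ {p}) K) : G.IsSplit S (S \ K) K :=
  isSplit_diff hK.conn (hK.sub.trans Set.sdiff_subset) (hS.diff_isComp hp hK)

/-- The three parts of a branch set that touch each other and one further branch set each. -/
structure IsTriple (G : SimpleGraph V) (X : W → Set V) (i : W) (P : Fin 3 → Set V)
    (j : Fin 3 → W) : Prop where
  conn : ∀ k, G.ConnSet (P k)
  disjoint : ∀ k l, k ≠ l → Disjoint (P k) (P l)
  touch : ∀ k l, k ≠ l → G.Touch (P k) (P l)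
  sub : ∀ k, P k ⊆ X i
  label : ∀ k, G.Touch (P k) (X (j k))
  inj : Function.Injective j
  total : ∀ w ∈ G.labels X i (X i), ∃ k, w = j k

theorem IsTriple.of_parts {i : W} {A B C : Set V} {a b c : W} (hA : G.ConnSet A)
    (hB : G.ConnSet B) (hC : G.ConnSet C) (dAB : Disjoint A B) (dAC : Disjoint A C)
    (dBC : Disjoint B C) (tAB : G.Touch A B) (tAC : G.Touch A C) (tBC : G.Touch B C)
    (hX : A ∪ B ∪ C = X i) (ha : G.labels X i A = {a}) (hb : G.labels X i B = {b})
    (hc : G.labels X i C = {c}) (hab : a ≠ b) (hac : a ≠ c) (hbc : b ≠ c) :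
    G.IsTriple X i ![A, B, C] ![a, b, c] := by
  have ha' : a ∈ G.labels X i A := ha ▸ rfl
  have hb' : b ∈ G.labels X i B := hb ▸ rfl
  have hc' : c ∈ G.labels X i C := hc ▸ rfl
  refine ⟨?_, ?_, ?_, ?_, ?_, ?_, ?_⟩
  · intro k; fin_cases k <;> assumption
  · intro k l h
    fin_cases k <;> fin_cases l <;>
      first | exact absurd rfl h | assumption | (apply Disjoint.symm; assumption)
  · intro k l h
    fin_cases k <;> fin_cases l <;>
      first | exact absurd rfl h | assumption | (apply Touch.symm; assumption)
  · intro k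
    rw [← hX]
    fin_cases k
    · exact fun x hx => .inl (.inl hx)
    · exact fun x hx => .inl (.inr hx)
    · exact fun x hx => .inr hx
  · intro k
    fin_cases k
    exacts [ha'.2, hb'.2, hc'.2]
  · intro k l h
    fin_cases k <;> fin_cases l <;> simp_all
  · intro w hw
    rw [← hX, labels_union, labels_union, ha, hb, hc] at hw
    rcases hw with (h | h) | h
    exacts [⟨0, h⟩, ⟨1, h⟩, ⟨2, h⟩]

/-- Moving a part of a branch set to another branch set. -/
theorem SpanModel.move [DecidableEq W] (hm : SpanModel Q G X) {i j : W} (hij : j ≠ i)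
    {Y Z : Set V} (h : G.IsSplit (X i) Y Z) (hj : G.Touch Z (X j))
    (hQ : ∀ k, Q.Adj i k → k ≠ j → G.Touch Y (X k)) :
    SpanModel Q G (Function.update (Function.update X i Y) j (X j ∪ Z)) := by
  have hYX := h.subset_left
  have hZX := h.symm.subset_left
  have hdis : ∀ k, k ≠ i → Disjoint (X k) Y ∧ Disjoint (X k) Z := fun k hk =>
    ⟨(hm.disjoint k i hk).mono_right hYX, (hm.disjoint k i hk).mono_right hZX⟩
  have hYj : G.Touch Y (X j ∪ Z) := (h.touch (hm.conn i)).right Set.subset_union_right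
  set X' := Function.update (Function.update X i Y) j (X j ∪ Z) with hX'
  have ej : X' j = X j ∪ Z := by simp [hX']
  have ei : X' i = Y := by simp [hX', hij.symm]
  have ek : ∀ k, k ≠ i → k ≠ j → X' k = X k := fun k h1 h2 => by simp [hX', h1, h2]
  have hle : ∀ k, k ≠ i → X k ⊆ X' k := by
    intro k hk
    by_cases hkj : k = j
    · rw [hkj, ej]; exact Set.subset_union_left
    · rw [ek k hk hkj]
  have hd : ∀ a b, a ≠ b → b ≠ i → Disjoint (X' a) (X' b) := by
    intro a b hab hbi
    by_cases hai : a = i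
    · subst hai
      rw [ei]
      by_cases hbj : b = j
      · rw [hbj, ej, Set.disjoint_union_right]
        exact ⟨(hdis j hij).1.symm, h.disjoint⟩
      · rw [ek b hbi hbj]; exact (hdis b hbi).1.symm
    · by_cases haj : a = j
      · have hbj : b ≠ j := fun h => hab (haj.trans h.symm)
        rw [haj, ej, ek b hbi hbj, Set.disjoint_union_left]
        exact ⟨hm.disjoint j b hbj.symm, (hdis b hbi).2.symm⟩
      · rw [ek a hai haj]
        by_cases hbj : b = j
        · rw [hbj, ej, Set.disjoint_union_right]
          exact ⟨hm.disjoint a j haj, (hdis a hai).2⟩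
        · rw [ek b hbi hbj]; exact hm.disjoint a b hab
  refine ⟨fun a b hab => ?_, fun a => ?_, fun a b hab => ?_, fun v => ?_⟩
  · by_cases hbi : b = i
    · exact (hd b a hab.symm fun h => hab (h.trans hbi.symm)).symm
    · exact hd a b hab hbi
  · by_cases hai : a = i
    · rw [hai, ei]; exact h.left
    · by_cases haj : a = j
      · rw [haj, ej]; exact (hm.conn j).union h.right (.inr hj.symm)
      · rw [ek a hai haj]; exact hm.conn a
  · have key : ∀ b, Q.Adj i b → G.Touch (X' i) (X' b) := by
      intro b hb
      rw [ei]
      by_cases hbj : b = j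
      · rw [hbj, ej]; exact hYj
      · exact (hQ b hb hbj).right (hle b hb.ne')
    by_cases hai : a = i
    · subst hai; exact key b hab
    · by_cases hbi : b = i
      · subst hbi; exact (key a hab.symm).symm
      · exact (hm.touch a b hab).mono (hle a hai) (hle b hbi)
  · obtain ⟨k, hk⟩ := hm.cover v
    by_cases hki : k = i
    · rw [hki, ← h.union] at hk
      rcases hk with hk | hk
      · exact ⟨i, by rwa [ei]⟩
      · exact ⟨j, by rw [ej]; exact .inr hk⟩
    · exact ⟨k, hle k hki hk⟩

variable [Finite V]

/-- The part `Z` meets the rest of its branch set only through `y`. If it touched no other branch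
set, or only one that is a single vertex `x`, then its boundary would lie in `{y, x}`; `h3` supplies
a vertex beyond this boundary. So `Z` can be handed to a branch set outside `F`. -/
theorem SpanModel.exists_movable (hm : SpanModel Q G X) (hG : G.WellLinked) {i : W} {F : Set W}
    (hF : ∀ j ∈ F, ∃ x, X j = {x})
    (h3 : ∀ a b, ∃ c ∈ G.labels X i (X i), c ≠ a ∧ c ≠ b) {Y Z : Set V}
    (hYZ : G.IsSplit (X i) Y Z) (hZ : (G.labels X i Z).Subsingleton) {y : V}
    (hy : ∀ z ∈ Z, ∀ w ∈ Y, G.Adj z w → w = y) : ∃ j ∉ F, G.labels X i Z = {j} := by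
  by_contra! hcon
  obtain ⟨j, x, hjx⟩ : ∃ (j : W) (x : V), ∀ k ∈ G.labels X i Z, k = j ∧ X k = {x} := by
    rcases hZ.eq_empty_or_singleton with h | ⟨j, h⟩
    · rw [h]; exact ⟨i, y, by simp⟩
    · have hj : j ∈ F := by
        by_contra hj
        exact hcon j hj h
      obtain ⟨x, hx⟩ := hF j hj
      refine ⟨j, x, fun k hk => ?_⟩
      rw [h] at hk
      rw [Set.mem_singleton_iff.mp hk]
      exact ⟨rfl, hx⟩
  have hsub : G.bdry Z ⊆ {y, x} := by
    rintro v ⟨hv, z, hz, hzv⟩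
    obtain ⟨k, hk⟩ := hm.cover v
    by_cases hki : k = i
    · subst hki
      rw [← hYZ.union] at hk
      exact .inl (hy z hz v (hk.resolve_right hv) hzv)
    · have := (hjx k ⟨hki, z, hz, v, hk, hzv⟩).2
      rw [this] at hk
      exact .inr hk
  obtain ⟨c, hc, hcj, -⟩ := h3 j j
  obtain ⟨v, hv⟩ := (hm.conn c).1
  have hne : Z ∪ G.bdry Z ≠ Set.univ := by
    intro h
    rcases (h.symm ▸ trivial : v ∈ Z ∪ G.bdry Z) with h | ⟨-, z, hz, hzv⟩
    · exact hc.1 (hm.eq_of_mem hv (hYZ.symm.subset_left h))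
    · exact hcj (hjx c ⟨hc.1, z, hz, v, hv, hzv⟩).1
  have h1 := Set.ncard_le_ncard hsub (Set.toFinite _)
  have h2 := Set.ncard_insert_le y {x}
  rw [Set.ncard_singleton] at h2
  have := (hG Z hYZ.right hne).1
  omega

/-- How a branch set with at least two vertices can be cut into connected parts. -/
theorem SpanModel.exists_cut (hm : SpanModel Q G X) (hG : G.WellLinked) {i : W} {F : Set W}
    (hF : ∀ j ∈ F, ∃ x, X j = {x})
    (h3 : ∀ a b, ∃ c ∈ G.labels X i (X i), c ≠ a ∧ c ≠ b) (hbig : ¬ ∃ x, X i = {x}) :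
    (∃ Y Z, G.IsSplit (X i) Y Z ∧ ∃ j ∉ F, G.labels X i Z = {j}) ∨
    (∃ Y Z, G.IsSplit (X i) Y Z ∧ (G.labels X i Y).Nontrivial ∧ (G.labels X i Z).Nontrivial) ∨
    ∃ P j, G.IsTriple X i P j := by
  by_cases hb : ∃ Y Z, G.IsSplit (X i) Y Z ∧ (G.labels X i Y).Nontrivial ∧
      (G.labels X i Z).Nontrivial
  · exact .inr (.inl hb)
  by_cases hmv : ∃ Y Z, G.IsSplit (X i) Y Z ∧ ∃ j ∉ F, G.labels X i Z = {j}
  · exact .inl hmv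
  right; right
  have hb' : ∀ Y Z, G.IsSplit (X i) Y Z → (G.labels X i Y).Nontrivial →
      (G.labels X i Z).Subsingleton := by
    intro Y Z h hY
    by_contra hZ
    exact hb ⟨Y, Z, h, hY, Set.not_subsingleton_iff.mp hZ⟩
  -- Assuming the first two outcomes fail, a part with at most one label must be attached to the
  -- other part through at least two vertices of that part.
  have hstuck : ∀ Y Z, G.IsSplit (X i) Y Z → (G.labels X i Z).Subsingleton → ∀ y,
      (∀ z ∈ Z, ∀ w ∈ Y, G.Adj z w → w = y) → False := fun Y Z h hZ y hy =>
    hmv ⟨Y, Z, h, hm.exists_movable hG hF h3 h hZ hy⟩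
  have hsing : ∀ {S : Set W}, S.Subsingleton → ∀ a ∈ S, S = {a} := fun hS a ha =>
    Set.eq_singleton_iff_unique_mem.mpr ⟨ha, fun b hb => hS hb ha⟩
  have htot : ∀ Y Z, G.IsSplit (X i) Y Z → (G.labels X i Z).Subsingleton →
      (G.labels X i Y).Nontrivial := by
    intro Y Z h hZ
    by_contra hY
    rw [Set.not_nontrivial_iff] at hY
    obtain ⟨a, ha⟩ : ∃ a, G.labels X i Y ⊆ {a} := by
      rcases hY.eq_empty_or_singleton with h | ⟨a, h⟩
      exacts [⟨i, by simp [h]⟩, ⟨a, h.subset⟩]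
    obtain ⟨b, hb⟩ : ∃ b, G.labels X i Z ⊆ {b} := by
      rcases hZ.eq_empty_or_singleton with h | ⟨a, h⟩
      exacts [⟨i, by simp [h]⟩, ⟨a, h.subset⟩]
    obtain ⟨c, hc, hca, hcb⟩ := h3 a b
    rw [← h.union, labels_union] at hc
    rcases hc with hc | hc
    exacts [hca (ha hc), hcb (hb hc)]
  have hXi := hm.conn i
  obtain ⟨K₀, Z₀, hKZ₀, hK₀⟩ : ∃ K Z, G.IsSplit (X i) K Z ∧ (G.labels X i K).Nontrivial := by
    obtain ⟨p, hp⟩ := hXi.1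
    obtain ⟨q, hq, hqp⟩ : ∃ q ∈ X i, q ≠ p := by
      by_contra! h
      exact hbig ⟨p, Set.eq_singleton_iff_unique_mem.mpr ⟨hp, h⟩⟩
    obtain ⟨K, hK, -⟩ := exists_isComp_mem (G := G) (S := X i \ {p}) (x := q) ⟨hq, hqp⟩
    have hs := hK.isSplit hXi hp
    by_cases h : (G.labels X i K).Subsingleton
    · exact ⟨_, _, hs, htot _ _ hs h⟩
    · exact ⟨_, _, hs.symm, Set.not_subsingleton_iff.mp h⟩
  -- `K` is a minimal part with at least two labels. Hence, for `y` in `K`, each component of `K \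
  -- {y}` has at most one label and, not being attached through `y` alone, touches `Z`.
  obtain ⟨K, ⟨⟨Z, hKZ⟩, hK⟩, hmin⟩ := Set.Finite.exists_minimal
    (s := {K | (∃ Z, G.IsSplit (X i) K Z) ∧ (G.labels X i K).Nontrivial}) (Set.toFinite _)
    ⟨K₀, ⟨Z₀, hKZ₀⟩, hK₀⟩
  have hZ := hb' K Z hKZ hK
  obtain ⟨y, hy, z₀, hz₀, hyz⟩ := hKZ.touch hXi
  have hcomp : ∀ A, G.IsComp (K \ {y}) A → G.IsSplit (X i) (Z ∪ (K \ A)) A := by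
    intro A hA
    have hAK : A ⊆ K := hA.sub.trans Set.sdiff_subset
    have hyA : y ∉ A := fun h => (hA.sub h).2 rfl
    refine ⟨hKZ.right.union (hKZ.left.diff_isComp hy hA) (.inr ⟨z₀, hz₀, y, ⟨hy, hyA⟩, hyz.symm⟩),
      hA.conn, ?_, ?_⟩
    · rw [Set.disjoint_union_left]
      exact ⟨hKZ.disjoint.symm.mono_right hAK, Set.disjoint_sdiff_left⟩
    · rw [Set.union_assoc, Set.sdiff_union_of_subset hAK, Set.union_comm, hKZ.union]
  have hlab : ∀ A, G.IsComp (K \ {y}) A → (G.labels X i A).Subsingleton := by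
    intro A hA
    by_contra h
    have hAK : A ⊆ K := hA.sub.trans Set.sdiff_subset
    have := hmin ⟨⟨_, (hcomp A hA).symm⟩, Set.not_subsingleton_iff.mp h⟩ hAK hy
    exact (hA.sub this).2 rfl
  have htouch : ∀ A, G.IsComp (K \ {y}) A → G.Touch A Z := by
    intro A hA
    by_contra h
    refine hstuck _ _ (hcomp A hA) (hlab A hA) y fun a ha w hw haw => ?_
    rcases hw with hw | hw
    · exact absurd ⟨a, ha, w, hw, haw⟩ h
    · by_contra hwy
      exact hw.2 (hA.mem_of_adj ha ⟨hw.1, hwy⟩ haw)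
  have hyZ : y ∉ Z := Set.disjoint_left.mp hKZ.disjoint hy
  have hyX : y ∈ X i := hKZ.subset_left hy
  -- Every component of `K \ {y}` touches the connected set `Z`, so deleting `y` does not disconnect
  -- the branch set.
  have hU : G.IsSplit (X i) {y} (X i \ {y}) := by
    have hZU : Z ⊆ X i \ {y} := fun z hz =>
      ⟨hKZ.symm.subset_left hz, fun h => hyZ (Set.mem_singleton_iff.mp h ▸ hz)⟩
    obtain ⟨A, hA, hZA⟩ := exists_isComp_superset hKZ.right hZU
    have hAU : X i \ {y} = A := by
      refine Set.Subset.antisymm (fun x hx => ?_) hA.sub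
      by_cases hxZ : x ∈ Z
      · exact hZA hxZ
      have hxK : x ∈ K := by
        have := hx.1
        rw [← hKZ.union] at this
        exact this.resolve_right hxZ
      obtain ⟨B, hB, hxB⟩ := exists_isComp_mem (G := G) (S := K \ {y}) (x := x) ⟨hxK, hx.2⟩
      obtain ⟨b, hbB, z, hz, hbz⟩ := htouch B hB
      have hBU : B ⊆ X i \ {y} := fun b hb => ⟨hKZ.subset_left (hB.sub hb).1, (hB.sub hb).2⟩
      exact hA.subset_of_conn hB.conn hBU ⟨b, hbB, hA.mem_of_adj (hZA hz) (hBU hbB) hbz.symm⟩ hxB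
    rw [hAU]
    refine ⟨connSet_singleton y, hA.conn, ?_, ?_⟩
    · rw [← hAU]; exact Set.disjoint_sdiff_right
    · rw [← hAU]; exact Set.union_sdiff_cancel (Set.singleton_subset_iff.mpr hyX)
  have hUn : (G.labels X i (X i \ {y})).Nontrivial := by
    by_contra h
    rw [Set.not_nontrivial_iff] at h
    exact hstuck _ _ hU h y fun z _ w hw _ => hw
  -- the last step, once two parts with different labels have been found
  have hfin : ∀ A B a b, G.IsComp (K \ {y}) B → G.ConnSet A → Z ⊆ A → A ⊆ X i → y ∉ A →
      Disjoint A B → G.ConnSet (X i \ (A ∪ B)) → G.labels X i A = {a} → G.labels X i B = {b} →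
      a ≠ b → ∃ P j, G.IsTriple X i P j := by
    intro A B a b hB hA hZA hAX hyA hAB hC ha hb hab
    have hBX : B ⊆ X i := (hcomp B hB).symm.subset_left
    have hyB : y ∉ B := fun h => (hB.sub h).2 rfl
    have tBA : G.Touch B A := (htouch B hB).right hZA
    have hyC : y ∈ X i \ (A ∪ B) := ⟨hyX, by simp [hyA, hyB]⟩
    have hs : G.IsSplit (X i) (X i \ (A ∪ B)) (A ∪ B) :=
      isSplit_diff (hA.union hB.conn (.inr tBA.symm)) (Set.union_subset hAX hBX) hC
    -- `A ∪ B` has two labels, so the remainder, which contains `y`, has at most one; the third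
    -- label guaranteed by `h3` must belong to it.
    have hCl := hb' _ _ hs.symm (by
      rw [labels_union, ha, hb]
      exact ⟨a, .inl rfl, b, .inr rfl, hab⟩)
    obtain ⟨c, hc, hca, hcb⟩ := h3 a b
    rw [← hs.union, labels_union, labels_union, ha, hb] at hc
    have hc' : c ∈ G.labels X i (X i \ (A ∪ B)) := by
      rcases hc with h | h | h
      exacts [h, absurd h hca, absurd h hcb]
    refine ⟨_, _, IsTriple.of_parts hA hB.conn hC hAB ?_ ?_ tBA.symm
      ⟨z₀, hZA hz₀, y, hyC, hyz.symm⟩ ((hKZ.left.isComp_touch hy hB).right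
        (Set.singleton_subset_iff.mpr hyC)) ?_ ha hb (hsing hCl c hc') hab hca.symm hcb.symm⟩
    · exact Set.disjoint_left.mpr fun x hx h => h.2 (.inl hx)
    · exact Set.disjoint_left.mpr fun x hx h => h.2 (.inr hx)
    · rw [Set.union_comm]; exact hs.union
  have hexB : ∀ j ∈ G.labels X i (X i \ {y}), j ∉ G.labels X i Z →
      ∃ B, G.IsComp (K \ {y}) B ∧ G.labels X i B = {j} := by
    rintro j ⟨hji, x, hx, w, hw, hxw⟩ hjZ
    have hxZ : x ∉ Z := fun h => hjZ ⟨hji, x, h, w, hw, hxw⟩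
    have hxK : x ∈ K := by
      have := hx.1
      rw [← hKZ.union] at this
      exact this.resolve_right hxZ
    obtain ⟨B, hB, hxB⟩ := exists_isComp_mem (G := G) (S := K \ {y}) (x := x) ⟨hxK, hx.2⟩
    exact ⟨B, hB, hsing (hlab B hB) j ⟨hji, x, hxB, w, hw, hxw⟩⟩
  obtain ⟨j₁, hj₁, j₂, hj₂, hj⟩ := hUn
  have hKB : ∀ B, X i \ (Z ∪ B) = K \ B := by
    intro B
    ext x
    rw [← hKZ.union]
    have := fun h : x ∈ K => Set.disjoint_left.mp hKZ.disjoint h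
    simp only [Set.mem_sdiff, Set.mem_union]
    tauto
  have hBZ : ∀ B, G.IsComp (K \ {y}) B → Disjoint Z B := fun B hB =>
    hKZ.disjoint.symm.mono_right (hB.sub.trans Set.sdiff_subset)
  -- If `Z` has no label, it is merged with one labelled component and a second component is the
  -- other part. If `Z` has a label, it serves as a part itself.
  rcases hZ.eq_empty_or_singleton with hZ0 | ⟨a, hZa⟩
  · obtain ⟨A, hA, hAl⟩ := hexB j₁ hj₁ (by rw [hZ0]; simp)
    obtain ⟨B, hB, hBl⟩ := hexB j₂ hj₂ (by rw [hZ0]; simp)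
    have hAB : A ≠ B := by
      rintro rfl
      exact hj (Set.singleton_injective (hAl.symm.trans hBl))
    have hd := hA.disjoint_of_ne hB hAB
    have hAK : A ⊆ K := hA.sub.trans Set.sdiff_subset
    have hyA : y ∉ A := fun h => (hA.sub h).2 rfl
    refine hfin (Z ∪ A) B j₁ j₂ hB (hKZ.right.union hA.conn (.inr (htouch A hA).symm))
      Set.subset_union_left (Set.union_subset hKZ.symm.subset_left (hAK.trans hKZ.subset_left))
      (by simp [hyA, hyZ]) (Set.disjoint_union_left.mpr ⟨hBZ B hB, hd⟩) ?_
      (by rw [labels_union, hZ0, Set.empty_union, hAl]) hBl hj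
    have h1 := (hKZ.left.diff_isComp hy hA).diff_isComp (p := y) (C := B) ⟨hy, hyA⟩
      ⟨hB.conn, fun b hb => ⟨⟨(hB.sub hb).1, Set.disjoint_right.mp hd hb⟩, (hB.sub hb).2⟩,
        fun h => hB.notTouch (h.right fun x hx => ⟨⟨hx.1.1.1, hx.1.2⟩, hx.2⟩)⟩
    rwa [Set.union_assoc, hKB, ← Set.sdiff_sdiff]
  · obtain ⟨j, hjU, hja⟩ : ∃ j ∈ G.labels X i (X i \ {y}), j ≠ a := by
      by_cases h : j₁ = a
      · exact ⟨j₂, hj₂, fun h' => hj (h.trans h'.symm)⟩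
      · exact ⟨j₁, hj₁, h⟩
    obtain ⟨B, hB, hBl⟩ := hexB j hjU (by rw [hZa]; exact hja)
    refine hfin Z B a j hB hKZ.right subset_rfl hKZ.symm.subset_left hyZ (hBZ B hB) ?_ hZa hBl
      hja.symm
    rw [hKB]
    exact hKZ.left.diff_isComp hy hB

/-- The measure for shrinking is the size of `X i`. Since `i` and `j` are outside `F`, the branch
sets that are already single vertices are untouched. -/
theorem SpanModel.exists_move (hm : SpanModel Q G X) {F : Set W}
    (hF : ∀ j ∈ F, ∃ x, X j = {x}) {i j : W} (hi : i ∉ F) (hjF : j ∉ F) (hij : j ≠ i)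
    {Y Z : Set V} (h : G.IsSplit (X i) Y Z) (hj : G.Touch Z (X j))
    (hQ : ∀ k, Q.Adj i k → k ≠ j → G.Touch Y (X k)) :
    ∃ X', SpanModel Q G X' ∧ (∀ j ∈ F, ∃ x, X' j = {x}) ∧ (X' i).ncard < (X i).ncard := by
  classical
  refine ⟨_, hm.move hij h hj hQ, fun k hk => ?_, ?_⟩
  · have h1 : k ≠ i := fun h => hi (h ▸ hk)
    have h2 : k ≠ j := fun h => hjF (h ▸ hk)
    simpa [h1, h2] using hF k hk
  · have : Function.update (Function.update X i Y) j (X j ∪ Z) i = Y := by simp [hij.symm]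
    rw [this]
    refine Set.ncard_lt_ncard ?_ (Set.toFinite _)
    refine h.subset_left.ssubset_of_ne fun he => ?_
    obtain ⟨z, hz⟩ := h.right.1
    rw [← h.diff_right, he] at hz
    exact hz.2 hz.1

/-- A branch set can be shrunk to a single vertex, unless one of its cuts has a consequence of
interest. -/
theorem WellLinked.shrink (hG : G.WellLinked) {goal : Prop} {F : Set W} {i : W} (hi : i ∉ F)
    (h3 : ∀ a b, ∃ c, Q.Adj i c ∧ c ≠ a ∧ c ≠ b)
    (hb : ∀ X, SpanModel Q G X → (∀ j ∈ F, ∃ x, X j = {x}) → ∀ Y Z, G.IsSplit (X i) Y Z →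
      (G.labels X i Y).Nontrivial → (G.labels X i Z).Nontrivial →
      goal ∨ ∃ X', SpanModel Q G X' ∧ (∀ j ∈ F, ∃ x, X' j = {x}) ∧ (X' i).ncard < (X i).ncard)
    (hc : ∀ X, SpanModel Q G X → (∀ j ∈ F, ∃ x, X j = {x}) → ∀ P j, G.IsTriple X i P j → goal)
    {X : W → Set V} (hm : SpanModel Q G X) (hF : ∀ j ∈ F, ∃ x, X j = {x}) :
    goal ∨ ∃ X', SpanModel Q G X' ∧ ∀ j ∈ insert i F, ∃ x, X' j = {x} := by
  induction hn : (X i).ncard using Nat.strong_induction_on generalizing X with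
  | _ n ih =>
    by_cases hbig : ∃ x, X i = {x}
    · right
      refine ⟨X, hm, ?_⟩
      rintro j (rfl | hj)
      exacts [hbig, hF j hj]
    have h3' : ∀ a b, ∃ c ∈ G.labels X i (X i), c ≠ a ∧ c ≠ b := by
      intro a b
      obtain ⟨c, hc, h⟩ := h3 a b
      exact ⟨c, ⟨hc.ne', hm.touch i c hc⟩, h⟩
    have hsmaller : (∃ X', SpanModel Q G X' ∧ (∀ j ∈ F, ∃ x, X' j = {x}) ∧
        (X' i).ncard < (X i).ncard) →
        goal ∨ ∃ X', SpanModel Q G X' ∧ ∀ j ∈ insert i F, ∃ x, X' j = {x} := by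
      rintro ⟨X', h1, h2, h4⟩
      exact ih _ (hn ▸ h4) h1 h2 rfl
    rcases hm.exists_cut hG hF h3' hbig with ⟨Y, Z, hs, j, hjF, hl⟩ | ⟨Y, Z, hs, hY, hZ⟩ |
      ⟨P, j, hP⟩
    -- The detached part has `j` as its only label, so all other adjacencies of `i` are kept by the
    -- remaining part.
    · have hj : j ∈ G.labels X i Z := hl ▸ rfl
      refine hsmaller (hm.exists_move hF hi hjF hj.1 hs hj.2 fun k hk hkj => ?_)
      have hk' : k ∈ G.labels X i (X i) := ⟨hk.ne', hm.touch i k hk⟩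
      rw [← hs.union, labels_union, hl] at hk'
      exact (hk'.resolve_right hkj).2
    · rcases hb X hm hF Y Z hs hY hZ with h | h
      exacts [.inl h, hsmaller h]
    · exact .inl (hc X hm hF P j hP)

end Models

end SimpleGraph

namespace SimpleGraph

/-! ### Clique models: Hadwiger number at least five. -/

section Complete

variable {V W : Type*} {G : SimpleGraph V} {Q : SimpleGraph W} {X : W → Set V}

theorem connSet_of_pairwise {T : Set V} (hne : T.Nonempty)
    (h : ∀ u ∈ T, ∀ v ∈ T, u ≠ v → G.Adj u v) : G.ConnSet T := by
  refine ⟨hne, fun U hU ⟨u, hu⟩ hn => ?_⟩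
  obtain ⟨w, hw, hwU⟩ : ∃ w ∈ T, w ∉ U := by
    by_contra! hc
    exact hn (hU.antisymm hc)
  exact ⟨u, hu, w, ⟨hw, hwU⟩, h u (hU hu) w hw fun he => hwU (he ▸ hu)⟩

theorem K5Minus_adj {i j : Fin 5} : K5Minus.Adj i j ↔ i ≠ j ∧ s(i, j) ≠ s(0, 1) := by
  simp [K5Minus, completeGraph]

theorem isInducedMinor_K5Minus {T : Fin 5 → Set V} (hT : ∀ k, G.ConnSet (T k))
    (hd : ∀ k l, k ≠ l → Disjoint (T k) (T l))
    (ht : ∀ k l, k ≠ l → s(k, l) ≠ s(0, 1) → G.Touch (T k) (T l))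
    (hn : ¬ G.Touch (T 0) (T 1)) : IsInducedMinor K5Minus G := by
  refine ⟨T, hd, fun k => connSet_iff.mp (hT k), fun k l hkl => ?_⟩
  rw [K5Minus_adj]
  constructor
  · refine fun h => ⟨hkl, fun he => ?_⟩
    rcases Sym2.eq_iff.mp he with ⟨rfl, rfl⟩ | ⟨rfl, rfl⟩
    exacts [hn h, hn (Touch.symm h)]
  · exact fun h => ht k l h.1 h.2

theorem isInducedMinor_K5Minus_of_parts {S₀ S₁ A B C : Set V} (h0 : G.ConnSet S₀)
    (h1 : G.ConnSet S₁) (hA : G.ConnSet A) (hB : G.ConnSet B) (hC : G.ConnSet C)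
    (d01 : Disjoint S₀ S₁) (d0A : Disjoint S₀ A) (d0B : Disjoint S₀ B) (d0C : Disjoint S₀ C)
    (d1A : Disjoint S₁ A) (d1B : Disjoint S₁ B) (d1C : Disjoint S₁ C) (dAB : Disjoint A B)
    (dAC : Disjoint A C) (dBC : Disjoint B C) (t0A : G.Touch S₀ A) (t0B : G.Touch S₀ B)
    (t0C : G.Touch S₀ C) (t1A : G.Touch S₁ A) (t1B : G.Touch S₁ B) (t1C : G.Touch S₁ C)
    (tAB : G.Touch A B) (tAC : G.Touch A C) (tBC : G.Touch B C) (hn : ¬ G.Touch S₀ S₁) :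
    IsInducedMinor K5Minus G := by
  refine isInducedMinor_K5Minus (T := ![S₀, S₁, A, B, C]) ?_ ?_ ?_ hn
  · intro k; fin_cases k <;> assumption
  · intro k l h
    fin_cases k <;> fin_cases l <;>
      first | exact absurd rfl h | assumption | (apply Disjoint.symm; assumption)
  · intro k l h h'
    fin_cases k <;> fin_cases l <;>
      first | exact absurd rfl h | exact absurd rfl h' | exact absurd Sym2.eq_swap h' |
        assumption | (apply Touch.symm; assumption)

/-- If the two branch sets of the missing edge touched, the model would be one of K₅. -/
theorem IsMinor.isInducedMinor_K5Minus [Finite V] (h : IsMinor K5Minus G)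
    (h4 : G.hadwigerNumber ≤ 4) : IsInducedMinor K5Minus G := by
  obtain ⟨X, hX⟩ := h
  refine SimpleGraph.isInducedMinor_K5Minus (fun k => connSet_iff.mpr (hX.connected k)) hX.disjoint
    (fun k l h h' => hX.adj k l (K5Minus_adj.mpr ⟨h, h'⟩)) fun h01 => ?_
  have : IsMinor (completeGraph (Fin 5)) G := by
    refine ⟨X, hX.disjoint, hX.connected, fun k l hkl => ?_⟩
    by_cases h : s(k, l) = s(0, 1)
    · rcases Sym2.eq_iff.mp h with ⟨rfl, rfl⟩ | ⟨rfl, rfl⟩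
      exacts [h01, h01.symm]
    · exact hX.adj k l (K5Minus_adj.mpr ⟨hkl.ne, h⟩)
  have := (isGreatest_hadwigerNumber G).2 this
  omega

open Classical in
/-- The family of branch sets in which that of `i` is replaced by `Y`, and `Z` is added. -/
noncomputable def cutFamily (X : W → Set V) (i : W) (Y Z : Set V) : Option W → Set V
  | none => Z
  | some w => if w = i then Y else X w

theorem cutFamily_self {i : W} {Y Z : Set V} : cutFamily X i Y Z (some i) = Y := if_pos rfl

theorem cutFamily_ne {i w : W} {Y Z : Set V} (h : w ≠ i) : cutFamily X i Y Z (some w) = X w :=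
  if_neg h

theorem SpanModel.conn_cutFamily (hm : SpanModel Q G X) {i : W} {Y Z : Set V}
    (h : G.IsSplit (X i) Y Z) (o : Option W) : G.ConnSet (cutFamily X i Y Z o) := by
  rcases o with _ | w
  · exact h.right
  · by_cases hw : w = i
    · subst hw; rw [cutFamily_self]; exact h.left
    · rw [cutFamily_ne hw]; exact hm.conn w

theorem SpanModel.disjoint_cutFamily (hm : SpanModel Q G X) {i : W} {Y Z : Set V}
    (h : G.IsSplit (X i) Y Z) (o o' : Option W) (hne : o ≠ o') :
    Disjoint (cutFamily X i Y Z o) (cutFamily X i Y Z o') := by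
  have key : ∀ (w : W) (o : Option W), some w ≠ o → w ≠ i →
      Disjoint (X w) (cutFamily X i Y Z o) := by
    intro w o ho hw
    rcases o with _ | w'
    · exact (hm.disjoint w i hw).mono_right h.symm.subset_left
    · by_cases hw' : w' = i
      · subst hw'; rw [cutFamily_self]; exact (hm.disjoint w w' hw).mono_right h.subset_left
      · rw [cutFamily_ne hw']; exact hm.disjoint w w' fun h => ho (by rw [h])
  have key' : ∀ (w : W) (o : Option W), some w ≠ o → w ≠ i →
      Disjoint (cutFamily X i Y Z (some w)) (cutFamily X i Y Z o) := by
    intro w o ho hw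
    rw [cutFamily_ne hw]
    exact key w o ho hw
  rcases o with _ | w <;> rcases o' with _ | w'
  · exact absurd rfl hne
  · by_cases hw : w' = i
    · subst hw; rw [cutFamily_self]; exact h.disjoint.symm
    · exact (key' w' none (by simp) hw).symm
  · by_cases hw : w = i
    · subst hw; rw [cutFamily_self]; exact h.disjoint
    · exact key' w none (by simp) hw
  · by_cases hw : w = i
    · refine (key' w' (some w) hne.symm fun h => hne (by rw [hw, h])).symm
    · exact key' w (some w') hne hw

theorem completeGraph_touch {p : ℕ} {X : Fin p → Set V}
    (hm : SpanModel (completeGraph (Fin p)) G X) {i j : Fin p} (h : i ≠ j) :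
    G.Touch (X i) (X j) := hm.touch i j h

/-- In a clique model, a cut of a branch set with overlapping but different label sets. -/
theorem isInducedMinor_K5Minus_of_overlap {p : ℕ} {X : Fin p → Set V}
    (hm : SpanModel (completeGraph (Fin p)) G X) {i : Fin p} {Y Z : Set V}
    (h : G.IsSplit (X i) Y Z) {b : Fin p} (hb : b ∈ G.labels X i Z) (hbY : b ∉ G.labels X i Y)
    (hI : (G.labels X i Y ∩ G.labels X i Z).Nontrivial) : IsInducedMinor K5Minus G := by
  obtain ⟨j, ⟨hjY, hjZ⟩, k, ⟨hkY, hkZ⟩, hjk⟩ := hI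
  have dY : ∀ {l}, l ∈ G.labels X i Y ∪ G.labels X i Z → Disjoint Y (X l) := fun {l} hl =>
    (hm.disjoint i l (by rcases hl with hl | hl <;> exact hl.1.symm)).mono_left h.subset_left
  have dZ : ∀ {l}, l ∈ G.labels X i Y ∪ G.labels X i Z → Disjoint Z (X l) := fun {l} hl =>
    (hm.disjoint i l (by rcases hl with hl | hl <;> exact hl.1.symm)).mono_left h.symm.subset_left
  have hbj : b ≠ j := fun h => hbY (h ▸ hjY)
  have hbk : b ≠ k := fun h => hbY (h ▸ hkY)
  -- The nonadjacent pair is `Y` and `X b`; the triangle is `Z`, `X j`, `X k`.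
  exact isInducedMinor_K5Minus_of_parts h.left (hm.conn b) h.right (hm.conn j) (hm.conn k)
    (dY (.inr hb)) h.disjoint (dY (.inl hjY)) (dY (.inl hkY)) (dZ (.inr hb)).symm
    (hm.disjoint b j hbj) (hm.disjoint b k hbk) (dZ (.inl hjY)) (dZ (.inl hkY))
    (hm.disjoint j k hjk) (h.touch (hm.conn i)) hjY.2 hkY.2 hb.2.symm (completeGraph_touch hm hbj)
    (completeGraph_touch hm hbk) hjZ.2 hkZ.2 (completeGraph_touch hm hjk)
    fun ht => hbY ⟨hb.1, ht⟩

/-- In a clique model, a cut of a branch set with two exclusive labels on one side. -/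
theorem isInducedMinor_K5Minus_of_exclusive {p : ℕ} {X : Fin p → Set V}
    (hm : SpanModel (completeGraph (Fin p)) G X) {i : Fin p} {Y Z : Set V}
    (h : G.IsSplit (X i) Y Z) (hY : (G.labels X i Y).Nontrivial)
    (hE : (G.labels X i Z \ G.labels X i Y).Nontrivial) : IsInducedMinor K5Minus G := by
  obtain ⟨j, hj, k, hk, hjk⟩ := hY
  obtain ⟨b, ⟨hb, hbY⟩, c, ⟨hc, hcY⟩, hbc⟩ := hE
  have dY : ∀ {l}, l ≠ i → Disjoint Y (X l) := fun {l} hl =>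
    (hm.disjoint i l hl.symm).mono_left h.subset_left
  have dZ : ∀ {l}, l ≠ i → Disjoint Z (X l) := fun {l} hl =>
    (hm.disjoint i l hl.symm).mono_left h.symm.subset_left
  have hjb : j ≠ b := fun h => hbY (h ▸ hj)
  have hkb : k ≠ b := fun h => hbY (h ▸ hk)
  have hjc : j ≠ c := fun h => hcY (h ▸ hj)
  have hkc : k ≠ c := fun h => hcY (h ▸ hk)
  have t : ∀ {l m}, l ≠ m → G.Touch (X l) (X m) := fun h => completeGraph_touch hm h
  have dd : ∀ {l m}, l ≠ m → Disjoint (X l) (X m) := fun h => hm.disjoint _ _ h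
  -- `Z` is absorbed into `X b`, which makes that set touch `Y`, while `Y` and `X c` stay apart.
  refine isInducedMinor_K5Minus_of_parts (S₀ := Y) (S₁ := X c) (A := X b ∪ Z) (B := X j)
    (C := X k) h.left (hm.conn c) ((hm.conn b).union h.right (.inr hb.2.symm)) (hm.conn j)
    (hm.conn k) (dY hc.1) ?_ (dY hj.1) (dY hk.1) ?_ (dd hjc.symm) (dd hkc.symm) ?_ ?_ (dd hjk)
    ((h.touch (hm.conn i)).right Set.subset_union_right) hj.2 hk.2
    (hc.2.symm.right Set.subset_union_right) (t hjc.symm) (t hkc.symm)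
    ((t hjb.symm).left Set.subset_union_left) ((t hkb.symm).left Set.subset_union_left) (t hjk)
    fun ht => hcY ⟨hc.1, ht⟩
  · exact Set.disjoint_union_right.mpr ⟨dY hb.1, h.disjoint⟩
  · exact Set.disjoint_union_right.mpr ⟨dd hbc.symm, (dZ hc.1).symm⟩
  · exact Set.disjoint_union_left.mpr ⟨dd hjb.symm, dZ hj.1⟩
  · exact Set.disjoint_union_left.mpr ⟨dd hkb.symm, dZ hk.1⟩

variable [Finite V]

/-- A well-linked `K₅⁻`-induced-minor-free graph with a `K₅` minor is complete. -/
theorem WellLinked.complete_of_five_le (hG : G.WellLinked) (hfree : G.InducedMinorFree K5Minus)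
    (h5 : 5 ≤ G.hadwigerNumber) (v w : V) (hvw : v ≠ w) : G.Adj v w := by
  classical
  obtain ⟨p, hp⟩ : ∃ p, p = G.hadwigerNumber := ⟨_, rfl⟩
  have hge : ∀ q, IsMinor (completeGraph (Fin q)) G → q ≤ p := fun q hq =>
    hp ▸ (isGreatest_hadwigerNumber G).2 hq
  have : NeZero p := ⟨by omega⟩
  obtain ⟨X₀, hX₀⟩ := hG.exists_spanModel (hp ▸ (isGreatest_hadwigerNumber G).1 :
    IsMinor (completeGraph (Fin p)) G)
  have hcard : ∀ i : Fin p, ({i}ᶜ : Set (Fin p)).ncard = p - 1 := by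
    intro i
    rw [Set.ncard_compl, Set.ncard_singleton, Nat.card_fin]
  have hall : ∀ X, SpanModel (completeGraph (Fin p)) G X → ∀ i, {i}ᶜ ⊆ G.labels X i (X i) :=
    fun X hX i j hj => ⟨hj, completeGraph_touch hX (Ne.symm hj)⟩
  have key : ∀ F : Finset (Fin p), ∃ X, SpanModel (completeGraph (Fin p)) G X ∧
      ∀ j ∈ (F : Set (Fin p)), ∃ x, X j = {x} := by
    intro F
    induction F using Finset.induction_on with
    | empty => exact ⟨X₀, hX₀, by simp⟩
    | insert i F hi ih =>
      obtain ⟨X, hX, hF⟩ := ih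
      rw [Finset.coe_insert]
      refine (hG.shrink (goal := False) (i := i) (by simpa using hi) ?_ ?_ ?_ hX hF).resolve_left id
      · intro a b
        by_contra! hcon
        have hsub : ({i}ᶜ : Set (Fin p)) ⊆ {a, b} := by
          intro c hc
          by_cases hca : c = a
          · exact .inl hca
          · exact .inr (hcon c (Ne.symm hc) hca)
        have h1 := Set.ncard_le_ncard hsub (Set.toFinite _)
        have h2 := Set.ncard_insert_le a {b}
        rw [Set.ncard_singleton] at h2
        rw [hcard] at h1
        omega
      · intro X hX _ Y Z hYZ hY hZ
        left
        have hE : (G.labels X i Z \ G.labels X i Y).Subsingleton := by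
          rw [← Set.not_nontrivial_iff]
          exact fun h => hfree (isInducedMinor_K5Minus_of_exclusive hX hYZ hY h)
        have hE' : (G.labels X i Y \ G.labels X i Z).Subsingleton := by
          rw [← Set.not_nontrivial_iff]
          exact fun h => hfree (isInducedMinor_K5Minus_of_exclusive hX hYZ.symm hZ h)
        have hsub : ({i}ᶜ : Set (Fin p)) ⊆ (G.labels X i Y ∩ G.labels X i Z) ∪
            ((G.labels X i Z \ G.labels X i Y) ∪ (G.labels X i Y \ G.labels X i Z)) := by
          refine (hall X hX i).trans ?_
          rw [← hYZ.union, labels_union]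
          intro j hj
          by_cases h1 : j ∈ G.labels X i Y <;> by_cases h2 : j ∈ G.labels X i Z <;>
            simp_all
        -- There are `p - 1 ≥ 4` labels in all, and each side has at most one label of its own, so
        -- at least two are shared. The overlap lemma then rules out unshared labels altogether.
        have hI : (G.labels X i Y ∩ G.labels X i Z).Nontrivial := by
          by_contra h
          rw [Set.not_nontrivial_iff] at h
          have h1 := Set.ncard_le_ncard hsub (Set.toFinite _)
          have h2 := Set.ncard_union_le (G.labels X i Y ∩ G.labels X i Z)
            ((G.labels X i Z \ G.labels X i Y) ∪ (G.labels X i Y \ G.labels X i Z))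
          have h3 := Set.ncard_union_le (G.labels X i Z \ G.labels X i Y)
            (G.labels X i Y \ G.labels X i Z)
          have h4 := Set.ncard_le_one_iff_subsingleton.mpr h
          have h5 := Set.ncard_le_one_iff_subsingleton.mpr hE
          have h6 := Set.ncard_le_one_iff_subsingleton.mpr hE'
          rw [hcard] at h1
          omega
        have e1 : ∀ j ∈ G.labels X i Z, j ∈ G.labels X i Y := by
          by_contra! hcon
          obtain ⟨b, hb, hbY⟩ := hcon
          exact hfree (isInducedMinor_K5Minus_of_overlap hX hYZ hb hbY hI)
        have e2 : ∀ j ∈ G.labels X i Y, j ∈ G.labels X i Z := by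
          by_contra! hcon
          obtain ⟨b, hb, hbY⟩ := hcon
          exact hfree (isInducedMinor_K5Minus_of_overlap hX hYZ.symm hb hbY
            (by rwa [Set.inter_comm]))
        have hYall : ∀ j, j ≠ i → G.Touch Y (X j) ∧ G.Touch Z (X j) := by
          intro j hj
          have := hall X hX i hj
          rw [← hYZ.union, labels_union] at this
          rcases this with h | h
          exacts [⟨h.2, (e2 j h).2⟩, ⟨(e1 j h).2, h.2⟩]
        -- Both halves touch each other and every other branch set, so the cut yields one branch set
        -- more than η allows.
        have hbig : IsMinor (completeGraph (Option (Fin p))) G := by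
          refine ⟨cutFamily X i Y Z, hX.disjoint_cutFamily hYZ,
            fun o => connSet_iff.mp (hX.conn_cutFamily hYZ o), ?_⟩
          have hn : ∀ w, G.Touch Z (cutFamily X i Y Z (some w)) := by
            intro w
            by_cases hw : w = i
            · subst hw; rw [cutFamily_self]; exact (hYZ.touch (hX.conn w)).symm
            · rw [cutFamily_ne hw]; exact (hYall w hw).2
          rintro (_ | a) (_ | b) hab
          · exact absurd rfl hab.ne
          · exact hn b
          · exact (hn a).symm
          · have hab' : a ≠ b := fun h => hab.ne (by rw [h])
            show G.Touch _ _
            by_cases ha : a = i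
            · subst ha
              rw [cutFamily_self, cutFamily_ne hab'.symm]
              exact (hYall b hab'.symm).1
            · rw [cutFamily_ne ha]
              by_cases hb : b = i
              · subst hb; rw [cutFamily_self]; exact (hYall a ha).1.symm
              · rw [cutFamily_ne hb]; exact completeGraph_touch hX hab'
        have hbig' : IsMinor (completeGraph (Fin (p + 1))) G := by
          refine IsMinor.trans ⟨fun k => {finSuccEquiv p k}, fun a b hab => by simpa using hab,
            fun a => connSet_iff.mp (connSet_singleton _), fun a b hab => ?_⟩ hbig
          exact ⟨_, rfl, _, rfl, fun h => hab.ne ((finSuccEquiv p).injective h)⟩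
        have := hge _ hbig'
        omega
      · intro X hX _ P j hP
        -- A triple accounts for only three labels, fewer than `p - 1`.
        have hsub : ({i}ᶜ : Set (Fin p)) ⊆ Set.range j := by
          intro c hc
          obtain ⟨k, hk⟩ := hP.total c (hall X hX i hc)
          exact ⟨k, hk.symm⟩
        have h1 := Set.ncard_le_ncard hsub (Set.toFinite _)
        rw [hcard, ← Nat.card_coe_set_eq, Nat.card_range_of_injective hP.inj, Nat.card_fin] at h1
        omega
  obtain ⟨X, hX, hs⟩ := key Finset.univ
  obtain ⟨a, ha⟩ := hX.cover v
  obtain ⟨b, hb⟩ := hX.cover w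
  obtain ⟨x, hx⟩ := hs a (by simp)
  obtain ⟨y, hy⟩ := hs b (by simp)
  rw [hx] at ha
  rw [hy] at hb
  have hab : a ≠ b := by
    rintro rfl
    rw [hx] at hy
    exact hvw (ha.trans ((Set.singleton_injective hy).trans (Set.mem_singleton_iff.mp hb).symm))
  have := completeGraph_touch hX hab
  rw [hx, hy, touch_singleton] at this
  rwa [Set.mem_singleton_iff.mp ha, Set.mem_singleton_iff.mp hb]

end Complete

end SimpleGraph

namespace SimpleGraph

/-! ### Verifying minors by finite tables; branch sets with three neighbours. -/

section Patterns

variable {V W : Type*} {G : SimpleGraph V} {Q : SimpleGraph W} {X : W → Set V}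

/-- A family of pairwise disjoint connected sets. -/
def IsBranchFamily {U : Type*} (G : SimpleGraph V) (R : U → Set V) : Prop :=
  (∀ a, G.ConnSet (R a)) ∧ ∀ a b, a ≠ b → Disjoint (R a) (R b)

/-- A `K₅⁻` minor obtained by merging the members of a family of disjoint connected sets according
to a map `f`, where `E` lists some pairs of members known to touch. -/
theorem isMinor_K5Minus_of_map {n : ℕ} {R : Fin n → Set V}
    (hR : G.IsBranchFamily R)
    (E : List (Fin n × Fin n)) (f : Fin n → Fin 5)
    (h1 : ∀ u v, f u = f v → u ≠ v → (u, v) ∈ E ∨ (v, u) ∈ E)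
    (h2 : ∀ k l, k < l → l ≠ 1 → ∃ e ∈ E, f e.1 = k ∧ f e.2 = l ∨ f e.2 = k ∧ f e.1 = l)
    (hE : ∀ e ∈ E, G.Touch (R e.1) (R e.2)) : IsMinor K5Minus G := by
  have hE' : ∀ u v, (u, v) ∈ E ∨ (v, u) ∈ E → G.Touch (R u) (R v) := by
    rintro u v (h | h)
    exacts [hE _ h, (hE _ h).symm]
  -- Among pairs `k < l`, the condition `l ≠ 1` excludes exactly the missing edge `(0, 1)`.
  have h2' : ∀ k l, k < l → l ≠ 1 →
      ∃ u v, f u = k ∧ f v = l ∧ ((u, v) ∈ E ∨ (v, u) ∈ E) := by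
    intro k l hkl hl
    obtain ⟨⟨u, v⟩, he, ⟨h, h'⟩ | ⟨h, h'⟩⟩ := h2 k l hkl hl
    exacts [⟨u, v, h, h', .inl he⟩, ⟨v, u, h, h', .inr he⟩]
  have hm : IsMinor (G.touchGraph R) G := (isInducedMinor_touchGraph hR.2 hR.1).isMinor
  refine IsMinor.trans ⟨fun k => {u | f u = k}, fun k l hkl => ?_, fun k => ?_, fun k l hkl => ?_⟩
    hm
  · exact Set.disjoint_left.mpr fun u (hu : f u = k) (hv : f u = l) => hkl (hu.symm.trans hv)
  · rw [← connSet_iff]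
    refine connSet_of_pairwise ?_ fun u hu v hv huv =>
      ⟨huv, hE' u v (h1 u v (hu.trans hv.symm) huv)⟩
    have : ∀ k : Fin 5, (∃ l, k < l ∧ l ≠ 1) ∨ ∃ l, l < k ∧ k ≠ 1 := by decide
    rcases this k with ⟨l, hl, hn⟩ | ⟨l, hl, hn⟩
    · obtain ⟨u, v, hu, -⟩ := h2' k l hl hn
      exact ⟨u, hu⟩
    · obtain ⟨u, v, -, hv, -⟩ := h2' l k hl hn
      exact ⟨v, hv⟩
  · have hd : ∀ u v, f u ≠ f v → (u, v) ∈ E ∨ (v, u) ∈ E → (G.touchGraph R).Adj u v :=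
      fun u v hne h => ⟨fun h => hne (by rw [h]), hE' u v h⟩
    have key : ∀ k l : Fin 5, K5Minus.Adj k l → k < l ∧ l ≠ 1 ∨ l < k ∧ k ≠ 1 := by
      simp only [K5Minus_adj]
      decide
    rcases key k l hkl with ⟨h, hn⟩ | ⟨h, hn⟩
    · obtain ⟨u, v, hu, hv, huv⟩ := h2' k l h hn
      exact ⟨u, hu, v, hv, hd u v (by rw [hu, hv]; exact hkl.ne) huv⟩
    · obtain ⟨u, v, hu, hv, huv⟩ := h2' l k h hn
      exact ⟨v, hv, u, hu, hd v u (by rw [hu, hv]; exact hkl.ne) huv.symm⟩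

theorem SpanModel.family (hm : SpanModel Q G X) {n : ℕ} {g : Fin n → W}
    (hg : Function.Injective g) :
    G.IsBranchFamily fun a => X (g a) :=
  ⟨fun _ => hm.conn _, fun _ _ h => hm.disjoint _ _ fun he => h (hg he)⟩

theorem family_cons {n : ℕ} {R : Fin n → Set V} {S : Set V}
    (hR : G.IsBranchFamily R) (hS : G.ConnSet S)
    (hd : ∀ a, Disjoint S (R a)) :
    G.IsBranchFamily (Matrix.vecCons S R) := by
  refine ⟨fun a => ?_, fun a b h => ?_⟩
  · cases a using Fin.cases with
    | zero => exact hS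
    | succ a => exact hR.1 a
  · cases a using Fin.cases with
    | zero =>
      cases b using Fin.cases with
      | zero => exact absurd rfl h
      | succ b => exact hd b
    | succ a =>
      cases b using Fin.cases with
      | zero => exact (hd a).symm
      | succ b => exact hR.2 a b fun he => h (by rw [he])

theorem SpanModel.family_split (hm : SpanModel Q G X) {i : W} {Y Z : Set V}
    (h : G.IsSplit (X i) Y Z) {n : ℕ} {g : Fin n → W} (hg : Function.Injective g)
    (hi : ∀ a, g a ≠ i) :
    G.IsBranchFamily (Matrix.vecCons Y (Matrix.vecCons Z fun a => X (g a))) := by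
  have hd : ∀ a, Disjoint (X i) (X (g a)) := fun a => hm.disjoint _ _ (hi a).symm
  refine family_cons (family_cons (hm.family hg) h.right fun a =>
    (hd a).mono_left h.symm.subset_left) h.left fun a => ?_
  cases a using Fin.cases with
  | zero => exact h.disjoint
  | succ a => exact (hd a).mono_left h.subset_left

theorem SpanModel.family_triple (hm : SpanModel Q G X) {i : W} {P : Fin 3 → Set V} {j : Fin 3 → W}
    (h : G.IsTriple X i P j) {a b c : Fin 3} (hab : a ≠ b) (hac : a ≠ c) (hbc : b ≠ c) {n : ℕ}
    {g : Fin n → W} (hg : Function.Injective g) (hi : ∀ a, g a ≠ i) :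
    G.IsBranchFamily (Matrix.vecCons (P a) (Matrix.vecCons (P b)
      (Matrix.vecCons (P c) fun a => X (g a)))) := by
  have hd : ∀ k a, Disjoint (P k) (X (g a)) := fun k a =>
    (hm.disjoint _ _ (hi a).symm).mono_left (h.sub k)
  refine family_cons (family_cons (family_cons (hm.family hg) (h.conn c) (hd c)) (h.conn b) ?_)
    (h.conn a) ?_
  · intro k
    cases k using Fin.cases with
    | zero => exact h.disjoint b c hbc
    | succ k => exact hd b k
  · intro k
    cases k using Fin.cases with
    | zero => exact h.disjoint a b hab
    | succ k =>
      cases k using Fin.cases with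
      | zero => exact h.disjoint a c hac
      | succ k => exact hd a k

theorem IsTriple.exists_order {i : W} {P : Fin 3 → Set V} {j : Fin 3 → W} (h : G.IsTriple X i P j)
    {s u w : W} (hs : s ∈ G.labels X i (X i)) (hu : u ∈ G.labels X i (X i))
    (hw : w ∈ G.labels X i (X i)) (hsu : s ≠ u) (hsw : s ≠ w) (huw : u ≠ w) :
    ∃ a b c : Fin 3, a ≠ b ∧ a ≠ c ∧ b ≠ c ∧ G.Touch (P a) (X s) ∧ G.Touch (P b) (X u) ∧
      G.Touch (P c) (X w) := by
  obtain ⟨a, rfl⟩ := h.total s hs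
  obtain ⟨b, rfl⟩ := h.total u hu
  obtain ⟨c, rfl⟩ := h.total w hw
  exact ⟨a, b, c, fun h => hsu (h ▸ rfl), fun h => hsw (h ▸ rfl), fun h => huw (h ▸ rfl),
    h.label a, h.label b, h.label c⟩

/-- Two subsets of a three-element set with at least two elements each that cover it share an
element and each contain a further one. -/
theorem exists_shared_label {A B : Set W} {s u w : W} (hA : A.Nontrivial) (hB : B.Nontrivial)
    (hAs : ∀ x ∈ A, x = s ∨ x = u ∨ x = w) (hBs : ∀ x ∈ B, x = s ∨ x = u ∨ x = w)
    (hs : s ∈ A ∪ B) (hu : u ∈ A ∪ B) (hw : w ∈ A ∪ B) :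
    (s ∈ A ∧ s ∈ B ∧ (u ∈ A ∧ w ∈ B ∨ w ∈ A ∧ u ∈ B)) ∨
    (u ∈ A ∧ u ∈ B ∧ (s ∈ A ∧ w ∈ B ∨ w ∈ A ∧ s ∈ B)) ∨
    (w ∈ A ∧ w ∈ B ∧ (s ∈ A ∧ u ∈ B ∨ u ∈ A ∧ s ∈ B)) := by
  have two : ∀ C : Set W, C.Nontrivial → (∀ x ∈ C, x = s ∨ x = u ∨ x = w) →
      (s ∈ C ∧ u ∈ C) ∨ (s ∈ C ∧ w ∈ C) ∨ (u ∈ C ∧ w ∈ C) := by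
    rintro C ⟨x, hx, y, hy, hxy⟩ hC
    rcases hC x hx with rfl | rfl | rfl <;> rcases hC y hy with rfl | rfl | rfl <;>
      first | exact absurd rfl hxy | simp [hx, hy]
  have hA' := two A hA hAs
  have hB' := two B hB hBs
  simp only [Set.mem_union] at hs hu hw
  tauto

theorem isMinor_of_injective {U : Type*} {H : SimpleGraph U} {n : ℕ} {R : Fin n → Set V}
    (hR : G.IsBranchFamily R) (E : List (Fin n × Fin n)) (f : U → Fin n)
    (hf : Function.Injective f)
    (hH : ∀ u v, H.Adj u v → (f u, f v) ∈ E ∨ (f v, f u) ∈ E)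
    (hE : ∀ e ∈ E, G.Touch (R e.1) (R e.2)) : IsMinor H G := by
  refine ⟨fun u => R (f u), fun u v h => hR.2 _ _ fun he => h (hf he),
    fun u => connSet_iff.mp (hR.1 _), fun u v h => ?_⟩
  rcases hH u v h with h | h
  exacts [hE _ h, (hE _ h).symm]

/-- Shrinking a branch set that stands for a vertex with three neighbours. -/
theorem WellLinked.shrink_cubic [Finite V] (hG : G.WellLinked) {goal : Prop} {F : Set W}
    {i s u w : W} (hi : i ∉ F) (his : Q.Adj i s) (hiu : Q.Adj i u) (hiw : Q.Adj i w)
    (hsu : s ≠ u) (hsw : s ≠ w) (huw : u ≠ w)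
    (hextra : ∀ X, SpanModel Q G X → ∀ k, k ≠ i → k ≠ s → k ≠ u → k ≠ w →
      G.Touch (X i) (X k) → goal)
    (htriple : ∀ X, SpanModel Q G X → ∀ P j, G.IsTriple X i P j → ∀ a b c, a ≠ b → a ≠ c →
      b ≠ c → G.Touch (P a) (X s) → G.Touch (P b) (X u) → G.Touch (P c) (X w) → goal)
    (hs : ∀ X, SpanModel Q G X → (∀ j ∈ F, ∃ x, X j = {x}) → ∀ Y Z, G.IsSplit (X i) Y Z →
      G.Touch Y (X s) → G.Touch Y (X u) → G.Touch Z (X s) → G.Touch Z (X w) →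
      goal ∨ ∃ X', SpanModel Q G X' ∧ (∀ j ∈ F, ∃ x, X' j = {x}) ∧ (X' i).ncard < (X i).ncard)
    (hu : ∀ X, SpanModel Q G X → ∀ Y Z, G.IsSplit (X i) Y Z →
      G.Touch Y (X u) → G.Touch Y (X s) → G.Touch Z (X u) → G.Touch Z (X w) → goal)
    (hw : ∀ X, SpanModel Q G X → ∀ Y Z, G.IsSplit (X i) Y Z →
      G.Touch Y (X w) → G.Touch Y (X s) → G.Touch Z (X w) → G.Touch Z (X u) → goal)
    {X : W → Set V} (hm : SpanModel Q G X) (hF : ∀ j ∈ F, ∃ x, X j = {x}) :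
    goal ∨ ∃ X', SpanModel Q G X' ∧ ∀ j ∈ insert i F, ∃ x, X' j = {x} := by
  refine hG.shrink hi (fun a b => ?_) (fun X hm hF Y Z h hY hZ => ?_) (fun X hm _ P j h => ?_) hm hF
  · by_cases h1 : s ≠ a ∧ s ≠ b
    · exact ⟨s, his, h1⟩
    by_cases h2 : u ≠ a ∧ u ≠ b
    · exact ⟨u, hiu, h2⟩
    refine ⟨w, hiw, ?_⟩
    constructor
    · rintro rfl
      exact hsu ((not_not.mp fun h => h1 ⟨hsw, h⟩).trans (not_not.mp fun h => h2 ⟨huw, h⟩).symm)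
    · rintro rfl
      exact hsu ((not_not.mp fun h => h1 ⟨h, hsw⟩).trans (not_not.mp fun h => h2 ⟨h, huw⟩).symm)
  · by_cases hg : goal
    · exact .inl hg
    -- Any further label gives the goal, so only `s`, `u`, `w` remain. Two sides with at least two
    -- of these labels each must share one, and the three cases are named after the shared label.
    have hsub : ∀ T ⊆ X i, ∀ k ∈ G.labels X i T, k = s ∨ k = u ∨ k = w := by
      intro T hT k hk
      by_contra! hne
      exact hg (hextra X hm k hk.1 hne.1 hne.2.1 hne.2.2 (hk.2.left hT))
    have hmem : ∀ k, Q.Adj i k → k ∈ G.labels X i Y ∪ G.labels X i Z := fun k hk => by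
      rw [← labels_union, h.union]
      exact ⟨hk.ne', hm.touch i k hk⟩
    rcases exists_shared_label hY hZ (hsub Y h.subset_left) (hsub Z h.symm.subset_left)
      (hmem s his) (hmem u hiu) (hmem w hiw) with
      ⟨h1, h2, ⟨h3, h4⟩ | ⟨h3, h4⟩⟩ | ⟨h1, h2, ⟨h3, h4⟩ | ⟨h3, h4⟩⟩ | ⟨h1, h2, ⟨h3, h4⟩ | ⟨h3, h4⟩⟩
    · exact hs X hm hF Y Z h h1.2 h3.2 h2.2 h4.2
    · exact hs X hm hF Z Y h.symm h2.2 h4.2 h1.2 h3.2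
    · exact .inl (hu X hm Y Z h h1.2 h3.2 h2.2 h4.2)
    · exact .inl (hu X hm Z Y h.symm h2.2 h4.2 h1.2 h3.2)
    · exact .inl (hw X hm Y Z h h1.2 h3.2 h2.2 h4.2)
    · exact .inl (hw X hm Z Y h.symm h2.2 h4.2 h1.2 h3.2)
  · obtain ⟨a, b, c, hab, hac, hbc, ha, hb, hc⟩ := h.exists_order
      (s := s) (u := u) (w := w) ⟨his.ne', hm.touch _ _ his⟩
      ⟨hiu.ne', hm.touch _ _ hiu⟩ ⟨hiw.ne', hm.touch _ _ hiw⟩ hsu hsw huw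
    exact htriple X hm P j h a b c hab hac hbc ha hb hc

/-- The neighbourhood of a vertex that is a branch set of its own. -/
theorem SpanModel.adj_iff (hm : SpanModel Q G X) {i s u w : W} {x a b c : V} (hi : X i = {x})
    (hs : X s = {a}) (hu : X u = {b}) (hw : X w = {c}) (his : Q.Adj i s) (hiu : Q.Adj i u)
    (hiw : Q.Adj i w)
    (hextra : ∀ k, k ≠ i → k ≠ s → k ≠ u → k ≠ w → ¬ G.Touch (X i) (X k)) (y : V) :
    G.Adj x y ↔ y = a ∨ y = b ∨ y = c := by
  have key : ∀ {k d}, X k = {d} → Q.Adj i k → G.Adj x d := by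
    intro k d hk hik
    obtain ⟨p, hp, q, hq, hpq⟩ := hm.touch i k hik
    rw [hi] at hp
    rw [hk] at hq
    rwa [← Set.mem_singleton_iff.mp hp, ← Set.mem_singleton_iff.mp hq]
  constructor
  · intro hxy
    obtain ⟨k, hk⟩ := hm.cover y
    have hx : x ∈ X i := hi ▸ rfl
    have ht : G.Touch (X i) (X k) := ⟨x, hx, y, hk, hxy⟩
    by_cases h0 : k = i
    · subst h0
      rw [hi] at hk
      exact absurd hk hxy.ne'
    by_cases h1 : k = s
    · subst h1; rw [hs] at hk; exact .inl hk
    by_cases h2 : k = u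
    · subst h2; rw [hu] at hk; exact .inr (.inl hk)
    by_cases h3 : k = w
    · subst h3; rw [hw] at hk; exact .inr (.inr hk)
    exact absurd ht (hextra k h0 h1 h2 h3)
  · rintro (rfl | rfl | rfl)
    exacts [key hs his, key hu hiu, key hw hiw]

end Patterns

end SimpleGraph

namespace SimpleGraph

/-! ### Well-linked graphs with a K₃,₃ or prism minor. -/

section Cubic

variable {V : Type*} {G : SimpleGraph V}

/-- The complete bipartite graph `K_{3,3}`. -/
def K33 : SimpleGraph (Fin 6) := circulantGraph {1, 3}

/-- The triangular prism. -/
def prism : SimpleGraph (Fin 6) := circulantGraph {2, 3}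

instance : DecidableRel K33.Adj := fun i j =>
  inferInstanceAs (Decidable ((circulantGraph {1, 3}).Adj i j))

instance : DecidableRel prism.Adj := fun i j =>
  inferInstanceAs (Decidable ((circulantGraph {2, 3}).Adj i j))

variable {X : Fin 6 → Set V}

/-- In this table, as in the later ones, the list holds known touching pairs of the family and the
vector gives the merging into the vertices of K₅⁻, with `0` and `1` nonadjacent. Here `Z` joins `X
w`, and `X u` joins `X e`; the pair that need not touch is `Y`, `X c`. -/
theorem SpanModel.isMinor_of_K33_split (hm : SpanModel K33 G X) {i s u w c e : Fin 6}
    (hi : ∀ a, ![s, u, w, c, e] a ≠ i) (hg : Function.Injective ![s, u, w, c, e])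
    (hc : ∀ a, K33.Adj c (![s, u, w] a)) (he : ∀ a, K33.Adj e (![s, u, w] a)) {Y Z : Set V}
    (h : G.IsSplit (X i) Y Z) (hYs : G.Touch Y (X s)) (hYu : G.Touch Y (X u))
    (hZs : G.Touch Z (X s)) (hZw : G.Touch Z (X w)) : IsMinor K5Minus G := by
  refine isMinor_K5Minus_of_map (hm.family_split h hg hi)
    [(0,1),(0,2),(0,3),(1,2),(1,4),(5,2),(5,3),(5,4),(6,2),(6,3),(6,4)] ![0,2,3,4,2,1,4]
    (by decide) (by decide) ?_
  simp only [List.forall_mem_cons]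
  exact ⟨h.touch (hm.conn i), hYs, hYu, hZs, hZw, hm.touch _ _ (hc 0), hm.touch _ _ (hc 1),
    hm.touch _ _ (hc 2), hm.touch _ _ (he 0), hm.touch _ _ (he 1), hm.touch _ _ (he 2), by simp⟩

/-- The circulant form makes every vertex `i` look alike: its neighbours are `i + 1`, `i + 3`, `i +
5`. Two parts absorb their labelled neighbours, and the third part is the one apart from `X (i +
2)`. -/
theorem SpanModel.isMinor_of_K33_triple (hm : SpanModel K33 G X) {i : Fin 6}
    {P : Fin 3 → Set V} {j : Fin 3 → Fin 6} (h : G.IsTriple X i P j) {a b c : Fin 3}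
    (hab : a ≠ b) (hac : a ≠ c) (hbc : b ≠ c) (ha : G.Touch (P a) (X (i + 1)))
    (hb : G.Touch (P b) (X (i + 3))) (hc : G.Touch (P c) (X (i + 5))) : IsMinor K5Minus G := by
  have hg : ∀ i : Fin 6, Function.Injective ![i + 1, i + 3, i + 5, i + 2, i + 4] := by decide
  have hi : ∀ i : Fin 6, ∀ a, ![i + 1, i + 3, i + 5, i + 2, i + 4] a ≠ i := by decide
  have hadj : ∀ i : Fin 6, ∀ a, K33.Adj (i + 2) (![i + 1, i + 3, i + 5] a) ∧
    K33.Adj (i + 4) (![i + 1, i + 3, i + 5] a) := by decide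
  refine isMinor_K5Minus_of_map (hm.family_triple h hab hac hbc (hg i) (hi i))
    [(0,1),(0,2),(1,2),(0,3),(1,4),(2,5),(6,3),(6,4),(6,5),(7,3),(7,4),(7,5)]
    ![0,2,3,4,2,3,1,4] (by decide) (by decide) ?_
  simp only [List.forall_mem_cons]
  exact ⟨h.touch _ _ hab, h.touch _ _ hac, h.touch _ _ hbc, ha, hb, hc,
    hm.touch _ _ (hadj i 0).1, hm.touch _ _ (hadj i 1).1, hm.touch _ _ (hadj i 2).1,
    hm.touch _ _ (hadj i 0).2, hm.touch _ _ (hadj i 1).2, hm.touch _ _ (hadj i 2).2, by simp⟩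

/-- An extra edge inside one side: merge the third vertex `e` of that side with `i + 5`, and `i +
1`, `i + 3` form the nonadjacent pair. -/
theorem SpanModel.isMinor_of_K33_extra (hm : SpanModel K33 G X) {i k : Fin 6}
    (h0 : k ≠ i) (h1 : k ≠ i + 1) (h3 : k ≠ i + 3) (h5 : k ≠ i + 5)
    (h : G.Touch (X i) (X k)) : IsMinor K5Minus G := by
  obtain ⟨e, hg, hi, hc, he⟩ : ∃ e, Function.Injective ![i, i + 1, i + 3, i + 5, k, e] ∧
      (∀ a, K33.Adj i (![i + 1, i + 3, i + 5] a)) ∧ (∀ a, K33.Adj k (![i + 1, i + 3, i + 5] a)) ∧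
      ∀ a, K33.Adj e (![i + 1, i + 3, i + 5] a) := by
    clear h
    revert i k
    decide
  refine isMinor_K5Minus_of_map (hm.family hg)
    [(0,1),(0,2),(0,3),(4,1),(4,2),(4,3),(5,1),(5,2),(5,3),(0,4)] ![2,0,1,3,4,3]
    (by decide) (by decide) ?_
  simp only [List.forall_mem_cons]
  exact ⟨hm.touch _ _ (hi 0), hm.touch _ _ (hi 1), hm.touch _ _ (hi 2), hm.touch _ _ (hc 0),
    hm.touch _ _ (hc 1), hm.touch _ _ (hc 2), hm.touch _ _ (he 0), hm.touch _ _ (he 1),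
    hm.touch _ _ (he 2), h, by simp⟩

theorem WellLinked.shrink_K33 [Finite V] (hG : G.WellLinked) {F : Set (Fin 6)} (i : Fin 6)
    (hi : i ∉ F) (hm : SpanModel K33 G X) (hF : ∀ j ∈ F, ∃ x, X j = {x}) :
    IsMinor K5Minus G ∨ ∃ X', SpanModel K33 G X' ∧ ∀ j ∈ insert i F, ∃ x, X' j = {x} := by
  have hadj : ∀ i : Fin 6, K33.Adj i (i + 1) ∧ K33.Adj i (i + 3) ∧ K33.Adj i (i + 5) := by decide
  have hne : ∀ i : Fin 6, i + 1 ≠ i + 3 ∧ i + 1 ≠ i + 5 ∧ i + 3 ≠ i + 5 := by decide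
  refine hG.shrink_cubic hi (hadj i).1 (hadj i).2.1 (hadj i).2.2 (hne i).1 (hne i).2.1
    (hne i).2.2 (fun X hm k h0 h1 h3 h5 => hm.isMinor_of_K33_extra h0 h1 h3 h5)
    (fun X hm P j h a b c => hm.isMinor_of_K33_triple h)
    (fun X hm hF Y Z h h1 h2 h3 h4 =>
      .inl (hm.isMinor_of_K33_split (c := i + 2) (e := i + 4) ?_ ?_ ?_ ?_ h h1 h2 h3 h4))
    (fun X hm Y Z h => hm.isMinor_of_K33_split (c := i + 2) (e := i + 4) ?_ ?_ ?_ ?_ h)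
    (fun X hm Y Z h => hm.isMinor_of_K33_split (c := i + 2) (e := i + 4) ?_ ?_ ?_ ?_ h) hm hF
  all_goals (clear * -; revert i; decide)

/-- A well-linked graph with a `K_{3,3}` minor and no `K₅⁻` minor has two vertices with the same
three neighbours. -/
theorem WellLinked.twins_of_isMinor_K33 [Finite V] (hG : G.WellLinked) (h : IsMinor K33 G) :
    IsMinor K5Minus G ∨ ∃ u v a b c, u ≠ v ∧ a ≠ b ∧ a ≠ c ∧ b ≠ c ∧
      (∀ y, G.Adj u y ↔ y = a ∨ y = b ∨ y = c) ∧ ∀ y, G.Adj v y ↔ y = a ∨ y = b ∨ y = c := by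
  by_cases hn : IsMinor K5Minus G
  · exact .inl hn
  right
  obtain ⟨X, hm⟩ := hG.exists_spanModel h
  -- Only `0`, `2` and their common neighbours `1`, `3`, `5` need to be single vertices; the branch
  -- set of `4` touches neither `0` nor `2`, as that would give a K₅⁻ minor.
  obtain ⟨X, hm, hF⟩ := (hG.shrink_K33 (F := ∅) 0 (by simp) hm (by simp)).resolve_left hn
  obtain ⟨X, hm, hF⟩ := (hG.shrink_K33 2 (by decide) hm hF).resolve_left hn
  obtain ⟨X, hm, hF⟩ := (hG.shrink_K33 1 (by decide) hm hF).resolve_left hn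
  obtain ⟨X, hm, hF⟩ := (hG.shrink_K33 3 (by decide) hm hF).resolve_left hn
  obtain ⟨X, hm, hF⟩ := (hG.shrink_K33 5 (by decide) hm hF).resolve_left hn
  obtain ⟨u, hu⟩ := hF 0 (by simp)
  obtain ⟨v, hv⟩ := hF 2 (by simp)
  obtain ⟨a, ha⟩ := hF 1 (by simp)
  obtain ⟨b, hb⟩ := hF 3 (by simp)
  obtain ⟨c, hc⟩ := hF 5 (by simp)
  have hne : ∀ {k l x y}, X k = {x} → X l = {y} → k ≠ l → x ≠ y := by
    rintro k l x y hk hl hkl rfl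
    exact hkl (hm.eq_of_mem (x := x) (hk ▸ rfl) (hl ▸ rfl))
  refine ⟨u, v, a, b, c, hne hu hv (by decide), hne ha hb (by decide), hne ha hc (by decide),
    hne hb hc (by decide),
    hm.adj_iff hu ha hb hc (by decide) (by decide) (by decide) fun k h0 h1 h2 h3 h =>
      hn (hm.isMinor_of_K33_extra h0 h1 h2 h3 h),
    hm.adj_iff hv ha hb hc (by decide) (by decide) (by decide) fun k h0 h1 h2 h3 h =>
      hn (hm.isMinor_of_K33_extra (i := 2) h0 h2 h3 h1 h)⟩

/-- In the circulant prism, `i + 2` and `i + 4` complete the triangle of `i`, and `i + 3` is its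
partner in the other triangle. The parts for `i + 3` and `i + 4` absorb those branch sets, and `i +
2` joins `i + 5`; the part for `i + 2` is kept apart from `i + 1`. -/
theorem SpanModel.isMinor_of_prism_triple (hm : SpanModel prism G X) {i : Fin 6}
    {P : Fin 3 → Set V} {j : Fin 3 → Fin 6} (h : G.IsTriple X i P j) {a b c : Fin 3}
    (hab : a ≠ b) (hac : a ≠ c) (hbc : b ≠ c) (ha : G.Touch (P a) (X (i + 3)))
    (hb : G.Touch (P b) (X (i + 2))) (hc : G.Touch (P c) (X (i + 4))) : IsMinor K5Minus G := by
  have hg : ∀ i : Fin 6, Function.Injective ![i + 3, i + 2, i + 4, i + 5, i + 1] := by decide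
  have hi : ∀ i : Fin 6, ∀ a, ![i + 3, i + 2, i + 4, i + 5, i + 1] a ≠ i := by decide
  have hadj : ∀ i : Fin 6, prism.Adj (i + 2) (i + 4) ∧ prism.Adj (i + 3) (i + 5) ∧
    prism.Adj (i + 3) (i + 1) ∧ prism.Adj (i + 5) (i + 1) ∧ prism.Adj (i + 2) (i + 5) ∧
    prism.Adj (i + 4) (i + 1) := by decide
  obtain ⟨h1, h2, h3, h4, h5, h6⟩ := hadj i
  refine isMinor_K5Minus_of_map (hm.family_triple h hab hac hbc (hg i) (hi i))
    [(0,1),(0,2),(1,2),(0,3),(1,4),(2,5),(4,5),(3,6),(3,7),(6,7),(4,6),(5,7)]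
    ![2,0,3,2,4,3,4,1] (by decide) (by decide) ?_
  simp only [List.forall_mem_cons]
  exact ⟨h.touch _ _ hab, h.touch _ _ hac, h.touch _ _ hbc, ha, hb, hc,
    hm.touch _ _ h1, hm.touch _ _ h2, hm.touch _ _ h3, hm.touch _ _ h4, hm.touch _ _ h5,
    hm.touch _ _ h6, by simp⟩

theorem SpanModel.isMinor_of_prism_split_mate (hm : SpanModel prism G X) {i : Fin 6} {Y Z : Set V}
    (h : G.IsSplit (X i) Y Z) (hYm : G.Touch Y (X (i + 3))) (hYq : G.Touch Y (X (i + 2)))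
    (hZm : G.Touch Z (X (i + 3))) (hZr : G.Touch Z (X (i + 4))) : IsMinor K5Minus G := by
  have hg : ∀ i : Fin 6, Function.Injective ![i + 3, i + 2, i + 4, i + 5, i + 1] := by decide
  have hi : ∀ i : Fin 6, ∀ a, ![i + 3, i + 2, i + 4, i + 5, i + 1] a ≠ i := by decide
  have hadj : ∀ i : Fin 6, prism.Adj (i + 2) (i + 4) ∧ prism.Adj (i + 3) (i + 5) ∧
    prism.Adj (i + 3) (i + 1) ∧ prism.Adj (i + 5) (i + 1) ∧ prism.Adj (i + 2) (i + 5) ∧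
    prism.Adj (i + 4) (i + 1) := by decide
  obtain ⟨h1, h2, h3, h4, h5, h6⟩ := hadj i
  refine isMinor_K5Minus_of_map (hm.family_split h (hg i) (hi i))
    [(0,1),(0,2),(0,3),(1,2),(1,4),(3,4),(2,5),(2,6),(5,6),(3,5),(4,6)] ![0,2,3,4,2,4,1]
    (by decide) (by decide) ?_
  simp only [List.forall_mem_cons]
  exact ⟨h.touch (hm.conn i), hYm, hYq, hZm, hZr, hm.touch _ _ h1, hm.touch _ _ h2,
    hm.touch _ _ h3, hm.touch _ _ h4, hm.touch _ _ h5, hm.touch _ _ h6, by simp⟩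

/-- `q`, `r` are the triangle mates of `i`, `m` its partner, and `q'`, `r'` the partners of `q`,
`r`. Merging `Y` with `X m` and `X r` with `X r'` leaves `Z` and `X q'` as the nonadjacent pair. -/
theorem SpanModel.isMinor_of_prism_split_triangle (hm : SpanModel prism G X)
    {i m q r q' r' : Fin 6}
    (hi : ∀ a, ![m, q, r, q', r'] a ≠ i) (hg : Function.Injective ![m, q, r, q', r'])
    (hadj : prism.Adj q r ∧ prism.Adj m q' ∧ prism.Adj m r' ∧ prism.Adj q' r' ∧
      prism.Adj q q' ∧ prism.Adj r r') {Y Z : Set V}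
    (h : G.IsSplit (X i) Y Z) (hYq : G.Touch Y (X q)) (hYm : G.Touch Y (X m))
    (hZq : G.Touch Z (X q)) (hZr : G.Touch Z (X r)) : IsMinor K5Minus G := by
  obtain ⟨h1, h2, h3, h4, h5, h6⟩ := hadj
  refine isMinor_K5Minus_of_map (hm.family_split h hg hi)
    [(0,1),(0,3),(0,2),(1,3),(1,4),(3,4),(2,5),(2,6),(5,6),(3,5),(4,6)] ![2,0,2,3,4,1,4]
    (by decide) (by decide) ?_
  simp only [List.forall_mem_cons]
  exact ⟨h.touch (hm.conn i), hYq, hYm, hZq, hZr, hm.touch _ _ h1, hm.touch _ _ h2,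
    hm.touch _ _ h3, hm.touch _ _ h4, hm.touch _ _ h5, hm.touch _ _ h6, by simp⟩

theorem SpanModel.isMinor_of_prism_extra (hm : SpanModel prism G X) {i k : Fin 6}
    (h0 : k ≠ i) (h3 : k ≠ i + 3) (h2 : k ≠ i + 2) (h4 : k ≠ i + 4)
    (h : G.Touch (X i) (X k)) : IsMinor K5Minus G := by
  obtain ⟨q, r, r', hg, h1, h2, h3, h4, h5, h6, h7, h8, h9⟩ : ∃ q r r',
      Function.Injective ![i, i + 3, q, r, k, r'] ∧ prism.Adj i (i + 3) ∧ prism.Adj i q ∧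
      prism.Adj i r ∧ prism.Adj q r ∧ prism.Adj (i + 3) k ∧ prism.Adj (i + 3) r' ∧
      prism.Adj k r' ∧ prism.Adj q k ∧ prism.Adj r r' := by
    have : ∀ i k : Fin 6, k ≠ i → k ≠ i + 3 → k ≠ i + 2 → k ≠ i + 4 →
        k = i + 5 ∨ k = i + 1 := by decide
    rcases this i k h0 h3 h2 h4 with rfl | rfl
    · refine ⟨i + 2, i + 4, i + 1, ?_⟩
      clear * -
      revert i
      decide
    · refine ⟨i + 4, i + 2, i + 5, ?_⟩
      clear * -
      revert i
      decide
  refine isMinor_K5Minus_of_map (hm.family hg)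
    [(0,1),(0,2),(0,3),(2,3),(1,4),(1,5),(4,5),(2,4),(3,5),(0,4)] ![2,0,1,3,4,3]
    (by decide) (by decide) ?_
  simp only [List.forall_mem_cons]
  exact ⟨hm.touch _ _ h1, hm.touch _ _ h2, hm.touch _ _ h3, hm.touch _ _ h4, hm.touch _ _ h5,
    hm.touch _ _ h6, hm.touch _ _ h7, hm.touch _ _ h8, hm.touch _ _ h9, h, by simp⟩

theorem WellLinked.shrink_prism [Finite V] (hG : G.WellLinked) {F : Set (Fin 6)} (i : Fin 6)
    (hi : i ∉ F) (hm : SpanModel prism G X) (hF : ∀ j ∈ F, ∃ x, X j = {x}) :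
    IsMinor K5Minus G ∨ ∃ X', SpanModel prism G X' ∧ ∀ j ∈ insert i F, ∃ x, X' j = {x} := by
  have hadj : ∀ i : Fin 6, prism.Adj i (i + 3) ∧ prism.Adj i (i + 2) ∧ prism.Adj i (i + 4) := by
    decide
  have hne : ∀ i : Fin 6, i + 3 ≠ i + 2 ∧ i + 3 ≠ i + 4 ∧ i + 2 ≠ i + 4 := by decide
  refine hG.shrink_cubic hi (hadj i).1 (hadj i).2.1 (hadj i).2.2 (hne i).1 (hne i).2.1
    (hne i).2.2 (fun X hm k h0 h1 h3 h5 => hm.isMinor_of_prism_extra h0 h1 h3 h5)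
    (fun X hm P j h a b c => hm.isMinor_of_prism_triple h)
    (fun X hm hF Y Z h h1 h2 h3 h4 => .inl (hm.isMinor_of_prism_split_mate h h1 h2 h3 h4))
    (fun X hm Y Z h => hm.isMinor_of_prism_split_triangle (q' := i + 5) (r' := i + 1) ?_ ?_ ?_ h)
    (fun X hm Y Z h => hm.isMinor_of_prism_split_triangle (q' := i + 1) (r' := i + 5) ?_ ?_ ?_ h)
    hm hF
  all_goals (clear * -; revert i; decide)

/-- A well-linked graph with a prism minor and no `K₅⁻` minor has a vertex with three neighbours,
two of which are adjacent. -/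
theorem WellLinked.cubic_of_isMinor_prism [Finite V] (hG : G.WellLinked) (h : IsMinor prism G) :
    IsMinor K5Minus G ∨ ∃ u a b c, a ≠ b ∧ a ≠ c ∧ b ≠ c ∧ G.Adj a b ∧
      ∀ y, G.Adj u y ↔ y = a ∨ y = b ∨ y = c := by
  by_cases hn : IsMinor K5Minus G
  · exact .inl hn
  right
  obtain ⟨X, hm⟩ := hG.exists_spanModel h
  -- It suffices to shrink one vertex, `0`, and its three neighbours.
  obtain ⟨X, hm, hF⟩ := (hG.shrink_prism (F := ∅) 0 (by simp) hm (by simp)).resolve_left hn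
  obtain ⟨X, hm, hF⟩ := (hG.shrink_prism 2 (by decide) hm hF).resolve_left hn
  obtain ⟨X, hm, hF⟩ := (hG.shrink_prism 4 (by decide) hm hF).resolve_left hn
  obtain ⟨X, hm, hF⟩ := (hG.shrink_prism 3 (by decide) hm hF).resolve_left hn
  obtain ⟨u, hu⟩ := hF 0 (by simp)
  obtain ⟨a, ha⟩ := hF 2 (by simp)
  obtain ⟨b, hb⟩ := hF 4 (by simp)
  obtain ⟨c, hc⟩ := hF 3 (by simp)
  have hne : ∀ {k l x y}, X k = {x} → X l = {y} → k ≠ l → x ≠ y := by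
    rintro k l x y hk hl hkl rfl
    exact hkl (hm.eq_of_mem (x := x) (hk ▸ rfl) (hl ▸ rfl))
  refine ⟨u, a, b, c, hne ha hb (by decide), hne ha hc (by decide), hne hb hc (by decide), ?_,
    hm.adj_iff hu ha hb hc (by decide) (by decide) (by decide) fun k h0 h1 h2 h3 h =>
      hn (hm.isMinor_of_prism_extra h0 h3 h1 h2 h)⟩
  obtain ⟨p, hp, q, hq, hpq⟩ := hm.touch 2 4 (by decide)
  rw [ha] at hp
  rw [hb] at hq
  rwa [← Set.mem_singleton_iff.mp hp, ← Set.mem_singleton_iff.mp hq]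

end Cubic

end SimpleGraph

namespace SimpleGraph

/-! ### Well-linked graphs with a 4-wheel minor. -/

section Wheel

variable {V : Type*} {G : SimpleGraph V}

instance : DecidableRel (wheelGraph 4).Adj
  | none, none => .isFalse id
  | none, some _ => .isTrue trivial
  | some _, none => .isTrue trivial
  | some i, some j => inferInstanceAs (Decidable ((cycleGraph 4).Adj i j))

variable {X : Option (Fin 4) → Set V}

theorem SpanModel.isMinor_of_hub_split (hm : SpanModel (wheelGraph 4) G X) {Y Z : Set V}
    (h : G.IsSplit (X none) Y Z) {j : Fin 4} (hY : ∀ k, k ≠ j → G.Touch Y (X (some k)))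
    {p q : Fin 4} (hpq : p ≠ q) (hp : G.Touch Z (X (some p))) (hq : G.Touch Z (X (some q))) :
    IsMinor K5Minus G := by
  obtain ⟨a, b, hab, ha, hb⟩ : ∃ a b : Fin 4, a < b ∧ G.Touch Z (X (some (j + a))) ∧
      G.Touch Z (X (some (j + b))) := by
    rcases lt_or_gt_of_ne (fun h => hpq (sub_left_injective h) : p - j ≠ q - j) with h | h
    · exact ⟨_, _, h, by simpa using hp, by simpa using hq⟩
    · exact ⟨_, _, h, by simpa using hq, by simpa using hp⟩
  have hg : ∀ j : Fin 4,
      Function.Injective ![some j, some (j + 1), some (j + 2), some (j + 3)] := by decide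
  have hi : ∀ j : Fin 4, ∀ a, ![some j, some (j + 1), some (j + 2), some (j + 3)] a ≠ none := by
    decide
  have hadj : ∀ j, (wheelGraph 4).Adj (some j) (some (j + 1)) := by decide
  have hadj' : ∀ j, (wheelGraph 4).Adj (some (j + 3)) (some j) ∧
    (wheelGraph 4).Adj (some (j + 1)) (some (j + 2)) ∧
    (wheelGraph 4).Adj (some (j + 2)) (some (j + 3)) := by decide
  have hj : ∀ j : Fin 4, j + 1 ≠ j ∧ j + 2 ≠ j ∧ j + 3 ≠ j := by decide
  let E : Fin 4 → Fin 4 → List (Fin 6 × Fin 6) := fun a b =>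
    [(0,1),(2,3),(3,4),(4,5),(5,2),(0,3),(0,4),(0,5),
      (1,![2,3,4,5] a),(1,![2,3,4,5] b)]
  -- One merging for each position `a < b`, relative to `j`, of two rim sets touched by `Z`; the
  -- zero entries are placeholders for `a ≥ b`.
  let f : Fin 4 → Fin 4 → Fin 6 → Fin 5 := fun a b =>
    ![![0, ![2,0,3,4,1,3], ![2,0,3,1,4,3], ![2,0,3,3,1,4]],
      ![0, 0, ![2,0,1,3,4,1], ![2,0,3,3,1,4]], ![0, 0, 0, ![2,0,1,1,3,4]], 0] a b
  have h1 : ∀ a b, a < b → ∀ u v, f a b u = f a b v → u ≠ v → (u, v) ∈ E a b ∨ (v, u) ∈ E a b := by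
    decide
  have h2 : ∀ a b, a < b → ∀ k l, k < l → l ≠ 1 →
      ∃ e ∈ E a b, f a b e.1 = k ∧ f a b e.2 = l ∨ f a b e.2 = k ∧ f a b e.1 = l := by
    decide
  have key : ∀ c : Fin 4, G.Touch Z (X (some (j + c))) → G.Touch Z
      (Matrix.vecCons Y (Matrix.vecCons Z fun a => X (![some j, some (j + 1), some (j + 2),
        some (j + 3)] a)) (![2,3,4,5] c)) := by
    intro c hc
    fin_cases c
    · exact add_zero j ▸ hc
    · exact hc
    · exact hc
    · exact hc
  refine isMinor_K5Minus_of_map (hm.family_split h (hg j) (hi j)) (E a b) (f a b) (h1 a b hab)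
    (h2 a b hab) ?_
  simp only [E, List.forall_mem_cons]
  exact ⟨h.touch (hm.conn none), hm.touch _ _ (hadj j), hm.touch _ _ (hadj' j).2.1,
    hm.touch _ _ (hadj' j).2.2, hm.touch _ _ (hadj' j).1, hY _ (hj j).1, hY _ (hj j).2.1,
    hY _ (hj j).2.2, key a ha, key b hb, by simp⟩

/-- If `p`, `q` are consecutive on the rim, then `Y, p, q` and `Z, k, l` are the triangles of a
prism. If they are opposite, then `Y, k, l` and `Z, p, q` are the sides of a K₃,₃. -/
theorem SpanModel.isMinor_of_hub_split_pairs (hm : SpanModel (wheelGraph 4) G X) {Y Z : Set V}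
    (h : G.IsSplit (X none) Y Z) {p q k l : Fin 4}
    (hp : G.Touch Y (X (some p))) (hq : G.Touch Y (X (some q))) (hk : G.Touch Z (X (some k)))
    (hl : G.Touch Z (X (some l))) (hg : Function.Injective ![p, q, k, l]) :
    IsMinor prism G ∨ IsMinor K33 G := by
  have hg' : Function.Injective ![some p, some q, some k, some l] := by
    have : ![some p, some q, some k, some l] = some ∘ ![p, q, k, l] := by
      ext1 a
      fin_cases a <;> rfl
    rw [this]
    exact (Option.some_injective _).comp hg
  have hi : ∀ a, ![some p, some q, some k, some l] a ≠ none := by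
    intro a
    fin_cases a <;> simp
  have hR := hm.family_split h hg' hi
  have hYZ := h.touch (hm.conn none)
  have hcase : (wheelGraph 4).Adj (some p) (some q) ∧ (wheelGraph 4).Adj (some k) (some l) ∧
        (wheelGraph 4).Adj (some p) (some l) ∧ (wheelGraph 4).Adj (some q) (some k) ∨
      (wheelGraph 4).Adj (some p) (some q) ∧ (wheelGraph 4).Adj (some k) (some l) ∧
        (wheelGraph 4).Adj (some p) (some k) ∧ (wheelGraph 4).Adj (some q) (some l) ∨
      (wheelGraph 4).Adj (some p) (some k) ∧ (wheelGraph 4).Adj (some p) (some l) ∧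
        (wheelGraph 4).Adj (some q) (some k) ∧ (wheelGraph 4).Adj (some q) (some l) := by
    clear * - hg
    revert p q k l
    decide
  rcases hcase with ⟨h1, h2, h3, h4⟩ | ⟨h1, h2, h3, h4⟩ | ⟨h1, h2, h3, h4⟩
  · left
    refine isMinor_of_injective hR [(0,1),(0,2),(0,3),(1,4),(1,5),(2,3),(4,5),(2,5),(3,4)]
      ![0,4,2,1,3,5] (by decide) (by decide) ?_
    simp only [List.forall_mem_cons]
    exact ⟨hYZ, hp, hq, hk, hl, hm.touch _ _ h1, hm.touch _ _ h2, hm.touch _ _ h3,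
      hm.touch _ _ h4, by simp⟩
  · left
    refine isMinor_of_injective hR [(0,1),(0,2),(0,3),(1,4),(1,5),(2,3),(4,5),(2,4),(3,5)]
      ![0,5,2,1,3,4] (by decide) (by decide) ?_
    simp only [List.forall_mem_cons]
    exact ⟨hYZ, hp, hq, hk, hl, hm.touch _ _ h1, hm.touch _ _ h2, hm.touch _ _ h3,
      hm.touch _ _ h4, by simp⟩
  · right
    refine isMinor_of_injective hR [(0,1),(0,2),(0,3),(1,4),(1,5),(2,4),(2,5),(3,4),(3,5)]
      ![0,1,4,2,5,3] (by decide) (by decide) ?_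
    simp only [List.forall_mem_cons]
    exact ⟨hYZ, hp, hq, hk, hl, hm.touch _ _ h1, hm.touch _ _ h2, hm.touch _ _ h3,
      hm.touch _ _ h4, by simp⟩

/-- When the hub is cut in two, either `Y` misses at most one rim set, which gives K₅⁻, or it misses
two, which `Z` must touch. A triple is impossible because the hub has four labels. -/
theorem WellLinked.shrink_hub [Finite V] (hG : G.WellLinked)
    (hm : SpanModel (wheelGraph 4) G X) :
    (IsMinor K5Minus G ∨ IsMinor prism G ∨ IsMinor K33 G) ∨
      ∃ X', SpanModel (wheelGraph 4) G X' ∧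
        ∀ j ∈ insert none (∅ : Set (Option (Fin 4))), ∃ x, X' j = {x} := by
  refine hG.shrink (by simp) (by decide) (fun X hm _ Y Z h hY hZ => .inl ?_)
    (fun X hm _ P j h => ?_) hm (by simp)
  · have hlab : ∀ T, (G.labels X none T).Nontrivial →
        ∃ p q : Fin 4, p ≠ q ∧ G.Touch T (X (some p)) ∧ G.Touch T (X (some q)) := by
      rintro T ⟨_ | p, hp, _ | q, hq, hpq⟩
      · exact absurd rfl hpq
      · exact absurd rfl hp.1
      · exact absurd rfl hq.1
      · exact ⟨p, q, fun h => hpq (h ▸ rfl), hp.2, hq.2⟩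
    obtain ⟨p, q, hpq, hp, hq⟩ := hlab Y hY
    obtain ⟨p', q', hpq', hp', hq'⟩ := hlab Z hZ
    by_cases hA : ∃ j, ∀ k, k ≠ j → G.Touch Y (X (some k))
    · obtain ⟨j, hj⟩ := hA
      exact .inl (hm.isMinor_of_hub_split h hj hpq' hp' hq')
    push Not at hA
    have hcov : ∀ k, ¬ G.Touch Y (X (some k)) → G.Touch Z (X (some k)) := fun k hk => by
      have := hm.touch none (some k) trivial
      rw [← h.union, touch_union_left] at this
      exact this.resolve_left hk
    obtain ⟨k, hkp, hk⟩ := hA p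
    obtain ⟨l, hlk, hl⟩ := hA k
    refine .inr (hm.isMinor_of_hub_split_pairs h hp hq (hcov k hk) (hcov l hl) ?_)
    have h1 : q ≠ k := fun h => hk (h ▸ hq)
    have h2 : q ≠ l := fun h => hl (h ▸ hq)
    have h3 : p ≠ l := fun h => hl (h ▸ hp)
    have : ∀ p q k l : Fin 4, p ≠ q ∧ k ≠ p ∧ l ≠ k ∧ q ≠ k ∧ q ≠ l ∧ p ≠ l →
      Function.Injective ![p, q, k, l] := by decide
    exact this p q k l ⟨hpq, hkp, hlk, h1, h2, h3⟩
  · have hmem : ∀ k : Fin 4, ∃ t, some k = j t := fun k =>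
      h.total _ ⟨by simp, hm.touch none (some k) trivial⟩
    choose t ht using hmem
    have hinj : Function.Injective t := fun a b hab =>
      Option.some_injective _ ((ht a).trans (hab ▸ (ht b).symm))
    have := Fintype.card_le_of_injective t hinj
    simp at this

theorem SpanModel.isMinor_of_rim_extra (hm : SpanModel (wheelGraph 4) G X) {i : Fin 4}
    {k : Option (Fin 4)} (h0 : k ≠ some i) (h1 : k ≠ none) (h2 : k ≠ some (i + 1))
    (h3 : k ≠ some (i + 3)) (h : G.Touch (X (some i)) (X k)) : IsMinor K5Minus G := by
  have hk : ∀ (i : Fin 4) (k : Option (Fin 4)), k ≠ some i → k ≠ none → k ≠ some (i + 1) →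
    k ≠ some (i + 3) → k = some (i + 2) := by decide
  obtain rfl := hk i k h0 h1 h2 h3
  have hg : ∀ i : Fin 4,
    Function.Injective ![some i, none, some (i + 1), some (i + 2), some (i + 3)] := by decide
  have hadj : ∀ i, (wheelGraph 4).Adj (some i) (some (i + 1)) ∧
    (wheelGraph 4).Adj (some (i + 1)) (some (i + 2)) ∧
    (wheelGraph 4).Adj (some (i + 2)) (some (i + 3)) ∧
    (wheelGraph 4).Adj (some (i + 3)) (some i) := by decide
  refine isMinor_K5Minus_of_map (hm.family (hg i))
    [(0,1),(1,2),(1,3),(1,4),(0,2),(2,3),(3,4),(4,0),(0,3)] ![2,3,0,4,1]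
    (by decide) (by decide) ?_
  simp only [List.forall_mem_cons]
  exact ⟨hm.touch _ _ trivial, hm.touch _ _ trivial, hm.touch _ _ trivial, hm.touch _ _ trivial,
    hm.touch _ _ (hadj i).1, hm.touch _ _ (hadj i).2.1, hm.touch _ _ (hadj i).2.2.1,
    hm.touch _ _ (hadj i).2.2.2, h, by simp⟩

theorem SpanModel.isMinor_of_rim_split (hm : SpanModel (wheelGraph 4) G X) {i p o q : Fin 4}
    (hg : Function.Injective ![none, some p, some o, some q])
    (hi : ∀ a, ![none, some p, some o, some q] a ≠ some i)
    (hpo : (wheelGraph 4).Adj (some p) (some o)) (hoq : (wheelGraph 4).Adj (some o) (some q))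
    {Y Z : Set V} (h : G.IsSplit (X (some i)) Y Z) (hYp : G.Touch Y (X (some p)))
    (hYh : G.Touch Y (X none)) (hZp : G.Touch Z (X (some p))) (hZq : G.Touch Z (X (some q))) :
    IsMinor K5Minus G := by
  refine isMinor_K5Minus_of_map (hm.family_split h hg hi)
    [(0,1),(2,3),(2,4),(2,5),(3,4),(4,5),(0,2),(0,3),(1,3),(1,5)] ![0,2,3,4,1,2]
    (by decide) (by decide) ?_
  simp only [List.forall_mem_cons]
  exact ⟨h.touch (hm.conn _), hm.touch _ _ trivial, hm.touch _ _ trivial, hm.touch _ _ trivial,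
    hm.touch _ _ hpo, hm.touch _ _ hoq, hYh, hYp, hZp, hZq, by simp⟩

theorem SpanModel.isMinor_of_rim_triple (hm : SpanModel (wheelGraph 4) G X) {i : Fin 4}
    {P : Fin 3 → Set V} {j : Fin 3 → Option (Fin 4)} (h : G.IsTriple X (some i) P j)
    {a b c : Fin 3} (hab : a ≠ b) (hac : a ≠ c) (hbc : b ≠ c) (ha : G.Touch (P a) (X none))
    (hb : G.Touch (P b) (X (some (i + 1)))) (hc : G.Touch (P c) (X (some (i + 3)))) :
    IsMinor K5Minus G := by
  have hg : ∀ i : Fin 4, Function.Injective ![none, some (i + 1), some (i + 3), some (i + 2)] := by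
    decide
  have hi : ∀ i : Fin 4, ∀ a, ![none, some (i + 1), some (i + 3), some (i + 2)] a ≠ some i := by
    decide
  have hadj : ∀ i, (wheelGraph 4).Adj (some (i + 1)) (some (i + 2)) ∧
    (wheelGraph 4).Adj (some (i + 3)) (some (i + 2)) := by decide
  refine isMinor_K5Minus_of_map (hm.family_triple h hab hac hbc (hg i) (hi i))
    [(0,1),(0,2),(1,2),(0,3),(1,4),(2,5),(3,4),(3,5),(3,6),(4,6),(5,6)] ![0,2,3,4,2,3,1]
    (by decide) (by decide) ?_
  simp only [List.forall_mem_cons]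
  exact ⟨h.touch _ _ hab, h.touch _ _ hac, h.touch _ _ hbc, ha, hb, hc, hm.touch _ _ trivial,
    hm.touch _ _ trivial, hm.touch _ _ trivial, hm.touch _ _ (hadj i).1, hm.touch _ _ (hadj i).2,
    by simp⟩

/-- Cuts whose shared label is a rim neighbour give K₅⁻. If the hub is the shared label, no such
minor is claimed; instead the part touching `i + 1` is moved to that branch set, which is why `some
(i + 1)` must not yet be fixed. -/
theorem WellLinked.shrink_rim [Finite V] (hG : G.WellLinked) {F : Set (Option (Fin 4))}
    (i : Fin 4) (hi : some i ∉ F) (hi' : some (i + 1) ∉ F) (hm : SpanModel (wheelGraph 4) G X)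
    (hF : ∀ j ∈ F, ∃ x, X j = {x}) :
    IsMinor K5Minus G ∨
      ∃ X', SpanModel (wheelGraph 4) G X' ∧ ∀ j ∈ insert (some i) F, ∃ x, X' j = {x} := by
  have hadj : ∀ i, (wheelGraph 4).Adj (some i) none ∧
    (wheelGraph 4).Adj (some i) (some (i + 1)) ∧ (wheelGraph 4).Adj (some i) (some (i + 3)) := by
    decide
  have hne : ∀ i : Fin 4, some (i + 1) ≠ some (i + 3) := by decide
  have hnbr : ∀ i k, (wheelGraph 4).Adj (some i) k → k = none ∨ k = some (i + 1) ∨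
    k = some (i + 3) := by decide
  refine hG.shrink_cubic hi (hadj i).1 (hadj i).2.1 (hadj i).2.2 (by simp) (by simp) (hne i)
    (fun X hm k h0 h1 h3 h5 => hm.isMinor_of_rim_extra h0 h1 h3 h5)
    (fun X hm P j h a b c => hm.isMinor_of_rim_triple h)
    (fun X hm hF Y Z h h1 h2 h3 h4 => .inr ?_)
    (fun X hm Y Z h => hm.isMinor_of_rim_split (o := i + 2) ?_ ?_ ?_ ?_ h)
    (fun X hm Y Z h => hm.isMinor_of_rim_split (o := i + 2) ?_ ?_ ?_ ?_ h)
    hm hF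
  · refine hm.exists_move hF hi hi' (hadj i).2.1.ne' h.symm h2 fun k hk hk' => ?_
    rcases hnbr i k hk with rfl | rfl | rfl
    exacts [h3, absurd rfl hk', h4]
  all_goals (clear * -; revert i; decide)

/-- A well-linked graph with a `W₄` minor has a `K₅⁻` minor, a vertex with three neighbours, two
of which are adjacent, or two vertices with the same three neighbours. -/
theorem WellLinked.cubic_of_isMinor_wheelGraph [Finite V] (hG : G.WellLinked)
    (h : IsMinor (wheelGraph 4) G) (hn : ¬ IsMinor K5Minus G) :
    (∃ u a b c, a ≠ b ∧ a ≠ c ∧ b ≠ c ∧ G.Adj a b ∧ ∀ y, G.Adj u y ↔ y = a ∨ y = b ∨ y = c) ∨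
    ∃ u v a b c, u ≠ v ∧ a ≠ b ∧ a ≠ c ∧ b ≠ c ∧
      (∀ y, G.Adj u y ↔ y = a ∨ y = b ∨ y = c) ∧ ∀ y, G.Adj v y ↔ y = a ∨ y = b ∨ y = c := by
  obtain ⟨X, hm⟩ := hG.exists_spanModel h
  rcases hG.shrink_hub hm with (h | h | h) | ⟨X, hm, hF⟩
  · exact absurd h hn
  · exact .inl ((hG.cubic_of_isMinor_prism h).resolve_left hn)
  · exact .inr ((hG.twins_of_isMinor_K33 h).resolve_left hn)
  left
  -- The order `1, 2, 3` leaves the next rim vertex free at each step, and `0` is never shrunk. The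
  -- vertex sought is rim vertex `2`, adjacent to the hub, `3` and `1`.
  obtain ⟨X, hm, hF⟩ := (hG.shrink_rim 1 (by decide) (by decide) hm hF).resolve_left hn
  obtain ⟨X, hm, hF⟩ := (hG.shrink_rim 2 (by decide) (by decide) hm hF).resolve_left hn
  obtain ⟨X, hm, hF⟩ := (hG.shrink_rim 3 (by decide) (by decide) hm hF).resolve_left hn
  obtain ⟨u, hu⟩ := hF (some 2) (by simp)
  obtain ⟨a, ha⟩ := hF none (by simp)
  obtain ⟨b, hb⟩ := hF (some 3) (by simp)
  obtain ⟨c, hc⟩ := hF (some 1) (by simp)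
  have hne : ∀ {k l x y}, X k = {x} → X l = {y} → k ≠ l → x ≠ y := by
    rintro k l x y hk hl hkl rfl
    exact hkl (hm.eq_of_mem (x := x) (hk ▸ rfl) (hl ▸ rfl))
  refine ⟨u, a, b, c, hne ha hb (by decide), hne ha hc (by decide), hne hb hc (by decide), ?_,
    hm.adj_iff hu ha hb hc (by decide) (by decide) (by decide) fun k h0 h1 h2 h3 h =>
      hn (hm.isMinor_of_rim_extra (i := 2) h0 h1 h2 h3 h)⟩
  obtain ⟨p, hp, q, hq, hpq⟩ := hm.touch none (some 3) trivial
  rw [ha] at hp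
  rw [hb] at hq
  rwa [← Set.mem_singleton_iff.mp hp, ← Set.mem_singleton_iff.mp hq]

end Wheel

end SimpleGraph

namespace SimpleGraph

universe u

section Cubic

variable {V : Type*} {G : SimpleGraph V}

/-- Adding a vertex whose neighbourhood is a clique. -/
theorem TDOn.insert_of_clique [Finite V] {S K : Set V} {k : ℕ} {u : V} (h : G.TDOn S k)
    (hu : u ∉ S) (hKS : K ⊆ S) (hK : ∀ x ∈ K, ∀ y ∈ K, x ≠ y → G.Adj x y)
    (hN : ∀ y, G.Adj u y → y ∈ K) (hk : K.ncard + 1 ≤ k) : G.TDOn (insert u S) k := by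
  have hB : G.TDOn (insert u K) k := tdOn_of_ncard_le ((Set.ncard_insert_le u K).trans hk)
  have hint : ∀ x ∈ S ∩ insert u K, x ∈ K := by
    rintro x ⟨hx, rfl | hx'⟩
    exacts [absurd hx hu, hx']
  have := h.glue hB (fun x hx y hy => hK x (hint x hx) y (hint y hy)) (by
    rintro ⟨x, hx, y, ⟨rfl | hy, hyS⟩, hxy⟩
    · exact hx.2 (.inr (hN x hxy.symm))
    · exact hyS (hKS hy))
  rwa [Set.union_insert, Set.union_eq_self_of_subset_right hKS] at this

/-- The graph obtained by making `K` a clique. -/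
def fill (G : SimpleGraph V) (K : Set V) : SimpleGraph V := G ⊔ fromRel fun x y => x ∈ K ∧ y ∈ K

theorem fill_adj {K : Set V} {x y : V} :
    (G.fill K).Adj x y ↔ G.Adj x y ∨ x ≠ y ∧ x ∈ K ∧ y ∈ K := by
  simp only [fill, sup_adj, fromRel_adj]
  tauto

theorem fill_clique {K : Set V} : ∀ x ∈ K, ∀ y ∈ K, x ≠ y → (G.fill K).Adj x y :=
  fun _ hx _ hy hxy => fill_adj.mpr (.inr ⟨hxy, hx, hy⟩)

theorem ncard_triple_le (a b c : V) : ({a, b, c} : Set V).ncard + 1 ≤ 4 := by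
  have h1 := Set.ncard_insert_le a {b, c}
  have h2 := Set.ncard_insert_le b {c}
  rw [Set.ncard_singleton] at h2
  omega

end Cubic

/-! ### Removing cubic vertices, and the two inductions. -/

section Reduce

variable {V : Type u} [Finite V] {W : Type*} {H : SimpleGraph W} {G : SimpleGraph V}

/-- Contracting `u` into `c` joins `c` to `a` and `b`; with the edge `ab`, the neighbourhood is a
clique. Then `u` returns in a bag with it, of size at most 4 ≤ η. -/
theorem tdOn_of_cubic (hG : G.InducedMinorFree H)
    (ih : ∀ (V' : Type u) [Finite V'] (G' : SimpleGraph V'), Nat.card V' < Nat.card V →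
      G'.InducedMinorFree H → G'.TDOn Set.univ G'.hadwigerNumber)
    (h4 : 4 ≤ G.hadwigerNumber) {u a b c : V} (hab : G.Adj a b)
    (hu : ∀ y, G.Adj u y ↔ y = a ∨ y = b ∨ y = c) : G.TDOn Set.univ G.hadwigerNumber := by
  have huK : u ∉ ({a, b, c} : Set V) := fun h => G.irrefl ((hu u).mpr h)
  have htouch : ∀ y ∈ ({a, b, c} : Set V), G.Touch {u} {y} := fun y hy =>
    ⟨u, rfl, y, rfl, (hu y).mpr hy⟩
  have h1 : (G.fill {a, b, c}).TDOn {u}ᶜ G.hadwigerNumber := by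
    refine tdOn_of_contract_into hG ih (connSet_singleton u) disjoint_compl_left
      (htouch c (by simp)) fun x _ y _ hxy => ?_
    rcases fill_adj.mp hxy with h | ⟨hne, hx, hy⟩
    · exact .inl h
    by_cases hxc : x = c
    · exact .inr (.inl ⟨hxc, htouch y hy⟩)
    by_cases hyc : y = c
    · exact .inr (.inr ⟨hyc, htouch x hx⟩)
    left
    rcases hx with rfl | rfl | rfl <;> rcases hy with rfl | rfl | rfl <;>
      first | exact absurd rfl ‹_› | exact hab | exact hab.symm
  have h2 := h1.insert_of_clique (u := u) (by simp)
    (Set.subset_compl_singleton_iff.mpr huK) fill_clique (fun y hy => by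
      rcases fill_adj.mp hy with h | ⟨-, h, -⟩
      exacts [(hu y).mp h, absurd h huK]) ((ncard_triple_le a b c).trans h4)
  rw [show insert u ({u}ᶜ : Set V) = Set.univ from Set.union_compl_self {u}] at h2
  exact h2.mono (fun _ _ _ _ h => fill_adj.mpr (.inl h)) le_rfl

/-- Contracting `u` into `a` and `v` into `b` makes the common neighbourhood a clique without any
edge being given there. Both vertices return in bags of size at most 4. -/
theorem tdOn_of_twins (hG : G.InducedMinorFree H)
    (ih : ∀ (V' : Type u) [Finite V'] (G' : SimpleGraph V'), Nat.card V' < Nat.card V →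
      G'.InducedMinorFree H → G'.TDOn Set.univ G'.hadwigerNumber)
    (h4 : 4 ≤ G.hadwigerNumber) {u v a b c : V} (huv : u ≠ v) (hab : a ≠ b)
    (hu : ∀ y, G.Adj u y ↔ y = a ∨ y = b ∨ y = c) (hv : ∀ y, G.Adj v y ↔ y = a ∨ y = b ∨ y = c) :
    G.TDOn Set.univ G.hadwigerNumber := by
  classical
  have huK : u ∉ ({a, b, c} : Set V) := fun h => G.irrefl ((hu u).mpr h)
  have hvK : v ∉ ({a, b, c} : Set V) := fun h => G.irrefl ((hv v).mpr h)
  have hKA : ({a, b, c} : Set V) ⊆ {u, v}ᶜ := by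
    rintro x hx (rfl | rfl)
    exacts [huK hx, hvK hx]
  have h1 : (G.fill {a, b, c}).TDOn {u, v}ᶜ G.hadwigerNumber := by
    have hmem : ∀ x, x ∈ (if x = a then {a, u} else if x = b then {b, v} else {x} : Set V) := by
      intro x; split_ifs with h h <;> simp [h]
    refine tdOn_of_contract (A := {u, v}ᶜ) hG ih (fun h =>
        Set.eq_univ_iff_forall.mp h u (.inl rfl))
      (fun x => if x = a then {a, u} else if x = b then {b, v} else {x}) ?_ ?_ ?_
    · intro x hx y hy hxy
      have h1 : x ≠ u ∧ x ≠ v := by simpa using hx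
      have h2 : y ≠ u ∧ y ≠ v := by simpa using hy
      rw [Set.disjoint_left]
      intro z hz hz'
      split_ifs at hz hz' <;> simp only [Set.mem_insert_iff, Set.mem_singleton_iff] at hz hz' <;>
        grind
    · intro x _
      split_ifs
      · rw [Set.pair_comm]
        exact (connSet_singleton a).insert ⟨a, rfl, u, rfl, ((hu a).mpr (.inl rfl)).symm⟩
      · rw [Set.pair_comm]
        exact (connSet_singleton b).insert ⟨b, rfl, v, rfl, ((hv b).mpr (.inr (.inl rfl))).symm⟩
      · exact connSet_singleton x
    · have hleft : ∀ x ∈ ({a, b, c} : Set V), ∀ y ∈ ({a, b, c} : Set V), x = a ∨ x = b →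
          G.Touch (if x = a then {a, u} else if x = b then {b, v} else {x} : Set V)
            (if y = a then {a, u} else if y = b then {b, v} else {y} : Set V) := by
        rintro x - y hy (rfl | rfl)
        · exact ⟨u, by simp, y, hmem y, (hu y).mpr hy⟩
        · exact ⟨v, by simp [hab.symm], y, hmem y, (hv y).mpr hy⟩
      intro x _ y _ hxy
      rcases fill_adj.mp hxy with h | ⟨hne, hx, hy⟩
      · exact ⟨x, hmem x, y, hmem y, h⟩
      by_cases hx' : x = a ∨ x = b
      · exact hleft x hx y hy hx'
      by_cases hy' : y = a ∨ y = b
      · exact (hleft y hy x hx hy').symm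
      simp only [Set.mem_insert_iff, Set.mem_singleton_iff] at hx hy
      exact absurd ((by tauto : x = c).trans (by tauto : c = y)) hne
  have h2 := h1.insert_of_clique (u := v) (by simp) hKA fill_clique (fun y hy => by
      rcases fill_adj.mp hy with h | ⟨-, h, -⟩
      exacts [(hv y).mp h, absurd h hvK]) ((ncard_triple_le a b c).trans h4)
  have h3 := h2.insert_of_clique (u := u) (by simp [huv]) (hKA.trans (Set.subset_insert _ _))
    fill_clique (fun y hy => by
      rcases fill_adj.mp hy with h | ⟨-, h, -⟩
      exacts [(hu y).mp h, absurd h huK]) ((ncard_triple_le a b c).trans h4)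
  have huniv : insert u (insert v ({u, v}ᶜ : Set V)) = Set.univ := by
    ext x
    simp only [Set.mem_insert_iff, Set.mem_compl_iff, Set.mem_singleton_iff, Set.mem_univ]
    tauto
  rw [huniv] at h3
  exact h3.mono (fun _ _ _ _ h => fill_adj.mpr (.inl h)) le_rfl

theorem isMinor_completeGraph_wheelGraph : IsMinor (completeGraph (Fin 4)) (wheelGraph 4) := by
  -- Contract the rim edge between `2` and `3`.
  let g : Option (Fin 4) → Fin 4 := fun x => x.elim 0 ![1, 2, 3, 3]
  have hne : ∀ k, ∃ x, g x = k := by decide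
  have hg : ∀ x y, g x = g y → x ≠ y → (wheelGraph 4).Adj x y := by decide
  have hadj : ∀ k l, k ≠ l → ∃ x, g x = k ∧ ∃ y, g y = l ∧ (wheelGraph 4).Adj x y := by decide
  exact ⟨fun k => {x | g x = k},
    fun k l h => Set.disjoint_left.mpr fun x (hk : g x = k) hl => h (hk.symm.trans hl),
    fun k => connSet_iff.mp (connSet_of_pairwise (hne k) fun x hx y hy h =>
      hg x y (Eq.trans hx (Eq.symm hy)) h), fun k l h => hadj k l h.ne⟩

theorem tdOn_of_free_wheelGraph (hG : G.InducedMinorFree (wheelGraph 4)) :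
    G.TDOn Set.univ G.hadwigerNumber := by
  induction hn : Nat.card V using Nat.strong_induction_on generalizing V with
  | _ n ih =>
    rcases tdOn_or_wellLinked hG (fun V' _ G' h hG' => ih _ (hn ▸ h) hG' rfl) with h | ⟨h, hne⟩
    · exact h
    · exact absurd (h.isInducedMinor_wheelGraph hne) hG

/-- The bound η ≥ 4 needed for putting cubic vertices back comes from the W₄ minor, which contains
K₄. -/
theorem tdOn_of_free_K5Minus (hG : G.InducedMinorFree K5Minus) :
    G.TDOn Set.univ G.hadwigerNumber := by
  induction hn : Nat.card V using Nat.strong_induction_on generalizing V with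
  | _ n ih =>
    have ih' : ∀ (V' : Type u) [Finite V'] (G' : SimpleGraph V'), Nat.card V' < Nat.card V →
        G'.InducedMinorFree K5Minus → G'.TDOn Set.univ G'.hadwigerNumber :=
      fun V' _ G' h hG' => ih _ (hn ▸ h) hG' rfl
    rcases tdOn_or_wellLinked hG ih' with h | ⟨hw, v, w, hne, hvw⟩
    · exact h
    by_cases h5 : 5 ≤ G.hadwigerNumber
    · exact absurd (hw.complete_of_five_le hG h5 v w hne) hvw
    have hmin : ¬ IsMinor K5Minus G := fun h => hG (h.isInducedMinor_K5Minus (by omega))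
    have hwheel := (hw.isInducedMinor_wheelGraph ⟨v, w, hne, hvw⟩).isMinor
    have h4 : 4 ≤ G.hadwigerNumber :=
      (isGreatest_hadwigerNumber G).2 (isMinor_completeGraph_wheelGraph.trans hwheel)
    rcases hw.cubic_of_isMinor_wheelGraph hwheel hmin with
      ⟨u, a, b, c, hab, hac, hbc, h, hu⟩ | ⟨u, v, a, b, c, huv, hab, hac, hbc, hu, hv⟩
    · exact tdOn_of_cubic hG ih' h4 h hu
    · exact tdOn_of_twins hG ih' h4 huv hab hu hv

end Reduce

end SimpleGraph

theorem mainTheorem11 {V : Type*} [Finite V] (G : SimpleGraph V) :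
    (G.InducedMinorFree SimpleGraph.K5Minus →
      G.treewidth = (G.hadwigerNumber : ℤ) - 1) ∧
    (G.InducedMinorFree (SimpleGraph.wheelGraph 4) →
      G.treewidth = (G.hadwigerNumber : ℤ) - 1) :=
  ⟨fun h => le_antisymm (SimpleGraph.tdOn_of_free_K5Minus h).treewidth_le
      G.hadwigerNumber_sub_one_le_treewidth,
    fun h => le_antisymm (SimpleGraph.tdOn_of_free_wheelGraph h).treewidth_le
      G.hadwigerNumber_sub_one_le_treewidth⟩
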